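/- Let $D\ge 1$ and let $M=(M_b)_{b=1}^B$ be an extremal $D$-dimensional POVM, i.e. an extreme point of the convex set of $B$-tuples of positive semidefinite $D\times D$ complex matrices with $\sum_b M_b=\mathbb I$. For each $b$ let $|\psi^b_1\rangle,\dots,|\psi^b_{d_b}\rangle$ be an orthonormal basis of $\ker M_b$, so that $Z_b=\sum_{i}|\psi_i^b\rangle\langle\psi_i^b|$ is the projector onto $\ker M_b$. Let $\phi=(\phi_x)_{x=1}^N$ be a finite family of pure states (rank-one projectors) on $\mathbb C^D$ and let $\alpha_x>0$ be real numbers with $\sum_x\alpha_x\phi_x=\mathbb I/D$. Suppose that the family contains every kernel state $|\psi_i^b\rangle\langle\psi_i^b|$, and fix for each $(i,b)$ an index $x=(i,b)$ at which it occurs. If $D>2$, suppose also that, for some orthonormal basis $e_1,\dots,e_D$ of $\mathbb C^D$ with $\langle e_k,\psi_i^b\rangle\neq0$ for all $k,i,b$, the family contains the fiducial set $\mathcal T$ of the projectors onto the vectors $$e_k,\quad \tfrac{e_k+e_{k+1}}{\sqrt2},\quad \tfrac{e_k+\mathrm i e_{k+1}}{\sqrt2},\quad \tfrac{e_k+e_{k+1}+e_{k+2}}{\sqrt3},\quad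 \tfrac{\mathrm i e_k+e_{k+1}+\mathrm i e_{k+2}}{\sqrt3}$$ (for all $k$ for which the indices lie in $\{1,\dots,D\}$). Consider the prepare-and-measure scenario with $N$ preparations, one dichotomic measurement $y=(i,j)$ for each pair $i>j$ in $\{1,\dots,N\}$, and one further measurement $y=Y$ with $B$ outcomes. A $D$-dimensional realization consists of density matrices $\bar\phi_x$ on $\mathbb C^D$ and of POVMs $(\bar M_{b|y})_b$ on $\mathbb C^D$; it generates $P(b|x,y)=\operatorname{tr}(\bar\phi_x\bar M_{b|y})$. Define the linear witness $$W_M(P)=\sum_{i>j}\alpha_i\alpha_j\|\phi_i-\phi_j\|_1\bigl(P(2|x=i,y=(i,j))-P(2|x=j,y=(i,j))\bigr)-\sum_{b}\sum_{i=1}^{d_b}P(b|x=(i,b),y=Y).$$ Then the following hold. 1. The maximum of $W_M(P)$ over all $P$ generated by $D$-dimensional realizations is $1-\frac1D$, and it is attained. 2. There is a constant $C>0$, depending only on the reference data (on $D$, $M$, the kernel bases, $\phi$, $\alpha$ and the chosen indices) and neither on $\epsilon$ nor on the realization, such that for every $\epsilon\ge0$ and every $D$-dimensional realization $(\bar\phi,\bar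 M)$ generating a $P$ with $W_M(P)\ge 1-\frac1D-\epsilon$ there is a unitary or anti-unitary $U$ with $$\|M_b-U\bar M_{b|Y}U^\dagger\|\le\delta'\quad\text{for all }b,\qquad \delta'=C\epsilon^{1/16}\text{ if }D=2,\qquad \delta'=C\epsilon^{1/32}\text{ otherwise},$$ where $\|\cdot\|$ is the operator norm. 3. In particular $W_M$ self-tests $M$ exactly: for every $D$-dimensional realization with $W_M(P)=1-\frac1D$ there is a unitary or anti-unitary $U$ with $\bar M_{b|Y}=UM_bU^\dagger$ for all $b$. -/

import Mathlib

open scoped ComplexOrder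

namespace PrepareMeasure

noncomputable section

/-- The (unnormalised) rank-one operator `|v⟩⟨v|`. -/
def ketbra {D : ℕ} (v : EuclideanSpace ℂ (Fin D)) : Matrix (Fin D) (Fin D) ℂ :=
  Matrix.vecMulVec (fun i => v i) (fun i => star (v i))

/-- `D`-dimensional quantum states (density matrices). -/
def IsState {D : ℕ} (ρ : Matrix (Fin D) (Fin D) ℂ) : Prop :=
  ρ.PosSemidef ∧ ρ.trace = 1

/-- Pure states: projectors `|v⟩⟨v|` with `v` a unit vector. -/
def IsPureState {D : ℕ} (ρ : Matrix (Fin D) (Fin D) ℂ) : Prop :=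
  ∃ v : EuclideanSpace ℂ (Fin D), ‖v‖ = 1 ∧ ρ = ketbra v

/-- The set of `D`-dimensional POVMs with `B` outcomes. -/
def povms (D B : ℕ) : Set (Fin B → Matrix (Fin D) (Fin D) ℂ) :=
  {M | (∀ b, (M b).PosSemidef) ∧ ∑ b, M b = 1}

/-- Trace norm: the sum of the singular values of `A`, that is, of the square roots of the
eigenvalues of `Aᴴ A`. -/
def traceNorm {D : ℕ} (A : Matrix (Fin D) (Fin D) ℂ) : ℝ :=
  ∑ i, √((Matrix.isHermitian_conjTranspose_mul_self A).eigenvalues i)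

/-- Operator norm of `A` acting on `ℂ^D` with the Euclidean norm. -/
def opNorm {D : ℕ} (A : Matrix (Fin D) (Fin D) ℂ) : ℝ :=
  ‖Matrix.toEuclideanCLM (n := Fin D) (𝕜 := ℂ) A‖

/-- `τ` is a conjugation `A ↦ U A U†` by a unitary `U`, or by an anti-unitary `U`. Every
anti-unitary is `V ∘ K` with `V` unitary and `K` the entrywise complex conjugation of vectors,
and conjugation of a matrix by `K` is its entrywise complex conjugate. -/
def IsUnitaryOrAntiunitaryConj {D : ℕ}
    (τ : Matrix (Fin D) (Fin D) ℂ → Matrix (Fin D) (Fin D) ℂ) : Prop :=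
  ∃ V ∈ Matrix.unitaryGroup (Fin D) ℂ,
    (∀ A, τ A = V * A * V.conjTranspose) ∨ (∀ A, τ A = V * A.map star * V.conjTranspose)

/-- Measurement settings: one for each pair `(i, j)` with `i > j` (`p.1 = i`, `p.2 = j`), and one
last setting. -/
abbrev Setting (N : ℕ) : Type := {p : Fin N × Fin N // p.2 < p.1} ⊕ Unit

/-- Pair settings are dichotomic, the last one has `B` outcomes. -/
abbrev numOutcomes {N : ℕ} (B : ℕ) : Setting N → ℕ
  | .inl _ => 2
  | .inr _ => B

/-- Measurement statistics `P x y b = P(b|x,y)`. -/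
abbrev Behavior (N B : ℕ) : Type :=
  (x : Fin N) → (y : Setting N) → Fin (numOutcomes B y) → ℝ

/-- A choice of one `numOutcomes B y`-outcome family of operators for each setting `y`. -/
abbrev Measurements (D N B : ℕ) : Type :=
  (y : Setting N) → Fin (numOutcomes B y) → Matrix (Fin D) (Fin D) ℂ

/-- The states `ρ` and the measurements `Q` are a `D`-dimensional quantum realization. -/
def IsRealization {D N B : ℕ} (ρ : Fin N → Matrix (Fin D) (Fin D) ℂ)
    (Q : Measurements D N B) : Prop :=
  (∀ x, IsState (ρ x)) ∧ ∀ y, Q y ∈ povms D (numOutcomes B y)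

/-- Born's rule `P(b|x,y) = tr(ρ_x Q_{b|y})`. -/
def born {D N B : ℕ} (ρ : Fin N → Matrix (Fin D) (Fin D) ℂ) (Q : Measurements D N B) :
    Behavior N B :=
  fun x y b => (ρ x * Q y b).trace.re

/-- The set `Q_D` of behaviors that admit a `D`-dimensional realization. -/
def quantumSet (D N B : ℕ) : Set (Behavior N B) :=
  {P | ∃ (ρ : Fin N → Matrix (Fin D) (Fin D) ℂ) (Q : Measurements D N B),
    IsRealization ρ Q ∧ P = born ρ Q}

/-- The state witness
`∑_{i>j} α_i α_j ‖φ_i - φ_j‖₁ (P(2|i,(i,j)) - P(2|j,(i,j)))`.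
Outcomes are numbered from `0`, so the second outcome of a dichotomic measurement is `1`. -/
def stateWitness {D N B : ℕ} (φ : Fin N → Matrix (Fin D) (Fin D) ℂ) (α : Fin N → ℝ)
    (P : Behavior N B) : ℝ :=
  ∑ p : {p : Fin N × Fin N // p.2 < p.1},
    α p.1.1 * α p.1.2 * traceNorm (φ p.1.1 - φ p.1.2) *
      (P p.1.1 (.inl p) (1 : Fin 2) - P p.1.2 (.inl p) (1 : Fin 2))

/-- The POVM witness: the state witness minus `∑_{b,i} P(b | κ b i, last setting)`, where
`κ b i` is the preparation labelled by the `i`-th kernel vector of outcome `b`. -/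
def povmWitness {D N B : ℕ} (φ : Fin N → Matrix (Fin D) (Fin D) ℂ) (α : Fin N → ℝ)
    {d : Fin B → ℕ} (κ : (b : Fin B) → Fin (d b) → Fin N) (P : Behavior N B) : ℝ :=
  stateWitness φ α P - ∑ b : Fin B, ∑ i : Fin (d b), P (κ b i) (.inr ()) b

/-- The fiducial family `T` of pure states built on an orthonormal basis `e`:
`e_k`, `(e_k + e_{k+1})/√2`, `(e_k + i e_{k+1})/√2`, `(e_k + e_{k+1} + e_{k+2})/√3` and
`(i e_k + e_{k+1} + i e_{k+2})/√3`. -/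
def fiducialStates {D : ℕ} (e : OrthonormalBasis (Fin D) ℂ (EuclideanSpace ℂ (Fin D))) :
    Set (Matrix (Fin D) (Fin D) ℂ) :=
  {ρ | (∃ k : Fin D, ρ = ketbra (e k)) ∨
    (∃ k l : Fin D, (l : ℕ) = k + 1 ∧
      (ρ = ketbra (((1 / √2 : ℝ) : ℂ) • (e k + e l)) ∨
       ρ = ketbra (((1 / √2 : ℝ) : ℂ) • (e k + Complex.I • e l)))) ∨
    (∃ k l m : Fin D, (l : ℕ) = k + 1 ∧ (m : ℕ) = k + 2 ∧
      (ρ = ketbra (((1 / √3 : ℝ) : ℂ) • (e k + e l + e m)) ∨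
       ρ = ketbra (((1 / √3 : ℝ) : ℂ) • (Complex.I • e k + e l + Complex.I • e m))))}

end

end PrepareMeasure

/-!
The state part of the witness bounds a realization `ρ` of the preparations by the geometry of pure
states. By Cauchy–Schwarz a pair contributes at most twice the product of `√(1 - tr φᵢφⱼ)` and
`√(1 - tr ρᵢρⱼ)`, so the whole is at most the average of `1 - tr φᵢφⱼ` and `1 - tr ρᵢρⱼ` over
pairs, which depends on the purities of the averaged states only; the averaged state of purity
`1/D` is optimal. The argument is quantitative (`stateWitness_add_deficit_le`): a deficit `ε` makes
each `ρᵢ` pure up to `O(ε)`, and each overlap `tr ρᵢρⱼ` equal to `tr φᵢφⱼ` up to `O(ε^{1/2})`; it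
also bounds the probabilities `tr (ρ Q_b)` on the kernel preparations by `ε`
(`near_optimal_bounds`). The reference states with Helstrom measurements attain the bound
(`exists_realization_eq`).

The overlaps determine the states up to a unitary or anti-unitary (`exists_adapted_bases`). For
qubits this is the determination of Bloch vectors by their Gram matrix (`qubit_rigidity`). In
higher dimension pairwise overlaps do not suffice in general, but the fiducial states supply an
almost orthonormal basis, its phases, and a single choice of complex conjugation
(`fiducial_rigidity`). Two square roots are lost on the way, so the kernel states are recovered up to
`O(ε^{1/8})`.

After the (anti-)unitary rotation the realized POVM elements have expectation `O(ε^{1/8})` in the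
kernel states, hence act on them as `O(ε^{1/16})`. Extremality of `M` means that no non-zero
Hermitian tuple of total zero vanishes on the kernels (`extremal_povm_rigid`), and an injective
linear map of finite-dimensional spaces is bounded below, so that `M` is at distance `O(ε^{1/16})`
(`extremal_povm_stable`).

The estimates are made along an ultrafilter on a sequence of realizations with deficits tending to
zero. This replaces explicit constants by asymptotic ones (`Approx`), and lets every choice of a sign
be made once for the whole sequence; a sequence of realizations violating the bound for larger and
larger constants then yields a contradiction (`exists_robustness_constant`). Exact self-testing is
the case `ε = 0`.
-/

namespace PrepareMeasure

open Matrix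

/-! ### States, pure states and the trace -/

theorem exists_eq_conjTranspose_mul_self {D : ℕ} {A : Matrix (Fin D) (Fin D) ℂ}
    (hA : A.PosSemidef) : ∃ R : Matrix (Fin D) (Fin D) ℂ, A = Rᴴ * R := by
  open scoped MatrixOrder in
  exact CStarAlgebra.nonneg_iff_eq_star_mul_self.mp hA.nonneg

open scoped Matrix.Norms.Frobenius in
theorem frobenius_norm_sq {D : ℕ} (A : Matrix (Fin D) (Fin D) ℂ) :
    ‖A‖ ^ 2 = (Aᴴ * A).trace.re := by
  rw [Matrix.frobenius_norm_def, ← Real.sqrt_eq_rpow, Real.sq_sqrt (by positivity)]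
  simp only [Matrix.trace, Matrix.diag, Matrix.mul_apply, Matrix.conjTranspose_apply,
    Complex.re_sum]
  rw [Finset.sum_comm]
  refine Finset.sum_congr rfl fun i _ => Finset.sum_congr rfl fun j _ => ?_
  simp [Complex.sq_norm, Complex.normSq_apply]

theorem trace_mul_nonneg {D : ℕ} {A C : Matrix (Fin D) (Fin D) ℂ} (hA : A.PosSemidef)
    (hC : C.PosSemidef) : 0 ≤ (A * C).trace.re := by
  obtain ⟨R, rfl⟩ := exists_eq_conjTranspose_mul_self hA
  rw [Matrix.mul_assoc, Matrix.trace_mul_comm]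
  exact (Complex.le_def.mp (hC.mul_mul_conjTranspose_same R).trace_nonneg).1

theorem trace_mul_im_eq_zero {D : ℕ} {A C : Matrix (Fin D) (Fin D) ℂ} (hA : A.IsHermitian)
    (hC : C.IsHermitian) : (A * C).trace.im = 0 := by
  have h : star (A * C).trace = (A * C).trace := by
    rw [← Matrix.trace_conjTranspose, Matrix.conjTranspose_mul, hA.eq, hC.eq,
      Matrix.trace_mul_comm]
  exact Complex.conj_eq_iff_im.mp h

theorem trace_mul_eq_ofReal {D : ℕ} {A C : Matrix (Fin D) (Fin D) ℂ} (hA : A.IsHermitian)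
    (hC : C.IsHermitian) : (A * C).trace = (((A * C).trace.re : ℝ) : ℂ) := by
  apply Complex.ext <;> simp [trace_mul_im_eq_zero hA hC]

/-- The two-outcome distinguishability `tr ρQ - tr σQ` is bounded by the Hilbert–Schmidt overlap:
with factorisations `ρ = AᴴA`, `σ = CᴴC`, `Q = EᴴE`, `1 - Q = FᴴF`, the matrix
`A Cᴴ = A Eᴴ (C Eᴴ)ᴴ + A Fᴴ (C Fᴴ)ᴴ` has squared Frobenius norm `tr ρσ`, and each of the two
products is controlled by the probabilities of one outcome. -/
theorem sq_born_sub_le {D : ℕ} {ρ σ Q : Matrix (Fin D) (Fin D) ℂ} (hρ : IsState ρ)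
    (hσ : IsState σ) (hQ : Q.PosSemidef) (hQ' : (1 - Q).PosSemidef) :
    ((ρ * Q).trace.re - (σ * Q).trace.re) ^ 2 ≤ 1 - (ρ * σ).trace.re := by
  open scoped Matrix.Norms.Frobenius in
  have hp1 : (ρ * (1 - Q)).trace.re = 1 - (ρ * Q).trace.re := by
    rw [mul_sub, Matrix.trace_sub, mul_one, hρ.2]; simp
  have hq1 : (σ * (1 - Q)).trace.re = 1 - (σ * Q).trace.re := by
    rw [mul_sub, Matrix.trace_sub, mul_one, hσ.2]; simp
  have hp0 := trace_mul_nonneg hρ.1 hQ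
  have hq0 := trace_mul_nonneg hσ.1 hQ
  have hp0' := trace_mul_nonneg hρ.1 hQ'
  have hq0' := trace_mul_nonneg hσ.1 hQ'
  rw [hp1] at hp0'
  rw [hq1] at hq0'
  obtain ⟨A, hA⟩ := exists_eq_conjTranspose_mul_self hρ.1
  obtain ⟨C, hC⟩ := exists_eq_conjTranspose_mul_self hσ.1
  obtain ⟨E, hE⟩ := exists_eq_conjTranspose_mul_self hQ
  obtain ⟨F, hF⟩ := exists_eq_conjTranspose_mul_self hQ'
  have key : ∀ X Y : Matrix (Fin D) (Fin D) ℂ,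
      ‖X * Yᴴ‖ ^ 2 = ((Xᴴ * X) * (Yᴴ * Y)).trace.re := by
    intro X Y
    rw [frobenius_norm_sq, Matrix.conjTranspose_mul, Matrix.conjTranspose_conjTranspose,
      Matrix.mul_assoc, Matrix.trace_mul_comm]
    simp only [Matrix.mul_assoc]
  have hdec : A * Cᴴ = (A * Eᴴ) * (C * Eᴴ)ᴴ + (A * Fᴴ) * (C * Fᴴ)ᴴ := by
    have : A * Cᴴ = A * (Eᴴ * E + Fᴴ * F) * Cᴴ := by rw [← hE, ← hF]; simp
    rw [this]
    simp only [Matrix.conjTranspose_mul, Matrix.conjTranspose_conjTranspose, Matrix.mul_add,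
      Matrix.add_mul, Matrix.mul_assoc]
  set p := (ρ * Q).trace.re
  set q := (σ * Q).trace.re
  have hAE : ‖A * Eᴴ‖ ^ 2 = p := by rw [key, ← hA, ← hE]
  have hCE : ‖C * Eᴴ‖ ^ 2 = q := by rw [key, ← hC, ← hE]
  have hAF : ‖A * Fᴴ‖ ^ 2 = 1 - p := by rw [key, ← hA, ← hF, hp1]
  have hCF : ‖C * Fᴴ‖ ^ 2 = 1 - q := by rw [key, ← hC, ← hF, hq1]
  have hAC : ‖A * Cᴴ‖ ^ 2 = (ρ * σ).trace.re := by rw [key, ← hA, ← hC]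
  have hle : ‖A * Cᴴ‖ ≤ ‖A * Eᴴ‖ * ‖C * Eᴴ‖ + ‖A * Fᴴ‖ * ‖C * Fᴴ‖ := by
    rw [hdec]
    refine (norm_add_le _ _).trans (add_le_add ?_ ?_)
    · exact (Matrix.frobenius_norm_mul _ _).trans
        (by rw [Matrix.frobenius_norm_conjTranspose])
    · exact (Matrix.frobenius_norm_mul _ _).trans
        (by rw [Matrix.frobenius_norm_conjTranspose])
  rw [← hAC]
  set a := ‖A * Eᴴ‖
  set c := ‖C * Eᴴ‖
  set a' := ‖A * Fᴴ‖
  set c' := ‖C * Fᴴ‖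
  have h0 : 0 ≤ ‖A * Cᴴ‖ := norm_nonneg _
  have h1 : ‖A * Cᴴ‖ ^ 2 ≤ (a * c + a' * c') ^ 2 := by gcongr
  have h2 : a ^ 2 + a' ^ 2 = 1 := by rw [hAE, hAF]; ring
  have h3 : c ^ 2 + c' ^ 2 = 1 := by rw [hCE, hCF]; ring
  -- `(a, a')` and `(c, c')` are unit vectors of the plane: `p - q` is the product of the sines of
  -- the difference and of the sum of their angles, and `ac + a'c'` the cosine of the difference
  have h4 : p - q = (a * c' - a' * c) * (a * c' + a' * c) := by
    rw [← hAE, ← hCE]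
    linear_combination a ^ 2 * (-h3) + c ^ 2 * h2
  have h5 : (a * c + a' * c') ^ 2 = 1 - (a * c' - a' * c) ^ 2 := by
    linear_combination (c ^ 2 + c' ^ 2) * h2 + h3
  have h6 : (a * c' + a' * c) ^ 2 ≤ 1 := by
    have : (a * c' + a' * c) ^ 2 = 1 - (a * c - a' * c') ^ 2 := by
      linear_combination (c ^ 2 + c' ^ 2) * h2 + h3
    nlinarith [sq_nonneg (a * c - a' * c')]
  rw [h4, mul_pow]
  nlinarith [mul_le_mul_of_nonneg_left h6 (sq_nonneg (a * c' - a' * c))]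

theorem posSemidef_one_sub_zero {D : ℕ} :
    ((1 : Matrix (Fin D) (Fin D) ℂ) - 0).PosSemidef := by
  rw [sub_zero]; exact Matrix.PosSemidef.one

theorem trace_mul_le_one {D : ℕ} {ρ σ : Matrix (Fin D) (Fin D) ℂ} (hρ : IsState ρ)
    (hσ : IsState σ) : (ρ * σ).trace.re ≤ 1 := by
  have := sq_born_sub_le hρ hσ (Q := 0) Matrix.PosSemidef.zero posSemidef_one_sub_zero
  simp at this
  exact this

theorem ketbra_apply {D : ℕ} (v : EuclideanSpace ℂ (Fin D)) (i j : Fin D) :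
    ketbra v i j = v i * star (v j) := rfl

theorem ketbra_posSemidef {D : ℕ} (v : EuclideanSpace ℂ (Fin D)) : (ketbra v).PosSemidef :=
  Matrix.posSemidef_vecMulVec_self_star _

/-- Conjugating by a rank-one operator produces a multiple of it. -/
theorem ketbra_mul_mul_ketbra {D : ℕ} (v : EuclideanSpace ℂ (Fin D))
    (X : Matrix (Fin D) (Fin D) ℂ) :
    ketbra v * X * ketbra v = (ketbra v * X).trace • ketbra v := by
  ext i j
  simp only [Matrix.mul_apply, ketbra_apply, Matrix.trace, Matrix.diag, Matrix.smul_apply,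
    smul_eq_mul, Finset.sum_mul]
  refine Finset.sum_congr rfl fun k _ => Finset.sum_congr rfl fun l _ => ?_
  ring

theorem trace_ketbra {D : ℕ} (v : EuclideanSpace ℂ (Fin D)) :
    (ketbra v).trace = ((‖v‖ ^ 2 : ℝ) : ℂ) := by
  rw [EuclideanSpace.norm_sq_eq]
  simp only [Matrix.trace, Matrix.diag, ketbra_apply]
  push_cast
  refine Finset.sum_congr rfl fun i _ => ?_
  rw [Complex.star_def, Complex.mul_conj, Complex.normSq_eq_norm_sq]
  push_cast; rfl

theorem trace_ketbra_mul_ketbra {D : ℕ} (u v : EuclideanSpace ℂ (Fin D)) :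
    (ketbra u * ketbra v).trace = ((‖inner ℂ u v‖ ^ 2 : ℝ) : ℂ) := by
  rw [← Complex.normSq_eq_norm_sq, ← Complex.mul_conj]
  simp only [PiLp.inner_apply, RCLike.inner_apply, Matrix.trace, Matrix.diag, Matrix.mul_apply,
    ketbra_apply, map_sum, Finset.sum_mul, Finset.mul_sum]
  refine Finset.sum_congr rfl fun i _ => Finset.sum_congr rfl fun j _ => ?_
  simp; ring

theorem IsPureState.isState {D : ℕ} {P : Matrix (Fin D) (Fin D) ℂ} (hP : IsPureState P) :
    IsState P := by
  obtain ⟨v, hv, rfl⟩ := hP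
  exact ⟨ketbra_posSemidef v, by rw [trace_ketbra, hv]; simp⟩

theorem IsPureState.mul_mul {D : ℕ} {P : Matrix (Fin D) (Fin D) ℂ} (hP : IsPureState P)
    (X : Matrix (Fin D) (Fin D) ℂ) : P * X * P = (P * X).trace • P := by
  obtain ⟨v, hv, rfl⟩ := hP
  exact ketbra_mul_mul_ketbra v X

theorem IsPureState.mul_self {D : ℕ} {P : Matrix (Fin D) (Fin D) ℂ} (hP : IsPureState P) :
    P * P = P := by
  have := hP.mul_mul 1
  rwa [mul_one, hP.isState.2, one_smul] at this

/-! ### Distinguishing two pure states -/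

section PurePair

variable {D : ℕ} {P R : Matrix (Fin D) (Fin D) ℂ}

theorem pure_sub_sq (hP : IsPureState P) (hR : IsPureState R) :
    (P - R) * (P - R) = P + R - P * R - R * P := by
  rw [sub_mul, mul_sub, mul_sub, hP.mul_self, hR.mul_self]; abel

theorem trace_pure_sub_sq (hP : IsPureState P) (hR : IsPureState R) :
    ((P - R) * (P - R)).trace = ((2 * (1 - (P * R).trace.re) : ℝ) : ℂ) := by
  rw [pure_sub_sq hP hR]
  simp only [Matrix.trace_sub, Matrix.trace_add, hP.isState.2, hR.isState.2,
    Matrix.trace_mul_comm R P]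
  rw [trace_mul_eq_ofReal hP.isState.1.1 hR.isState.1.1]
  push_cast
  ring_nf
  simp

/-- The difference of two pure states has the eigenvalues `0` and `±√(1 - tr PR)` only. -/
theorem pure_sub_cube (hP : IsPureState P) (hR : IsPureState R) :
    (P - R) * (P - R) * (P - R) = ((1 - (P * R).trace.re : ℝ) : ℂ) • (P - R) := by
  have h1 : P * R * P = (((P * R).trace.re : ℝ) : ℂ) • P := by
    rw [← trace_mul_eq_ofReal hP.isState.1.1 hR.isState.1.1, hP.mul_mul]
  have h2 : R * P * R = (((P * R).trace.re : ℝ) : ℂ) • R := by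
    rw [← trace_mul_eq_ofReal hP.isState.1.1 hR.isState.1.1, hR.mul_mul, Matrix.trace_mul_comm]
  have hPP := hP.mul_self
  have hRR := hR.mul_self
  rw [pure_sub_sq hP hR]
  have e : (P + R - P * R - R * P) * (P - R) =
      P * P + R * P - P * R * P - R * (P * P) - P * R - R * R + P * (R * R) + R * P * R := by
    noncomm_ring
  rw [e, h1, h2, hPP, hRR]
  push_cast
  rw [sub_smul, one_smul, smul_sub]
  abel

theorem traceNorm_pure_sub (hP : IsPureState P) (hR : IsPureState R) :
    traceNorm (P - R) = 2 * √(1 - (P * R).trace.re) := by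
  set s := √(1 - (P * R).trace.re) with hs
  have hs0 : 0 ≤ s := Real.sqrt_nonneg _
  have hs2 : s ^ 2 = 1 - (P * R).trace.re :=
    Real.sq_sqrt (by linarith [trace_mul_le_one hP.isState hR.isState])
  have hherm : (P - R)ᴴ = P - R := by
    rw [Matrix.conjTranspose_sub, hP.isState.1.1.eq, hR.isState.1.1.eq]
  set A := P - R with hA
  set H := Matrix.isHermitian_conjTranspose_mul_self A with hH
  have hsum : ∑ i, H.eigenvalues i = 2 * s ^ 2 := by
    have h := H.trace_eq_sum_eigenvalues
    have htr : (Aᴴ * A).trace = ((2 * s ^ 2 : ℝ) : ℂ) := by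
      rw [hherm, trace_pure_sub_sq hP hR, ← hs2]
    rw [htr] at h
    have h' : ((2 * s ^ 2 : ℝ) : ℂ) = ((∑ i, H.eigenvalues i : ℝ) : ℂ) := by
      rw [h]; push_cast; rfl
    exact (Complex.ofReal_injective h').symm
  have heig : ∀ i, H.eigenvalues i * H.eigenvalues i = s ^ 2 * H.eigenvalues i := by
    intro i
    have hv := H.mulVec_eigenvectorBasis i
    set w := (H.eigenvectorBasis i).ofLp with hw
    have hw0 : w ≠ 0 := by
      intro h0
      have := H.eigenvectorBasis.orthonormal.1 i
      have h00 : H.eigenvectorBasis i = 0 := by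
        ext j; exact congrFun h0 j
      rw [h00] at this
      simp at this
    have h4 : (Aᴴ * A) * (Aᴴ * A) = ((s ^ 2 : ℝ) : ℂ) • (Aᴴ * A) := by
      rw [hherm, hs2, ← Matrix.mul_assoc, pure_sub_cube hP hR, Matrix.smul_mul]
    have h5 := congrArg (fun X => X.mulVec w) h4
    simp only [← Matrix.mulVec_mulVec, Matrix.smul_mulVec, hv, Matrix.mulVec_smul] at h5
    obtain ⟨j, hj⟩ := Function.ne_iff.mp hw0
    have h6 := congrFun h5 j
    simp only [Pi.smul_apply, Complex.real_smul, smul_eq_mul, Pi.zero_apply] at h6 hj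
    rw [← mul_assoc, ← mul_assoc] at h6
    have h7 := mul_right_cancel₀ hj h6
    exact_mod_cast h7
  have hsq : ∀ i, s * √(H.eigenvalues i) = H.eigenvalues i := by
    intro i
    rcases mul_eq_mul_right_iff.mp (heig i) with h | h
    · rw [h, Real.sqrt_sq hs0, sq]
    · rw [h]; simp
  unfold traceNorm
  by_cases h0 : s = 0
  · rw [h0, mul_zero]
    refine Finset.sum_eq_zero fun i _ => ?_
    have := hsq i
    rw [h0, zero_mul] at this
    change √(H.eigenvalues i) = 0
    rw [← this, Real.sqrt_zero]
  · have : s * ∑ i, √(H.eigenvalues i) = s * (2 * s) := by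
      rw [Finset.mul_sum, Finset.sum_congr rfl fun i _ => hsq i, hsum]; ring
    exact mul_left_cancel₀ h0 this

/-- The optimal (Helstrom) measurement distinguishing two pure states: the projector onto the
positive part of `P - R`, written as a polynomial in `P - R`. -/
theorem exists_optimal_effect (hP : IsPureState P) (hR : IsPureState R) :
    ∃ Q : Matrix (Fin D) (Fin D) ℂ, Q.PosSemidef ∧ (1 - Q).PosSemidef ∧
      (P * Q).trace.re - (R * Q).trace.re = √(1 - (P * R).trace.re) := by
  set s := √(1 - (P * R).trace.re) with hs
  have hs2 : s ^ 2 = 1 - (P * R).trace.re :=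
    Real.sq_sqrt (by linarith [trace_mul_le_one hP.isState hR.isState])
  by_cases h0 : s = 0
  · refine ⟨0, Matrix.PosSemidef.zero, posSemidef_one_sub_zero, ?_⟩
    simp [h0]
  have hherm : (P - R)ᴴ = P - R := by
    rw [Matrix.conjTranspose_sub, hP.isState.1.1.eq, hR.isState.1.1.eq]
  have hcube := pure_sub_cube hP hR
  have htr2 := trace_pure_sub_sq hP hR
  have htr1 : (P - R).trace = 0 := by
    rw [Matrix.trace_sub, hP.isState.2, hR.isState.2, sub_self]
  rw [← hs2] at hcube htr2
  have hlin : ∀ Q : Matrix (Fin D) (Fin D) ℂ,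
      (P * Q).trace.re - (R * Q).trace.re = ((P - R) * Q).trace.re := by
    intro Q; rw [sub_mul, Matrix.trace_sub, Complex.sub_re]
  set A := P - R with hA
  have hsC : (s : ℂ) ≠ 0 := by exact_mod_cast h0
  set Q : Matrix (Fin D) (Fin D) ℂ := ((1 / (2 * s ^ 2) : ℝ) : ℂ) • (A * A + (s : ℂ) • A) with hQ
  have hQH : Qᴴ = Q := by
    rw [hQ, Matrix.conjTranspose_smul, Matrix.conjTranspose_add, Matrix.conjTranspose_mul,
      Matrix.conjTranspose_smul, hherm]
    simp
  have hQQ : Q * Q = Q := by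
    have h4 : A * A * (A * A) = ((s ^ 2 : ℝ) : ℂ) • (A * A) := by
      rw [← Matrix.mul_assoc, hcube, Matrix.smul_mul]
    rw [hQ, Matrix.smul_mul, Matrix.mul_smul, smul_smul, Matrix.add_mul, Matrix.mul_add,
      Matrix.mul_add, h4, Matrix.mul_smul, hcube, Matrix.smul_mul, Matrix.smul_mul,
      ← Matrix.mul_assoc, hcube, Matrix.mul_smul]
    simp only [smul_add, smul_smul]
    push_cast
    have e1 : (1 : ℂ) / (2 * s ^ 2) * (1 / (2 * s ^ 2)) * s ^ 2 = 1 / (2 * s ^ 2) * (1 / 2) := by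
      field_simp
    have e2 : (1 : ℂ) / (2 * s ^ 2) * (1 / (2 * s ^ 2)) * (s * s ^ 2) =
      1 / (2 * s ^ 2) * (1 / 2) * s := by field_simp
    have e3 : (1 : ℂ) / (2 * s ^ 2) * (1 / (2 * s ^ 2)) * (s * s) = 1 / (2 * s ^ 2) * (1 / 2) := by
      field_simp
    rw [e1, e2, e3]
    module
  refine ⟨Q, ?_, ?_, ?_⟩
  · rw [← hQQ]
    nth_rewrite 1 [← hQH]
    exact Matrix.posSemidef_conjTranspose_mul_self Q
  · have h1 : (1 - Q)ᴴ * (1 - Q) = 1 - Q := by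
      rw [Matrix.conjTranspose_sub, hQH, Matrix.conjTranspose_one, Matrix.mul_sub, Matrix.sub_mul,
        Matrix.sub_mul, hQQ]
      simp
    rw [← h1]
    exact Matrix.posSemidef_conjTranspose_mul_self _
  · rw [hlin, hQ, Matrix.mul_smul, Matrix.mul_add, ← Matrix.mul_assoc, hcube, Matrix.mul_smul,
      Matrix.trace_smul, Matrix.trace_add, Matrix.trace_smul, Matrix.trace_smul, htr1, htr2]
    have : ((1 / (2 * s ^ 2) : ℝ) : ℂ) • (((s ^ 2 : ℝ) : ℂ) • (0 : ℂ) +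
        (s : ℂ) • ((2 * s ^ 2 : ℝ) : ℂ)) = (s : ℂ) := by
      push_cast
      simp only [smul_eq_mul]
      field_simp
      ring
    rw [this, Complex.ofReal_re]

end PurePair

/-! ### The maximal value of the witness -/

section Witness

variable {D N B : ℕ}

/-- A sum over ordered pairs `j < i` of a symmetric function. -/
theorem two_mul_sum_pairs (g : Fin N → Fin N → ℝ) (hg : ∀ i j, g i j = g j i) :
    2 * ∑ p : {p : Fin N × Fin N // p.2 < p.1}, g p.1.1 p.1.2 =
      (∑ i, ∑ j, g i j) - ∑ i, g i i := by
  have h1 : ∑ p : {p : Fin N × Fin N // p.2 < p.1}, g p.1.1 p.1.2 =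
      ∑ i, ∑ j, if j < i then g i j else 0 := by
    rw [← Fintype.sum_prod_type' (f := fun i j : Fin N => if j < i then g i j else 0),
      ← Finset.sum_filter]
    exact (Finset.sum_subtype _ (by simp) (fun p : Fin N × Fin N => g p.1 p.2)).symm
  have h2 : ∑ i : Fin N, ∑ j : Fin N, (if j < i then g i j else 0) =
      ∑ i : Fin N, ∑ j : Fin N, if i < j then g i j else 0 := by
    rw [Finset.sum_comm]
    simp only [hg]
  have h3 : ∑ i, g i i = ∑ i : Fin N, ∑ j : Fin N, if i = j then g i j else 0 := by simp
  have h4 : ∑ i, ∑ j, g i j = (∑ i : Fin N, ∑ j : Fin N, if j < i then g i j else 0) +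
      (∑ i : Fin N, ∑ j : Fin N, if i < j then g i j else 0) +
      ∑ i : Fin N, ∑ j : Fin N, if i = j then g i j else 0 := by
    rw [← Finset.sum_add_distrib, ← Finset.sum_add_distrib]
    refine Finset.sum_congr rfl fun i _ => ?_
    rw [← Finset.sum_add_distrib, ← Finset.sum_add_distrib]
    refine Finset.sum_congr rfl fun j _ => ?_
    rcases lt_trichotomy i j with h | h | h
    · simp [h, h.not_gt, h.ne]
    · simp [h]
    · simp [h, h.not_gt, h.ne']
  rw [h4, h3, h1, ← h2]
  ring

theorem sum_weights_eq_one (hD : 0 < D) {φ : Fin N → Matrix (Fin D) (Fin D) ℂ}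
    (hφ : ∀ x, IsState (φ x)) {α : Fin N → ℝ}
    (hmix : ∑ x, (α x : ℂ) • φ x = (1 / (D : ℂ)) • (1 : Matrix (Fin D) (Fin D) ℂ)) :
    ∑ x, α x = 1 := by
  have h := congrArg Matrix.trace hmix
  have hD' : (D : ℂ) ≠ 0 := by exact_mod_cast hD.ne'
  simp only [Matrix.trace_sum, Matrix.trace_smul, (hφ _).2, Matrix.trace_one, Fintype.card_fin,
    smul_eq_mul, mul_one] at h
  rw [one_div_mul_cancel hD'] at h
  exact_mod_cast h

theorem sum_sum_trace_mul (ρ : Fin N → Matrix (Fin D) (Fin D) ℂ) (α : Fin N → ℝ) :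
    ∑ i, ∑ j, α i * α j * (ρ i * ρ j).trace.re =
      ((∑ x, (α x : ℂ) • ρ x) * (∑ x, (α x : ℂ) • ρ x)).trace.re := by
  simp only [Finset.sum_mul, Finset.mul_sum, Matrix.trace_sum, Complex.re_sum, Matrix.smul_mul,
    Matrix.mul_smul, Matrix.trace_smul, smul_smul]
  rw [Finset.sum_comm]
  refine Finset.sum_congr rfl fun i _ => Finset.sum_congr rfl fun j _ => ?_
  rw [← Complex.ofReal_mul, smul_eq_mul, Complex.re_ofReal_mul]
  rw [Matrix.trace_mul_comm]; ring

theorem trace_average_sq (hD : 0 < D) {φ : Fin N → Matrix (Fin D) (Fin D) ℂ} {α : Fin N → ℝ}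
    (hmix : ∑ x, (α x : ℂ) • φ x = (1 / (D : ℂ)) • (1 : Matrix (Fin D) (Fin D) ℂ)) :
    ((∑ x, (α x : ℂ) • φ x) * (∑ x, (α x : ℂ) • φ x)).trace.re = 1 / (D : ℝ) := by
  have hDC : (D : ℂ) ≠ 0 := by exact_mod_cast hD.ne'
  rw [hmix, Matrix.smul_mul, Matrix.mul_smul, Matrix.one_mul, Matrix.trace_smul,
    Matrix.trace_smul, Matrix.trace_one, Fintype.card_fin]
  have : (1 / (D : ℂ)) • (1 / (D : ℂ)) • (D : ℂ) = ((1 / (D : ℝ) : ℝ) : ℂ) := by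
    push_cast; simp only [smul_eq_mul]; field_simp
  rw [this, Complex.ofReal_re]

/-- A Hermitian matrix of unit trace has purity at least `1 / D`. -/
theorem inv_le_trace_mul_self (hD : 0 < D) {R : Matrix (Fin D) (Fin D) ℂ} (hR : R.IsHermitian)
    (htr : R.trace = 1) : 1 / (D : ℝ) ≤ (R * R).trace.re := by
  have hD' : (D : ℂ) ≠ 0 := by exact_mod_cast hD.ne'
  set X := R - (1 / (D : ℂ)) • (1 : Matrix (Fin D) (Fin D) ℂ) with hX
  have hXH : Xᴴ = X := by
    rw [hX, Matrix.conjTranspose_sub, hR.eq, Matrix.conjTranspose_smul]; simp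
  have h0 : 0 ≤ (Xᴴ * X).trace.re :=
    (Complex.le_def.mp (Matrix.posSemidef_conjTranspose_mul_self X).trace_nonneg).1
  have h1 : (X * X).trace = (R * R).trace - ((1 / (D : ℝ) : ℝ) : ℂ) := by
    rw [hX]
    simp only [Matrix.sub_mul, Matrix.mul_sub, Matrix.smul_mul, Matrix.mul_smul, Matrix.one_mul,
      Matrix.mul_one, Matrix.trace_sub, Matrix.trace_smul, htr, Matrix.trace_one,
      Fintype.card_fin, smul_eq_mul]
    push_cast
    field_simp
    ring
  rw [hXH, h1, Complex.sub_re, Complex.ofReal_re] at h0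
  linarith

theorem effect_of_povm_two {Q : Fin 2 → Matrix (Fin D) (Fin D) ℂ} (hQ : Q ∈ povms D 2) :
    (Q 1).PosSemidef ∧ (1 - Q 1).PosSemidef := by
  refine ⟨hQ.1 1, ?_⟩
  have h := hQ.2
  rw [Fin.sum_univ_two] at h
  rw [← h, add_sub_cancel_right]
  exact hQ.1 0

/-- The state witness of a realization, increased by the squared mismatch of the
distinguishabilities `√(1 - tr ρ_i ρ_j)` and by the impurity of the states, is still at most
`1 - 1/D`. By Cauchy–Schwarz each term of the witness is at most twice the product
`√(1 - tr φ_i φ_j) √(1 - tr ρ_i ρ_j)`, and the averages of `1 - tr φ_i φ_j` and of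
`1 - tr ρ_i ρ_j` are linear in the purity of the averaged states. -/
theorem stateWitness_add_deficit_le (hD : 0 < D) {φ : Fin N → Matrix (Fin D) (Fin D) ℂ}
    (hφ : ∀ x, IsPureState (φ x)) {α : Fin N → ℝ} (hα : ∀ x, 0 < α x)
    (hmix : ∑ x, (α x : ℂ) • φ x = (1 / (D : ℂ)) • (1 : Matrix (Fin D) (Fin D) ℂ))
    {ρ : Fin N → Matrix (Fin D) (Fin D) ℂ} {Q : Measurements D N B} (hR : IsRealization ρ Q) :
    stateWitness φ α (born ρ Q) +
      ∑ p : {p : Fin N × Fin N // p.2 < p.1}, α p.1.1 * α p.1.2 *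
        (√(1 - (φ p.1.1 * φ p.1.2).trace.re) - √(1 - (ρ p.1.1 * ρ p.1.2).trace.re)) ^ 2 +
      1 / 2 * ∑ i, α i ^ 2 * (1 - (ρ i * ρ i).trace.re) ≤ 1 - 1 / (D : ℝ) := by
  have hsum := sum_weights_eq_one hD (fun x => (hφ x).isState) hmix
  have hterm : ∀ p : {p : Fin N × Fin N // p.2 < p.1},
      α p.1.1 * α p.1.2 * traceNorm (φ p.1.1 - φ p.1.2) *
        (born ρ Q p.1.1 (.inl p) (1 : Fin 2) - born ρ Q p.1.2 (.inl p) (1 : Fin 2)) +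
      α p.1.1 * α p.1.2 *
        (√(1 - (φ p.1.1 * φ p.1.2).trace.re) - √(1 - (ρ p.1.1 * ρ p.1.2).trace.re)) ^ 2 ≤
      α p.1.1 * α p.1.2 * ((1 - (φ p.1.1 * φ p.1.2).trace.re) +
        (1 - (ρ p.1.1 * ρ p.1.2).trace.re)) := by
    rintro ⟨⟨i, j⟩, hij⟩
    simp only
    obtain ⟨hE, hE'⟩ := effect_of_povm_two (hR.2 (.inl ⟨(i, j), hij⟩))
    have hsq := sq_born_sub_le (hR.1 i) (hR.1 j) hE hE'
    have hs : (0 : ℝ) ≤ 1 - (φ i * φ j).trace.re := by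
      linarith [trace_mul_le_one (hφ i).isState (hφ j).isState]
    have ht : (0 : ℝ) ≤ 1 - (ρ i * ρ j).trace.re := by
      linarith [trace_mul_le_one (hR.1 i) (hR.1 j)]
    rw [traceNorm_pure_sub (hφ i) (hφ j)]
    have hle := Real.le_sqrt_of_sq_le hsq
    set s := √(1 - (φ i * φ j).trace.re)
    set t := √(1 - (ρ i * ρ j).trace.re)
    have hs0 : 0 ≤ s := Real.sqrt_nonneg _
    have hs2 : s ^ 2 = 1 - (φ i * φ j).trace.re := Real.sq_sqrt hs
    have ht2 : t ^ 2 = 1 - (ρ i * ρ j).trace.re := Real.sq_sqrt ht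
    have ha : 0 < α i * α j := mul_pos (hα i) (hα j)
    rw [← hs2, ← ht2]
    change α i * α j * (2 * s) * ((ρ i * Q (.inl ⟨(i, j), hij⟩) (1 : Fin 2)).trace.re -
      (ρ j * Q (.inl ⟨(i, j), hij⟩) (1 : Fin 2)).trace.re) + _ ≤ _
    have h1 := mul_le_mul_of_nonneg_left hle (by positivity : 0 ≤ α i * α j * (2 * s))
    refine (add_le_add_left h1 _).trans (le_of_eq ?_)
    ring
  have hle := Finset.sum_le_sum fun p (_ : p ∈ Finset.univ) => hterm p
  rw [Finset.sum_add_distrib] at hle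
  have hpair := two_mul_sum_pairs
    (fun i j => α i * α j * ((1 - (φ i * φ j).trace.re) + (1 - (ρ i * ρ j).trace.re)))
    (fun i j => by rw [Matrix.trace_mul_comm (φ i), Matrix.trace_mul_comm (ρ i)]; ring)
  have htot : ∑ i, ∑ j, α i * α j = 1 := by
    simp_rw [← Finset.mul_sum, ← Finset.sum_mul, hsum, mul_one]
  have hfull : ∑ i, ∑ j, α i * α j * ((1 - (φ i * φ j).trace.re) + (1 - (ρ i * ρ j).trace.re)) =
      2 - ((∑ x, (α x : ℂ) • φ x) * (∑ x, (α x : ℂ) • φ x)).trace.re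
        - ((∑ x, (α x : ℂ) • ρ x) * (∑ x, (α x : ℂ) • ρ x)).trace.re := by
    rw [← sum_sum_trace_mul, ← sum_sum_trace_mul]
    have : ∀ i j, α i * α j * ((1 - (φ i * φ j).trace.re) + (1 - (ρ i * ρ j).trace.re)) =
        2 * (α i * α j) - α i * α j * (φ i * φ j).trace.re -
          α i * α j * (ρ i * ρ j).trace.re := by intros; ring
    simp only [this, Finset.sum_sub_distrib, ← Finset.mul_sum, hsum, mul_one]
  have hφφ := trace_average_sq hD hmix
  have hρρ : 1 / (D : ℝ) ≤
      ((∑ x, (α x : ℂ) • ρ x) * (∑ x, (α x : ℂ) • ρ x)).trace.re := by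
    refine inv_le_trace_mul_self hD ?_ ?_
    · rw [Matrix.IsHermitian, Matrix.conjTranspose_sum]
      refine Finset.sum_congr rfl fun x _ => ?_
      rw [Matrix.conjTranspose_smul, (hR.1 x).1.1.eq]; simp
    · simp only [Matrix.trace_sum, Matrix.trace_smul, (hR.1 _).2, smul_eq_mul, mul_one]
      exact_mod_cast hsum
  have hdiag : ∑ i, α i * α i * ((1 - (φ i * φ i).trace.re) + (1 - (ρ i * ρ i).trace.re)) =
      ∑ i, α i ^ 2 * (1 - (ρ i * ρ i).trace.re) := by
    refine Finset.sum_congr rfl fun i _ => ?_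
    rw [(hφ i).mul_self, (hφ i).isState.2, Complex.one_re]; ring
  rw [hfull, hdiag, hφφ] at hpair
  unfold stateWitness
  linarith

theorem penalty_nonneg {d : Fin B → ℕ} (κ : (b : Fin B) → Fin (d b) → Fin N)
    {ρ : Fin N → Matrix (Fin D) (Fin D) ℂ} {Q : Measurements D N B} (hR : IsRealization ρ Q)
    (b : Fin B) (i : Fin (d b)) : 0 ≤ born ρ Q (κ b i) (.inr ()) b :=
  trace_mul_nonneg (hR.1 _).1 ((hR.2 (.inr ())).1 b)

theorem mismatch_nonneg {φ ρ : Fin N → Matrix (Fin D) (Fin D) ℂ} {α : Fin N → ℝ}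
    (hα : ∀ x, 0 < α x) (p : {p : Fin N × Fin N // p.2 < p.1}) :
    0 ≤ α p.1.1 * α p.1.2 *
        (√(1 - (φ p.1.1 * φ p.1.2).trace.re) - √(1 - (ρ p.1.1 * ρ p.1.2).trace.re)) ^ 2 :=
  mul_nonneg (mul_pos (hα _) (hα _)).le (sq_nonneg _)

theorem impurity_nonneg {ρ : Fin N → Matrix (Fin D) (Fin D) ℂ} (hρ : ∀ x, IsState (ρ x))
    (α : Fin N → ℝ) (i : Fin N) : 0 ≤ α i ^ 2 * (1 - (ρ i * ρ i).trace.re) :=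
  mul_nonneg (sq_nonneg _) (by linarith [trace_mul_le_one (hρ i) (hρ i)])

theorem povmWitness_le (hD : 0 < D) {φ : Fin N → Matrix (Fin D) (Fin D) ℂ}
    (hφ : ∀ x, IsPureState (φ x)) {α : Fin N → ℝ} (hα : ∀ x, 0 < α x)
    (hmix : ∑ x, (α x : ℂ) • φ x = (1 / (D : ℂ)) • (1 : Matrix (Fin D) (Fin D) ℂ))
    {d : Fin B → ℕ} (κ : (b : Fin B) → Fin (d b) → Fin N)
    {ρ : Fin N → Matrix (Fin D) (Fin D) ℂ} {Q : Measurements D N B} (hR : IsRealization ρ Q) :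
    povmWitness φ α κ (born ρ Q) ≤ 1 - 1 / (D : ℝ) := by
  have h := stateWitness_add_deficit_le hD hφ hα hmix hR
  have h1 := Finset.sum_nonneg fun p (_ : p ∈ Finset.univ) =>
    mismatch_nonneg (φ := φ) (ρ := ρ) hα p
  have h2 := Finset.sum_nonneg fun i (_ : i ∈ Finset.univ) => impurity_nonneg hR.1 α i
  have h3 := Finset.sum_nonneg fun b (_ : b ∈ Finset.univ) =>
    Finset.sum_nonneg fun i (_ : i ∈ Finset.univ) => penalty_nonneg κ hR b i
  unfold povmWitness
  linarith

/-- What a value of the witness within `ε` of the maximum says about a realization. -/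
theorem near_optimal_bounds (hD : 0 < D) {φ : Fin N → Matrix (Fin D) (Fin D) ℂ}
    (hφ : ∀ x, IsPureState (φ x)) {α : Fin N → ℝ} (hα : ∀ x, 0 < α x)
    (hmix : ∑ x, (α x : ℂ) • φ x = (1 / (D : ℂ)) • (1 : Matrix (Fin D) (Fin D) ℂ))
    {d : Fin B → ℕ} (κ : (b : Fin B) → Fin (d b) → Fin N) {ε : ℝ}
    {ρ : Fin N → Matrix (Fin D) (Fin D) ℂ} {Q : Measurements D N B} (hR : IsRealization ρ Q)
    (hε : 1 - 1 / (D : ℝ) - ε ≤ povmWitness φ α κ (born ρ Q)) :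
    (∀ i j, j < i → α i * α j *
      (√(1 - (φ i * φ j).trace.re) - √(1 - (ρ i * ρ j).trace.re)) ^ 2 ≤ ε) ∧
    (∀ i, α i ^ 2 * (1 - (ρ i * ρ i).trace.re) ≤ 2 * ε) ∧
    ∀ b i, born ρ Q (κ b i) (.inr ()) b ≤ ε := by
  have h := stateWitness_add_deficit_le hD hφ hα hmix hR
  have h1 := Finset.sum_nonneg fun p (_ : p ∈ Finset.univ) =>
    mismatch_nonneg (φ := φ) (ρ := ρ) hα p
  have h2 := Finset.sum_nonneg fun i (_ : i ∈ Finset.univ) => impurity_nonneg hR.1 α i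
  have h3' := fun b => Finset.sum_nonneg fun i (_ : i ∈ Finset.univ) => penalty_nonneg κ hR b i
  have h3 := Finset.sum_nonneg fun b (_ : b ∈ Finset.univ) => h3' b
  unfold povmWitness at hε
  refine ⟨fun i j hij => ?_, fun i => ?_, fun b i => ?_⟩
  · have := Finset.single_le_sum (fun p (_ : p ∈ Finset.univ) =>
      mismatch_nonneg (φ := φ) (ρ := ρ) hα p) (Finset.mem_univ ⟨(i, j), hij⟩)
    simp only at this
    linarith
  · have := Finset.single_le_sum (fun i (_ : i ∈ Finset.univ) => impurity_nonneg hR.1 α i)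
      (Finset.mem_univ i)
    linarith
  · have e1 := Finset.single_le_sum (fun i (_ : i ∈ Finset.univ) => penalty_nonneg κ hR b i)
      (Finset.mem_univ i)
    have e2 := Finset.single_le_sum (fun b (_ : b ∈ Finset.univ) => h3' b) (Finset.mem_univ b)
    linarith

/-- The reference states with optimal pairwise measurements and the reference POVM reach the
maximum. -/
theorem exists_realization_eq (hD : 0 < D) {φ : Fin N → Matrix (Fin D) (Fin D) ℂ}
    (hφ : ∀ x, IsPureState (φ x)) {α : Fin N → ℝ}
    (hmix : ∑ x, (α x : ℂ) • φ x = (1 / (D : ℂ)) • (1 : Matrix (Fin D) (Fin D) ℂ))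
    {d : Fin B → ℕ} (κ : (b : Fin B) → Fin (d b) → Fin N)
    {M : Fin B → Matrix (Fin D) (Fin D) ℂ} (hM : M ∈ povms D B)
    (hκM : ∀ b i, (φ (κ b i) * M b).trace.re = 0) :
    ∃ Q : Measurements D N B, IsRealization φ Q ∧
      povmWitness φ α κ (born φ Q) = 1 - 1 / (D : ℝ) := by
  choose E hE hE' hEs using fun p : {p : Fin N × Fin N // p.2 < p.1} =>
    exists_optimal_effect (hφ p.1.1) (hφ p.1.2)
  let Q : Measurements D N B := fun y => match y with
    | .inl p => (![1 - E p, E p] : Fin 2 → Matrix (Fin D) (Fin D) ℂ)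
    | .inr _ => M
  have hR : IsRealization φ Q := by
    refine ⟨fun x => (hφ x).isState, ?_⟩
    rintro (p | _)
    · refine ⟨fun b => ?_, ?_⟩
      · change Fin 2 at b
        fin_cases b
        · exact hE' p
        · exact hE p
      · change ∑ b : Fin 2, (![1 - E p, E p] : Fin 2 → Matrix (Fin D) (Fin D) ℂ) b = 1
        simp
    · exact hM
  refine ⟨Q, hR, ?_⟩
  have hpen : ∑ b : Fin B, ∑ i : Fin (d b), born φ Q (κ b i) (.inr ()) b = 0 :=
    Finset.sum_eq_zero fun b _ => Finset.sum_eq_zero fun i _ => hκM b i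
  unfold povmWitness
  rw [hpen, sub_zero]
  have hsum := sum_weights_eq_one hD (fun x => (hφ x).isState) hmix
  have hterm : ∀ p : {p : Fin N × Fin N // p.2 < p.1},
      α p.1.1 * α p.1.2 * traceNorm (φ p.1.1 - φ p.1.2) *
        (born φ Q p.1.1 (.inl p) (1 : Fin 2) - born φ Q p.1.2 (.inl p) (1 : Fin 2)) =
      2 * (α p.1.1 * α p.1.2 * (1 - (φ p.1.1 * φ p.1.2).trace.re)) := by
    intro p
    have hs : (0 : ℝ) ≤ 1 - (φ p.1.1 * φ p.1.2).trace.re := by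
      linarith [trace_mul_le_one (hφ p.1.1).isState (hφ p.1.2).isState]
    rw [traceNorm_pure_sub (hφ _) (hφ _)]
    change _ * ((φ p.1.1 * E p).trace.re - (φ p.1.2 * E p).trace.re) = _
    rw [hEs, ← Real.sq_sqrt hs, Real.sqrt_sq (Real.sqrt_nonneg _)]
    ring
  unfold stateWitness
  rw [Finset.sum_congr rfl fun p _ => hterm p, ← Finset.mul_sum,
    two_mul_sum_pairs (fun i j => α i * α j * (1 - (φ i * φ j).trace.re))
    (fun i j => by rw [Matrix.trace_mul_comm (φ i)]; ring)]
  have hdiag : ∑ i, α i * α i * (1 - (φ i * φ i).trace.re) = 0 :=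
    Finset.sum_eq_zero fun i _ => by
      rw [(hφ i).mul_self, (hφ i).isState.2, Complex.one_re, sub_self, mul_zero]
  have htot : ∑ i, ∑ j, α i * α j = 1 := by
    simp_rw [← Finset.mul_sum, ← Finset.sum_mul, hsum, mul_one]
  have hφφ := trace_average_sq hD hmix
  rw [hdiag, sub_zero]
  simp only [mul_sub, mul_one, Finset.sum_sub_distrib]
  rw [htot, sum_sum_trace_mul, hφφ]

end Witness

open Filter Asymptotics Topology

/-! ### Approximation along a filter -/

/-- `f` agrees with the constant `a` up to an error `O(θ)` along the filter `l`. -/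
def Approx {ι E : Type*} [NormedAddCommGroup E] (l : Filter ι) (θ : ι → ℝ) (f : ι → E) (a : E) :
    Prop :=
  (fun n => f n - a) =O[l] θ

namespace Approx

variable {ι : Type*} {l : Filter ι} {θ η : ι → ℝ} {E : Type*} [NormedAddCommGroup E]

theorem const (a : E) : Approx l θ (fun _ => a) a := by
  simp only [Approx, sub_self]; exact isBigO_zero _ _

theorem mono {f : ι → E} {a : E} (h : Approx l η f a) (hη : η =O[l] θ) : Approx l θ f a :=
  IsBigO.trans h hη

theorem isBigO_one {f : ι → E} {a : E} (h : Approx l θ f a) (hθ : Tendsto θ l (𝓝 0)) :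
    f =O[l] (fun _ => (1 : ℝ)) := by
  have h1 : (fun n => f n - a) =O[l] (fun _ => (1 : ℝ)) := IsBigO.trans h (hθ.isBigO_one ℝ)
  have h2 := h1.add (isBigO_const_const a (one_ne_zero (α := ℝ)) l)
  simpa using h2

theorem tendsto {f : ι → E} {a : E} (h : Approx l θ f a) (hθ : Tendsto θ l (𝓝 0)) :
    Tendsto f l (𝓝 a) :=
  tendsto_sub_nhds_zero_iff.mp (IsBigO.trans_tendsto h hθ)

theorem unique [l.NeBot] {f : ι → E} {a b : E} (ha : Approx l θ f a) (hb : Approx l θ f b)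
    (hθ : Tendsto θ l (𝓝 0)) : a = b :=
  tendsto_nhds_unique (ha.tendsto hθ) (hb.tendsto hθ)

theorem add {f g : ι → E} {a b : E} (hf : Approx l θ f a) (hg : Approx l θ g b) :
    Approx l θ (fun n => f n + g n) (a + b) := by
  refine (IsBigO.add hf hg).congr_left fun n => ?_
  beta_reduce
  abel

theorem neg {f : ι → E} {a : E} (hf : Approx l θ f a) :
    Approx l θ (fun n => -f n) (-a) := by
  refine (IsBigO.neg_left hf).congr_left fun n => ?_
  beta_reduce
  abel

theorem sub {f g : ι → E} {a b : E} (hf : Approx l θ f a) (hg : Approx l θ g b) :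
    Approx l θ (fun n => f n - g n) (a - b) := by
  refine (IsBigO.sub hf hg).congr_left fun n => ?_
  beta_reduce
  abel

theorem sum {X : Type*} (s : Finset X) {f : X → ι → E} {a : X → E}
    (h : ∀ x ∈ s, Approx l θ (f x) (a x)) :
    Approx l θ (fun n => ∑ x ∈ s, f x n) (∑ x ∈ s, a x) := by
  refine (IsBigO.sum (A := fun x n => f x n - a x) h).congr_left fun n => ?_
  simp only [Finset.sum_apply, Finset.sum_sub_distrib]

theorem mul {𝕜 : Type*} [NormedField 𝕜] {f g : ι → 𝕜} {a b : 𝕜} (hf : Approx l θ f a) (hg : Approx l θ g b)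
    (hθ : Tendsto θ l (𝓝 0)) : Approx l θ (fun n => f n * g n) (a * b) := by
  have h1 : (fun n => (f n - a) * g n) =O[l] fun n => θ n * 1 :=
    IsBigO.mul hf (hg.isBigO_one hθ)
  have h2 : (fun n => a * (g n - b)) =O[l] θ := IsBigO.const_mul_left hg a
  simp only [mul_one] at h1
  refine (h1.add h2).congr_left fun n => ?_
  ring

theorem const_mul {𝕜 : Type*} [NormedField 𝕜] {f : ι → 𝕜} {a : 𝕜} (c : 𝕜) (hf : Approx l θ f a) :
    Approx l θ (fun n => c * f n) (c * a) := by
  refine (IsBigO.const_mul_left hf c).congr_left fun n => ?_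
  ring

theorem of_norm_le {F : Type*} [NormedAddCommGroup F] {f : ι → E} {a : E} {g : ι → F} {b : F}
    (hf : Approx l θ f a) (h : ∀ n, ‖g n - b‖ ≤ ‖f n - a‖) : Approx l θ g b := by
  have h1 : (fun n => g n - b) =O[l] (fun n => f n - a) :=
    IsBigO.of_bound 1 (Eventually.of_forall fun n => by simpa using h n)
  exact IsBigO.trans h1 hf

theorem conj {f : ι → ℂ} {a : ℂ} (hf : Approx l θ f a) :
    Approx l θ (fun n => star (f n)) (star a) :=
  hf.of_norm_le fun n => by rw [← star_sub, norm_star]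

theorem re {f : ι → ℂ} {a : ℂ} (hf : Approx l θ f a) : Approx l θ (fun n => (f n).re) a.re :=
  hf.of_norm_le fun n => by rw [← Complex.sub_re]; exact Complex.abs_re_le_norm _

theorem im {f : ι → ℂ} {a : ℂ} (hf : Approx l θ f a) : Approx l θ (fun n => (f n).im) a.im :=
  hf.of_norm_le fun n => by rw [← Complex.sub_im]; exact Complex.abs_im_le_norm _

theorem ofReal {f : ι → ℝ} {a : ℝ} (hf : Approx l θ f a) :
    Approx l θ (fun n => (f n : ℂ)) (a : ℂ) :=
  hf.of_norm_le fun n => by rw [← Complex.ofReal_sub, Complex.norm_real]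

theorem congr {f g : ι → E} {a b : E} (hf : Approx l θ f a) (h : ∀ n, f n = g n) (hab : a = b) :
    Approx l θ g b := by
  subst hab
  exact IsBigO.congr_left hf fun n => by rw [h n]

/-- Division by a function with non-zero limit. -/
theorem of_mul {𝕜 : Type*} [NormedField 𝕜] {f g : ι → 𝕜} {a b : 𝕜} (hfg : Approx l θ (fun n => f n * g n) (a * b))
    (hg : Approx l θ g b) (hb : b ≠ 0) (hf : f =O[l] (fun _ => (1 : ℝ))) : Approx l θ f a := by
  have h1 : (fun n => f n * (g n - b)) =O[l] fun n => 1 * θ n := hf.mul hg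
  simp only [one_mul] at h1
  refine ((IsBigO.sub hfg h1).const_mul_left b⁻¹).congr_left fun n => ?_
  field_simp
  ring

theorem of_sq_of_nonneg {q : ι → ℝ} {a : ℝ} (ha : 0 < a) (hq : ∀ᶠ n in l, 0 ≤ q n)
    (h : Approx l θ (fun n => q n ^ 2) (a ^ 2)) : Approx l θ q a := by
  have h1 : (fun n => q n - a) =O[l] (fun n => q n ^ 2 - a ^ 2) := by
    refine IsBigO.of_bound a⁻¹ ?_
    filter_upwards [hq] with n hn
    have e : q n ^ 2 - a ^ 2 = (q n + a) * (q n - a) := by ring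
    rw [e, norm_mul, Real.norm_of_nonneg (by linarith : 0 ≤ q n + a), inv_mul_eq_div,
      le_div_iff₀ ha, mul_comm]
    exact mul_le_mul_of_nonneg_right (by linarith) (norm_nonneg _)
  exact IsBigO.trans h1 h

/-- Along an ultrafilter the sign of a square root is eventually constant. -/
theorem of_sq {u : Ultrafilter ι} {q : ι → ℝ} {a : ℝ} (ha : a ≠ 0)
    (h : Approx (u : Filter ι) θ (fun n => q n ^ 2) (a ^ 2)) :
    Approx (u : Filter ι) θ q a ∨ Approx (u : Filter ι) θ q (-a) := by
  wlog hpos : 0 < a generalizing a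
  · have := this (neg_ne_zero.mpr ha) (by rwa [neg_sq])
      (by have := lt_of_le_of_ne (not_lt.mp hpos) ha; linarith)
    rw [neg_neg] at this
    exact this.symm
  rcases Ultrafilter.eventually_or.mp (Eventually.of_forall (f := (u : Filter ι))
    fun n => le_total 0 (q n)) with h0 | h0
  · exact Or.inl (of_sq_of_nonneg hpos h0 h)
  · right
    have := of_sq_of_nonneg (q := fun n => - q n) hpos (h0.mono fun n hn => by linarith)
      (h.congr (fun n => by rw [neg_sq]) rfl)
    exact this.neg.congr (fun n => by rw [neg_neg]) rfl

end Approx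

/-! ### Families of pure states with given overlaps -/

namespace IsPureState

variable {D : ℕ} {P : Matrix (Fin D) (Fin D) ℂ}

theorem star_apply (hP : IsPureState P) (j k : Fin D) : star (P j k) = P k j :=
  hP.isState.1.1.apply k j

theorem apply_mul_apply (hP : IsPureState P) (j k m : Fin D) :
    P j k * P k m = P j m * P k k := by
  obtain ⟨v, -, rfl⟩ := hP
  simp only [ketbra_apply]; ring

theorem norm_apply_le (hP : IsPureState P) (j k : Fin D) : ‖P j k‖ ≤ 1 := by
  obtain ⟨v, hv, rfl⟩ := hP
  have h := fun i => PiLp.norm_apply_le v i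
  rw [hv] at h
  rw [ketbra_apply, norm_mul, norm_star]
  exact mul_le_one₀ (h j) (norm_nonneg _) (h k)

theorem norm_sq_apply (hP : IsPureState P) (j k : Fin D) :
    ((‖P j k‖ ^ 2 : ℝ) : ℂ) = P j j * P k k := by
  rw [← Complex.normSq_eq_norm_sq, ← Complex.mul_conj, ← Complex.star_def, hP.star_apply,
    hP.apply_mul_apply]

theorem apply_eq_zero (hP : IsPureState P) {j : Fin D} (h : P j j = 0) (k : Fin D) :
    P j k = 0 ∧ P k j = 0 := by
  have h1 := hP.norm_sq_apply j k
  rw [h, zero_mul] at h1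
  have h2 : P j k = 0 := by
    have : ‖P j k‖ ^ 2 = 0 := by exact_mod_cast h1
    simpa using this
  exact ⟨h2, by rw [← hP.star_apply, h2, star_zero]⟩

theorem transpose (hP : IsPureState P) : IsPureState Pᵀ := by
  obtain ⟨v, hv, rfl⟩ := hP
  refine ⟨WithLp.toLp 2 (star v.ofLp), ?_, ?_⟩
  · rw [EuclideanSpace.norm_eq] at hv ⊢
    simpa using hv
  · ext i j
    simp [ketbra_apply, mul_comm]

theorem conj_unitary (hP : IsPureState P) {F : Matrix (Fin D) (Fin D) ℂ}
    (hF : F ∈ Matrix.unitaryGroup (Fin D) ℂ) : IsPureState (Fᴴ * P * F) := by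
  obtain ⟨v, hv, rfl⟩ := hP
  set w : EuclideanSpace ℂ (Fin D) := WithLp.toLp 2 (Fᴴ *ᵥ v.ofLp) with hw
  have hk : Fᴴ * ketbra v * F = ketbra w := by
    unfold ketbra
    rw [Matrix.mul_vecMulVec, Matrix.vecMulVec_mul]
    congr 1
    change (star v.ofLp) ᵥ* F = star (Fᴴ *ᵥ v.ofLp)
    rw [Matrix.star_mulVec, Matrix.conjTranspose_conjTranspose]
  refine ⟨w, ?_, hk⟩
  have h1 : (ketbra w).trace = (ketbra v).trace := by
    rw [← hk, Matrix.trace_mul_comm, ← Matrix.mul_assoc]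
    have : F * Fᴴ = 1 := Matrix.mem_unitaryGroup_iff.mp hF
    rw [this, Matrix.one_mul]
  rw [trace_ketbra, trace_ketbra, hv] at h1
  have h2 : ‖w‖ ^ 2 = 1 ^ 2 := Complex.ofReal_injective h1
  exact (sq_eq_sq₀ (norm_nonneg w) zero_le_one).mp h2

end IsPureState

section Overlaps

variable {D : ℕ} {X ι : Type*} {l : Filter ι} {θ η : ι → ℝ}
  {R : X → ι → Matrix (Fin D) (Fin D) ℂ} {r : X → Matrix (Fin D) (Fin D) ℂ}

theorem isBigO_one_apply (hR : ∀ x n, IsPureState (R x n)) (x : X) (j k : Fin D) :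
    (fun n => R x n j k) =O[l] (fun _ => (1 : ℝ)) :=
  IsBigO.of_bound 1 (Eventually.of_forall fun n => by simpa using (hR x n).norm_apply_le j k)

/-- Once the state `x` is known up to `O(η)`, its overlap with any other state `y` of the family
is a known linear functional of `y`. -/
theorem approx_overlap (hR : ∀ x n, IsPureState (R x n))
    (hov : ∀ x y, Approx l η (fun n => (R x n * R y n).trace) (r x * r y).trace)
    {x : X} {s : Matrix (Fin D) (Fin D) ℂ} (hx : ∀ j k, Approx l η (fun n => R x n j k) (s j k))
    (y : X) : Approx l η (fun n => (s * R y n).trace) (r x * r y).trace := by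
  have h1 : ∀ j k, Approx l η (fun n => (R x n j k - s j k) * R y n k j) 0 := by
    intro j k
    have h2 : (fun n => (R x n j k - s j k) * R y n k j) =O[l] fun n => η n * 1 :=
      IsBigO.mul (hx j k) (isBigO_one_apply (l := l) hR y k j)
    exact h2.congr (fun n => by rw [sub_zero]) fun n => mul_one _
  have h2 := Approx.sum Finset.univ fun j _ => Approx.sum Finset.univ fun k _ => h1 j k
  refine ((hov x y).sub h2).congr (fun n => ?_) (by simp)
  simp only [Matrix.trace, Matrix.diag, Matrix.mul_apply, sub_mul, Finset.sum_sub_distrib]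
  ring

theorem approx_apply_swap (hR : ∀ x n, IsPureState (R x n)) {x : X} {j k : Fin D} {a : ℂ}
    (h : Approx l θ (fun n => R x n j k) a) : Approx l θ (fun n => R x n k j) (star a) :=
  h.conj.congr (fun n => (hR x n).star_apply j k) rfl

theorem approx_norm_sq (hR : ∀ x n, IsPureState (R x n)) (hr : ∀ x, IsPureState (r x))
    (hη : Tendsto η l (𝓝 0)) (hdiag : ∀ x k, Approx l η (fun n => R x n k k) (r x k k))
    (x : X) (j k : Fin D) : Approx l η (fun n => ‖R x n j k‖ ^ 2) (‖r x j k‖ ^ 2) := by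
  have h := ((hdiag x j).mul (hdiag x k) hη).re
  refine h.congr (fun n => ?_) ?_
  · rw [← (hR x n).norm_sq_apply, Complex.ofReal_re]
  · rw [← (hr x).norm_sq_apply, Complex.ofReal_re]

/-- Entries that vanish in the reference are small, at the price of a square root. -/
theorem approx_zero (hR : ∀ x n, IsPureState (R x n)) (hr : ∀ x, IsPureState (r x))
    (hθ : Tendsto θ l (𝓝 0))
    (hdiag : ∀ x k, Approx l (fun n => θ n ^ 2) (fun n => R x n k k) (r x k k))
    {x : X} {j k : Fin D} (h0 : r x j k = 0) : Approx l θ (fun n => R x n j k) 0 := by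
  have hη : Tendsto (fun n => θ n ^ 2) l (𝓝 0) := by simpa using hθ.pow 2
  have h := approx_norm_sq hR hr hη hdiag x j k
  rw [h0] at h
  have h' : (fun n => ‖R x n j k‖ ^ 2) =O[l] (fun n => θ n ^ 2) :=
    IsBigO.congr_left h fun n => by simp
  have h2 := (IsBigO.of_pow (f := fun n => ‖R x n j k‖) (g := θ) two_ne_zero h').of_norm_left
  exact IsBigO.congr_left h2 fun n => by simp

theorem approx_of_nonneg (hR : ∀ x n, IsPureState (R x n)) (hr : ∀ x, IsPureState (r x))
    (hη : Tendsto η l (𝓝 0)) (hdiag : ∀ x k, Approx l η (fun n => R x n k k) (r x k k))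
    {x : X} {j k : Fin D} (hpos : 0 < r x j k) (hnn : ∀ n, 0 ≤ R x n j k) :
    Approx l η (fun n => R x n j k) (r x j k) := by
  have h := Approx.of_sq_of_nonneg (norm_pos_iff.mpr hpos.ne')
    (Eventually.of_forall fun n => norm_nonneg _) (approx_norm_sq hR hr hη hdiag x j k)
  exact h.ofReal.congr (fun n => Complex.norm_of_nonneg' (hnn n)) (Complex.norm_of_nonneg' hpos.le)

end Overlaps

/-! ### Rigidity of families of pure states -/

section Rigidity

variable {X ι : Type*} {u : Ultrafilter ι} {θ : ι → ℝ}

theorem approx_of_re_im {D : ℕ} {R : ι → Matrix (Fin D) (Fin D) ℂ} {j k : Fin D} {a : ℂ}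
    {l : Filter ι} (hre : Approx l θ (fun n => (R n j k).re) a.re)
    (him : Approx l θ (fun n => (R n j k).im) a.im) : Approx l θ (fun n => R n j k) a :=
  (hre.ofReal.add (him.ofReal.const_mul Complex.I)).congr
    (fun n => by rw [mul_comm]; exact Complex.re_add_im _)
    (by rw [mul_comm]; exact Complex.re_add_im _)

theorem isBigO_sq_of_tendsto {l : Filter ι} (hθ : Tendsto θ l (𝓝 0)) :
    (fun n => θ n ^ 2) =O[l] θ := by
  have h : (fun n => θ n * θ n) =O[l] fun n => θ n * 1 :=
    (isBigO_refl θ l).mul (hθ.isBigO_one ℝ)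
  refine h.congr (fun n => (sq _).symm) fun n => mul_one _

/-- Pure qubit states whose overlaps and diagonal entries are known are known up to a common
complex conjugation, provided the phase of one non-zero off-diagonal entry is normalised. The
real parts of the off-diagonal entries are read off from the overlaps with the normalised state,
and the overlaps then give all products of two imaginary parts. -/
theorem qubit_rigidity {R : X → ι → Matrix (Fin 2) (Fin 2) ℂ} {r : X → Matrix (Fin 2) (Fin 2) ℂ}
    (hθ : Tendsto θ u (𝓝 0)) (hR : ∀ x n, IsPureState (R x n)) (hr : ∀ x, IsPureState (r x))
    (hov : ∀ x y, Approx (u : Filter ι) (fun n => θ n ^ 2) (fun n => (R x n * R y n).trace)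
      (r x * r y).trace)
    (hdiag : ∀ x k, Approx (u : Filter ι) (fun n => θ n ^ 2) (fun n => R x n k k) (r x k k))
    (hphase : (∀ x, r x 0 1 = 0) ∨ ∃ x, 0 < r x 0 1 ∧ ∀ n, 0 ≤ R x n 0 1) :
    (∀ x j k, Approx (u : Filter ι) θ (fun n => R x n j k) (r x j k)) ∨
    (∀ x j k, Approx (u : Filter ι) θ (fun n => R x n j k) (r x k j)) := by
  have hη : Tendsto (fun n => θ n ^ 2) u (𝓝 0) := by simpa using hθ.pow 2
  have hmono := isBigO_sq_of_tendsto hθ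
  -- only the entry `(0, 1)` has to be controlled
  have hall : ∀ x, Approx (u : Filter ι) θ (fun n => R x n 0 1) (r x 0 1) →
      ∀ j k, Approx (u : Filter ι) θ (fun n => R x n j k) (r x j k) := by
    intro x h j k
    fin_cases j <;> fin_cases k
    · exact (hdiag x 0).mono hmono
    · exact h
    · exact (approx_apply_swap hR h).congr (fun _ => rfl) ((hr x).star_apply 0 1)
    · exact (hdiag x 1).mono hmono
  have hall' : ∀ x, Approx (u : Filter ι) θ (fun n => R x n 0 1) (r x 1 0) →
      ∀ j k, Approx (u : Filter ι) θ (fun n => R x n j k) (r x k j) := by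
    intro x h j k
    fin_cases j <;> fin_cases k
    · exact (hdiag x 0).mono hmono
    · exact h
    · exact (approx_apply_swap hR h).congr (fun _ => rfl) ((hr x).star_apply 1 0)
    · exact (hdiag x 1).mono hmono
  rcases hphase with h0 | ⟨x₁, hx₁, hx₁'⟩
  · left
    refine fun x => hall x ?_
    rw [h0 x]
    exact approx_zero hR hr hθ hdiag (h0 x)
  have hstar : ∀ x, r x 1 0 = star (r x 0 1) := fun x => ((hr x).star_apply 0 1).symm
  have hStar : ∀ x n, R x n 1 0 = star (R x n 0 1) := fun x n => ((hR x n).star_apply 0 1).symm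
  have htr : ∀ s t : Matrix (Fin 2) (Fin 2) ℂ, s 1 0 = star (s 0 1) → t 1 0 = star (t 0 1) →
      (s * t).trace.re = (s 0 0 * t 0 0 + s 1 1 * t 1 1).re +
        2 * ((s 0 1).re * (t 0 1).re + (s 0 1).im * (t 0 1).im) := by
    intro s t hs ht
    simp only [Matrix.trace_fin_two, Matrix.mul_apply, Fin.sum_univ_two, hs, ht]
    simp
    ring
  -- `Re Re + Im Im` of two states is known
  have hprod : ∀ x y, Approx (u : Filter ι) (fun n => θ n ^ 2)
      (fun n => (R x n 0 1).re * (R y n 0 1).re + (R x n 0 1).im * (R y n 0 1).im)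
      ((r x 0 1).re * (r y 0 1).re + (r x 0 1).im * (r y 0 1).im) := by
    intro x y
    have h1 := (hov x y).re
    have h2 := (((hdiag x 0).mul (hdiag y 0) hη).add ((hdiag x 1).mul (hdiag y 1) hη)).re
    refine ((h1.sub h2).const_mul (1 / 2 : ℝ)).congr (fun n => ?_) ?_
    · rw [htr _ _ (hStar x n) (hStar y n)]; ring
    · rw [htr _ _ (hstar x) (hstar y)]; ring
  have hx₁R := approx_of_nonneg hR hr hη hdiag hx₁ hx₁'
  have hre₁ : 0 < (r x₁ 0 1).re := (Complex.lt_def.mp hx₁).1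
  have him₁ : (r x₁ 0 1).im = 0 := (Complex.lt_def.mp hx₁).2.symm
  have hre : ∀ y, Approx (u : Filter ι) (fun n => θ n ^ 2) (fun n => (R y n 0 1).re)
      (r y 0 1).re := by
    intro y
    refine Approx.of_mul (g := fun n => (R x₁ n 0 1).re) (b := (r x₁ 0 1).re) ?_ hx₁R.re hre₁.ne' ?_
    · refine (hprod x₁ y).congr (fun n => ?_) ?_
      · rw [← (Complex.le_def.mp (hx₁' n)).2]; simp; ring
      · rw [him₁]; ring
    · refine IsBigO.of_bound 1 (Eventually.of_forall fun n => ?_)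
      simpa using (Complex.abs_re_le_norm _).trans ((hR y n).norm_apply_le 0 1)
  have him : ∀ x y, Approx (u : Filter ι) (fun n => θ n ^ 2)
      (fun n => (R x n 0 1).im * (R y n 0 1).im) ((r x 0 1).im * (r y 0 1).im) := by
    intro x y
    exact ((hprod x y).sub ((hre x).mul (hre y) hη)).congr (fun n => by ring) (by ring)
  by_cases hzero : ∀ x, (r x 0 1).im = 0
  · left
    refine fun x => hall x (approx_of_re_im ((hre x).mono hmono) ?_)
    have h := him x x
    rw [hzero x] at h ⊢
    have h' : (fun n => (R x n 0 1).im ^ 2) =O[(u : Filter ι)] (fun n => θ n ^ 2) :=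
      IsBigO.congr_left h fun n => by ring
    have h2 := IsBigO.of_pow (f := fun n => (R x n 0 1).im) (g := θ) two_ne_zero h'
    exact IsBigO.congr_left h2 fun n => by simp
  push Not at hzero
  obtain ⟨x₂, hx₂⟩ := hzero
  have hsq : Approx (u : Filter ι) (fun n => θ n ^ 2) (fun n => (R x₂ n 0 1).im ^ 2)
      ((r x₂ 0 1).im ^ 2) := (him x₂ x₂).congr (fun n => by ring) (by ring)
  have hbound : ∀ y, (fun n => (R y n 0 1).im) =O[(u : Filter ι)] (fun _ => (1 : ℝ)) := by
    intro y
    refine IsBigO.of_bound 1 (Eventually.of_forall fun n => ?_)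
    simpa using (Complex.abs_im_le_norm _).trans ((hR y n).norm_apply_le 0 1)
  rcases Approx.of_sq hx₂ hsq with h | h
  · left
    refine fun y => hall y (approx_of_re_im ((hre y).mono hmono) (Approx.mono ?_ hmono))
    exact Approx.of_mul ((him y x₂).congr (fun _ => rfl) rfl) h hx₂ (hbound y)
  · right
    refine fun y => hall' y (approx_of_re_im (((hre y).mono hmono).congr (fun _ => rfl) ?_)
      (Approx.mono ?_ hmono))
    · rw [hstar]; simp
    · refine Approx.of_mul ((him y x₂).congr (fun _ => rfl) ?_) h (neg_ne_zero.mpr hx₂) (hbound y)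
      rw [hstar]; simp

theorem trace_mul_of_pair {D : ℕ} {s T : Matrix (Fin D) (Fin D) ℂ} {k l : Fin D} (hkl : k ≠ l)
    (hs : ∀ j m, s j m ≠ 0 → (j = k ∨ j = l) ∧ (m = k ∨ m = l)) :
    (s * T).trace = s k k * T k k + s k l * T l k + (s l k * T k l + s l l * T l l) := by
  have inner : ∀ j, ∑ m, s j m * T m j = s j k * T k j + s j l * T l j := by
    intro j
    rw [← Finset.sum_pair (f := fun m => s j m * T m j) hkl]
    refine (Finset.sum_subset (Finset.subset_univ _) fun m _ hm => ?_).symm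
    by_contra h
    exact hm (by simpa using (hs j m (left_ne_zero_of_mul h)).2)
  simp only [Matrix.trace, Matrix.diag, Matrix.mul_apply, inner]
  rw [← Finset.sum_pair (f := fun j => s j k * T k j + s j l * T l j) hkl]
  refine (Finset.sum_subset (Finset.subset_univ _) fun j _ hj => ?_).symm
  rw [← inner]
  refine Finset.sum_eq_zero fun m _ => ?_
  by_contra h
  exact hj (by simpa using (hs j m (left_ne_zero_of_mul h)).1)

theorem trace_mul_of_triple {D : ℕ} {s T : Matrix (Fin D) (Fin D) ℂ} {k l m : Fin D}
    (hkl : k ≠ l) (hkm : k ≠ m) (hlm : l ≠ m)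
    (hs : ∀ i j, s i j ≠ 0 → (i = k ∨ i = l ∨ i = m) ∧ (j = k ∨ j = l ∨ j = m)) :
    (s * T).trace = (s k k * T k k + s k l * T l k + s k m * T m k) +
      (s l k * T k l + s l l * T l l + s l m * T m l) +
      (s m k * T k m + s m l * T l m + s m m * T m m) := by
  have three : ∀ f : Fin D → ℂ, ∑ j ∈ ({k, l, m} : Finset (Fin D)), f j = f k + f l + f m := by
    intro f
    rw [Finset.sum_insert (by simp [hkl, hkm]), Finset.sum_pair hlm, add_assoc]
  have inner : ∀ i, ∑ j, s i j * T j i = s i k * T k i + s i l * T l i + s i m * T m i := by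
    intro i
    rw [← three fun j => s i j * T j i]
    refine (Finset.sum_subset (Finset.subset_univ _) fun j _ hj => ?_).symm
    by_contra h
    exact hj (by simpa using (hs i j (left_ne_zero_of_mul h)).2)
  simp only [Matrix.trace, Matrix.diag, Matrix.mul_apply, inner]
  rw [← three fun i => s i k * T k i + s i l * T l i + s i m * T m i]
  refine (Finset.sum_subset (Finset.subset_univ _) fun i _ hi => ?_).symm
  rw [← inner]
  refine Finset.sum_eq_zero fun j _ => ?_
  by_contra h
  exact hi (by simpa using (hs i j (left_ne_zero_of_mul h)).1)

/-- A pure state with non-zero diagonal is determined by its diagonal and its superdiagonal. -/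
theorem approx_of_superdiagonal {D : ℕ} {l : Filter ι} {R : ι → Matrix (Fin D) (Fin D) ℂ}
    {s : Matrix (Fin D) (Fin D) ℂ} (hθ : Tendsto θ l (𝓝 0)) (hR : ∀ n, IsPureState (R n))
    (hs : IsPureState s) (hdiag : ∀ k, Approx l θ (fun n => R n k k) (s k k))
    (hs0 : ∀ k, s k k ≠ 0)
    (hadj : ∀ j k : Fin D, (k : ℕ) = j + 1 → Approx l θ (fun n => R n j k) (s j k))
    (j k : Fin D) : Approx l θ (fun n => R n j k) (s j k) := by
  have hup : ∀ (i : ℕ) (j k : Fin D), (k : ℕ) = j + i → Approx l θ (fun n => R n j k) (s j k) := by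
    intro i
    induction i with
    | zero =>
      intro j k h
      obtain rfl : k = j := Fin.ext h
      exact hdiag k
    | succ i ih =>
      intro j k h
      let m : Fin D := ⟨j + i, by omega⟩
      have h1 := ih j m rfl
      have h2 := hadj m k (by simp [m, h]; omega)
      refine Approx.of_mul ((h1.mul h2 hθ).congr (fun n => (hR n).apply_mul_apply j m k)
        (hs.apply_mul_apply j m k)) (hdiag m) (hs0 m) ?_
      exact IsBigO.of_bound 1 (Eventually.of_forall fun n => by
        simpa using (hR n).norm_apply_le j k)
  rcases le_total (j : ℕ) k with h | h
  · exact hup (k - j) j k (by omega)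
  · exact (hup (j - k) k j (by omega)).conj.congr (fun n => (hR n).star_apply k j)
      (hs.star_apply k j)

/-- Pure states of dimension `D` whose overlaps and diagonal entries are known, and which have no
vanishing diagonal entry, are known up to a common complex conjugation, when the family contains
the two- and three-level superpositions of neighbouring basis vectors. The phases of the basis are
normalised by the positivity of the superdiagonal entries of the states `(e_k + e_{k+1})/√2`. The
states `(e_k + i e_{k+1})/√2` then fix the superdiagonal entries of all states up to conjugation
separately for each `k`, and the overlap of the two three-level states forbids different choices
for neighbouring `k`. -/
theorem fiducial_rigidity {D : ℕ} {R : X → ι → Matrix (Fin D) (Fin D) ℂ}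
    {r : X → Matrix (Fin D) (Fin D) ℂ}
    (hθ : Tendsto θ u (𝓝 0)) (hR : ∀ x n, IsPureState (R x n)) (hr : ∀ x, IsPureState (r x))
    (hov : ∀ x y, Approx (u : Filter ι) (fun n => θ n ^ 2) (fun n => (R x n * R y n).trace)
      (r x * r y).trace)
    (hdiag : ∀ x k, Approx (u : Filter ι) (fun n => θ n ^ 2) (fun n => R x n k k) (r x k k))
    (hpair : ∀ k l : Fin D, (l : ℕ) = k + 1 → ∃ x, r x k k = 1 / 2 ∧ r x l l = 1 / 2 ∧
      r x k l = 1 / 2 ∧ (∀ j, j ≠ k → j ≠ l → r x j j = 0) ∧ ∀ n, 0 ≤ R x n k l)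
    (hpairI : ∀ k l : Fin D, (l : ℕ) = k + 1 → ∃ x, r x k k = 1 / 2 ∧ r x l l = 1 / 2 ∧
      r x k l = -Complex.I / 2 ∧ ∀ j, j ≠ k → j ≠ l → r x j j = 0)
    (htriple : ∀ k l m : Fin D, (l : ℕ) = k + 1 → (m : ℕ) = k + 2 → ∃ x, r x k k = 1 / 3 ∧
      r x l l = 1 / 3 ∧ r x m m = 1 / 3 ∧ r x k l = 1 / 3 ∧ r x l m = 1 / 3 ∧ r x k m = 1 / 3 ∧
      ∀ j, j ≠ k → j ≠ l → j ≠ m → r x j j = 0)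
    (htripleI : ∀ k l m : Fin D, (l : ℕ) = k + 1 → (m : ℕ) = k + 2 → ∃ x, r x k k = 1 / 3 ∧
      r x l l = 1 / 3 ∧ r x m m = 1 / 3 ∧ r x k l = Complex.I / 3 ∧ r x l m = -Complex.I / 3 ∧
      r x k m = 1 / 3) :
    (∀ x, (∀ k, r x k k ≠ 0) → ∀ j k, Approx (u : Filter ι) θ (fun n => R x n j k) (r x j k)) ∨
    (∀ x, (∀ k, r x k k ≠ 0) → ∀ j k, Approx (u : Filter ι) θ (fun n => R x n j k) (r x k j)) := by
  have hη : Tendsto (fun n => θ n ^ 2) u (𝓝 0) := by simpa using hθ.pow 2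
  have hmono := isBigO_sq_of_tendsto hθ
  have hov' := fun x y => (hov x y).mono hmono
  have hdiag' := fun x k => (hdiag x k).mono hmono
  -- a row without diagonal entry vanishes
  have hrow : ∀ x i j, r x i j ≠ 0 → r x i i ≠ 0 ∧ r x j j ≠ 0 := fun x i j h =>
    ⟨fun h0 => h ((hr x).apply_eq_zero h0 j).1, fun h0 => h ((hr x).apply_eq_zero h0 i).2⟩
  have hsupp : ∀ {x : X} {k l : Fin D}, (∀ j, j ≠ k → j ≠ l → r x j j = 0) →
      ∀ i j, r x i j ≠ 0 → (i = k ∨ i = l) ∧ (j = k ∨ j = l) := by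
    intro x k l h0 i j hij
    have hij' := hrow x i j hij
    constructor
    · by_contra! h; exact hij'.1 (h0 i h.1 h.2)
    · by_contra! h; exact hij'.2 (h0 j h.1 h.2)
  have hz : ∀ x j m, r x j m = 0 → Approx (u : Filter ι) θ (fun n => R x n j m) 0 :=
    fun x j m h => approx_zero hR hr hθ hdiag h
  have hdd : ∀ (y : X) (k : Fin D), Approx (u : Filter ι) θ (fun n => R y n k k) (r y k k) := hdiag'
  -- symmetric combinations of neighbouring entries
  have hsym : ∀ k l : Fin D, (l : ℕ) = k + 1 → ∀ y,
      Approx (u : Filter ι) θ (fun n => R y n k l + R y n l k) (r y k l + r y l k) := by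
    intro k l hkl y
    obtain ⟨x, hk, hl, hxkl, h0, hnn⟩ := hpair k l hkl
    have hne : k ≠ l := fun h => by rw [h] at hkl; omega
    have hlk : r x l k = 1 / 2 := by rw [← (hr x).star_apply k l, hxkl]; simp
    have hRkl := (approx_of_nonneg hR hr hη hdiag (x := x) (j := k) (k := l)
      (by rw [hxkl]; norm_num) hnn).mono hmono
    have hknown : ∀ i j, Approx (u : Filter ι) θ (fun n => R x n i j) (r x i j) := by
      intro i j
      by_cases h : r x i j = 0
      · rw [h]; exact hz x i j h
      obtain ⟨rfl | rfl, rfl | rfl⟩ := hsupp h0 i j h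
      · exact hdd x _
      · exact hRkl
      · exact (approx_apply_swap hR hRkl).congr (fun _ => rfl) ((hr x).star_apply _ _)
      · exact hdd x _
    have h1 := approx_overlap hR hov' hknown y
    have h2 := ((h1.sub ((hdd y k).const_mul (1 / 2))).sub ((hdd y l).const_mul (1 / 2))).const_mul 2
    refine h2.congr (fun n => ?_) ?_
    · rw [trace_mul_of_pair hne (hsupp h0), hk, hl, hlk, hxkl]; ring
    · rw [trace_mul_of_pair hne (hsupp h0), hk, hl, hlk, hxkl]; ring
  -- neighbouring entries of all states, up to one conjugation for each `k`
  have hadj : ∀ k l : Fin D, (l : ℕ) = k + 1 →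
      (∀ y, Approx (u : Filter ι) θ (fun n => R y n k l) (r y k l)) ∨
      (∀ y, Approx (u : Filter ι) θ (fun n => R y n k l) (r y l k)) := by
    intro k l hkl
    obtain ⟨x, hk, hl, hxkl, h0⟩ := hpairI k l hkl
    have hne : k ≠ l := fun h => by rw [h] at hkl; omega
    have hlk : r x l k = Complex.I / 2 := by rw [← (hr x).star_apply k l, hxkl]; simp
    have hre : Approx (u : Filter ι) θ (fun n => (R x n k l).re) (r x k l).re := by
      refine ((hsym k l hkl x).re.const_mul (1 / 2 : ℝ)).congr (fun n => ?_) ?_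
      · rw [← (hR x n).star_apply k l]; simp; ring
      · rw [← (hr x).star_apply k l]; simp; ring
    have him : Approx (u : Filter ι) θ (fun n => (R x n k l).im ^ 2) ((r x k l).im ^ 2) := by
      have h1 := (approx_norm_sq hR hr hη hdiag x k l).mono hmono
      refine (h1.sub (hre.mul hre hθ)).congr (fun n => ?_) ?_
      · rw [← Complex.normSq_eq_norm_sq, Complex.normSq_apply]; ring
      · rw [← Complex.normSq_eq_norm_sq, Complex.normSq_apply]; ring
    have him0 : (r x k l).im ≠ 0 := by rw [hxkl]; simp
    rcases Approx.of_sq him0 him with h | h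
    · left
      intro y
      have hRkl := approx_of_re_im hre h
      have hknown : ∀ i j, Approx (u : Filter ι) θ (fun n => R x n i j) (r x i j) := by
        intro i j
        by_cases h : r x i j = 0
        · rw [h]; exact hz x i j h
        obtain ⟨rfl | rfl, rfl | rfl⟩ := hsupp h0 i j h
        · exact hdd x _
        · exact hRkl
        · exact (approx_apply_swap hR hRkl).congr (fun _ => rfl) ((hr x).star_apply _ _)
        · exact hdd x _
      have h1 := approx_overlap hR hov' hknown y
      have h2 := ((h1.sub ((hdd y k).const_mul (1 / 2))).sub
        ((hdd y l).const_mul (1 / 2))).const_mul (-Complex.I)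
      refine (h2.add ((hsym k l hkl y).const_mul (1 / 2))).congr (fun n => ?_) ?_
      · rw [trace_mul_of_pair hne (hsupp h0), hk, hl, hlk, hxkl]
        linear_combination (R y n l k / 2 - R y n k l / 2) * Complex.I_mul_I
      · rw [trace_mul_of_pair hne (hsupp h0), hk, hl, hlk, hxkl]
        linear_combination (r y l k / 2 - r y k l / 2) * Complex.I_mul_I
    · right
      intro y
      have hRkl : Approx (u : Filter ι) θ (fun n => R x n k l) (r x l k) := by
        refine approx_of_re_im (hre.congr (fun _ => rfl) ?_) (h.congr (fun _ => rfl) ?_)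
        · rw [← (hr x).star_apply k l]; simp
        · rw [← (hr x).star_apply k l]; simp
      have hsupp' : ∀ i j, (r x)ᵀ i j ≠ 0 → (i = k ∨ i = l) ∧ (j = k ∨ j = l) :=
        fun i j h => (hsupp h0 j i h).symm
      have hknown : ∀ i j, Approx (u : Filter ι) θ (fun n => R x n i j) ((r x)ᵀ i j) := by
        intro i j
        by_cases h : r x i j = 0
        · rw [Matrix.transpose_apply, ← (hr x).star_apply i j, h, star_zero]; exact hz x i j h
        obtain ⟨rfl | rfl, rfl | rfl⟩ := hsupp h0 i j h
        · exact hdd x _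
        · exact hRkl
        · exact (approx_apply_swap hR hRkl).congr (fun _ => rfl) ((hr x).star_apply _ _)
        · exact hdd x _
      have h1 := approx_overlap hR hov' hknown y
      have h2 := ((h1.sub ((hdd y k).const_mul (1 / 2))).sub
        ((hdd y l).const_mul (1 / 2))).const_mul Complex.I
      refine (h2.add ((hsym k l hkl y).const_mul (1 / 2))).congr (fun n => ?_) ?_
      · rw [trace_mul_of_pair hne hsupp']
        simp only [Matrix.transpose_apply]
        rw [hk, hl, hlk, hxkl]
        linear_combination (R y n l k / 2 - R y n k l / 2) * Complex.I_mul_I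
      · rw [trace_mul_of_pair hne (hsupp h0), hk, hl, hlk, hxkl]
        linear_combination (r y k l / 2 - r y l k / 2) * Complex.I_mul_I
  -- the choices for neighbouring `k` agree
  have hclash : ∀ k l m : Fin D, (l : ℕ) = k + 1 → (m : ℕ) = k + 2 → ∀ x y : X,
      (r x k k = 1 / 3 ∧ r x l l = 1 / 3 ∧ r x m m = 1 / 3 ∧ r x k l = 1 / 3 ∧ r x l m = 1 / 3 ∧
        r x k m = 1 / 3 ∧ ∀ j, j ≠ k → j ≠ l → j ≠ m → r x j j = 0) →
      (r y k k = 1 / 3 ∧ r y l l = 1 / 3 ∧ r y m m = 1 / 3 ∧ r y k l = Complex.I / 3 ∧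
        r y l m = -Complex.I / 3 ∧ r y k m = 1 / 3) →
      Approx (u : Filter ι) θ (fun n => R x n k l) (1 / 3) →
      Approx (u : Filter ι) θ (fun n => R x n l m) (1 / 3) →
      ∀ a : ℂ, a * a = -1 / 9 → star a = -a → Approx (u : Filter ι) θ (fun n => R y n k l) a →
      Approx (u : Filter ι) θ (fun n => R y n l m) a → False := by
    rintro k l m hkl hkm x y ⟨xk, xl, xm, xkl, xlm, xkm, x0⟩ ⟨yk, yl, ym, ykl, ylm, ykm⟩
      hxkl hxlm a ha ha' hykl hylm
    have hne₁ : k ≠ l := fun h => by rw [h] at hkl; omega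
    have hne₂ : k ≠ m := fun h => by rw [h] at hkm; omega
    have hne₃ : l ≠ m := fun h => by rw [h] at hkl; omega
    have hxkm : Approx (u : Filter ι) θ (fun n => R x n k m) (1 / 3) := by
      refine Approx.of_mul (b := r x l l) ((hxkl.mul hxlm hθ).congr
        (fun n => (hR x n).apply_mul_apply k l m) (by rw [xl])) (hdd x l) (by rw [xl]; norm_num)
        (isBigO_one_apply hR x k m)
    have hykm : Approx (u : Filter ι) θ (fun n => R y n k m) (-1 / 3) := by
      refine Approx.of_mul (b := r y l l) ((hykl.mul hylm hθ).congr
        (fun n => (hR y n).apply_mul_apply k l m) (by rw [yl, ha]; norm_num)) (hdd y l)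
        (by rw [yl]; norm_num) (isBigO_one_apply hR y k m)
    have xlk : r x l k = 1 / 3 := by rw [← (hr x).star_apply k l, xkl]; simp
    have xml : r x m l = 1 / 3 := by rw [← (hr x).star_apply l m, xlm]; simp
    have xmk : r x m k = 1 / 3 := by rw [← (hr x).star_apply k m, xkm]; simp
    have ylk : r y l k = -Complex.I / 3 := by rw [← (hr y).star_apply k l, ykl]; simp
    have yml : r y m l = Complex.I / 3 := by rw [← (hr y).star_apply l m, ylm]; simp
    have ymk : r y m k = 1 / 3 := by rw [← (hr y).star_apply k m, ykm]; simp
    have hsupp3 : ∀ i j, r x i j ≠ 0 → (i = k ∨ i = l ∨ i = m) ∧ (j = k ∨ j = l ∨ j = m) := by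
      intro i j hij
      have hij' := hrow x i j hij
      constructor
      · by_contra! h; exact hij'.1 (x0 i h.1 h.2.1 h.2.2)
      · by_contra! h; exact hij'.2 (x0 j h.1 h.2.1 h.2.2)
    have hswap : ∀ {i j : Fin D}, Approx (u : Filter ι) θ (fun n => R x n i j) (1 / 3) →
        Approx (u : Filter ι) θ (fun n => R x n j i) (1 / 3) := fun h =>
      (approx_apply_swap hR h).congr (fun _ => rfl) (by simp)
    have hknown : ∀ i j, Approx (u : Filter ι) θ (fun n => R x n i j) (r x i j) := by
      intro i j
      by_cases h : r x i j = 0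
      · rw [h]; exact hz x i j h
      obtain ⟨rfl | rfl | rfl, rfl | rfl | rfl⟩ := hsupp3 i j h
      · exact hdd x _
      · rw [xkl]; exact hxkl
      · rw [xkm]; exact hxkm
      · rw [xlk]; exact hswap hxkl
      · exact hdd x _
      · rw [xlm]; exact hxlm
      · rw [xmk]; exact hswap hxkm
      · rw [xml]; exact hswap hxlm
      · exact hdd x _
    have h1 := approx_overlap hR hov' hknown y
    have h2 := ((((hdd y k).add (hdd y l)).add (hdd y m)).add
      ((hykl.add (approx_apply_swap hR hykl)).add ((hylm.add (approx_apply_swap hR hylm)).add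
      (hykm.add (approx_apply_swap hR hykm))))).const_mul (1 / 3)
    have h3 := h1.unique (h2.congr (fun n => by
      rw [trace_mul_of_triple hne₁ hne₂ hne₃ hsupp3, xk, xl, xm, xkl, xlk, xlm, xml, xkm, xmk]
      ring) rfl) hθ
    rw [trace_mul_of_triple hne₁ hne₂ hne₃ hsupp3, xk, xl, xm, xkl, xlk, xlm, xml, xkm, xmk,
      yk, yl, ym, ykl, ylk, ylm, yml, ykm, ymk, ha'] at h3
    have h4 : star (-1 / 3 : ℂ) = -1 / 3 := by simp
    rw [h4] at h3
    have h5 := congrArg Complex.re h3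
    norm_num at h5
  have hstep : ∀ k l m : Fin D, (l : ℕ) = k + 1 → (m : ℕ) = k + 2 →
      ((∀ y, Approx (u : Filter ι) θ (fun n => R y n k l) (r y k l)) →
        ∀ y, Approx (u : Filter ι) θ (fun n => R y n l m) (r y l m)) ∧
      ((∀ y, Approx (u : Filter ι) θ (fun n => R y n k l) (r y l k)) →
        ∀ y, Approx (u : Filter ι) θ (fun n => R y n l m) (r y m l)) := by
    intro k l m hkl hkm
    obtain ⟨x, hx⟩ := htriple k l m hkl hkm
    obtain ⟨y, hy⟩ := htripleI k l m hkl hkm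
    have xlk : r x l k = 1 / 3 := by rw [← (hr x).star_apply k l, hx.2.2.2.1]; simp
    have xml : r x m l = 1 / 3 := by rw [← (hr x).star_apply l m, hx.2.2.2.2.1]; simp
    have ylk : r y l k = -Complex.I / 3 := by rw [← (hr y).star_apply k l, hy.2.2.2.1]; simp
    have yml : r y m l = Complex.I / 3 := by rw [← (hr y).star_apply l m, hy.2.2.2.2.1]; simp
    have hlm : (m : ℕ) = l + 1 := by omega
    constructor
    · intro h
      refine (hadj l m hlm).resolve_right fun h' => ?_
      refine hclash k l m hkl hkm x y hx hy (hx.2.2.2.1 ▸ h x) (xml ▸ h' x) (Complex.I / 3) ?_ ?_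
        (hy.2.2.2.1 ▸ h y) (yml ▸ h' y)
      · linear_combination (1 / 9) * Complex.I_mul_I
      · simp; ring
    · intro h
      refine (hadj l m hlm).resolve_left fun h' => ?_
      refine hclash k l m hkl hkm x y hx hy (xlk ▸ h x) (hx.2.2.2.2.1 ▸ h' x) (-Complex.I / 3) ?_ ?_
        (ylk ▸ h y) (hy.2.2.2.2.1 ▸ h' y)
      · linear_combination (1 / 9) * Complex.I_mul_I
      · simp; ring
  have hglobal :
      (∀ k l : Fin D, (l : ℕ) = k + 1 →
        ∀ y, Approx (u : Filter ι) θ (fun n => R y n k l) (r y k l)) ∨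
      (∀ k l : Fin D, (l : ℕ) = k + 1 →
        ∀ y, Approx (u : Filter ι) θ (fun n => R y n k l) (r y l k)) := by
    by_cases hD : 1 < D
    · have h01 := hadj ⟨0, by omega⟩ ⟨1, hD⟩ rfl
      refine h01.imp (fun h => ?_) fun h => ?_
      all_goals
        intro k l hkl
        obtain ⟨k, hk⟩ := k
        obtain ⟨l, hl⟩ := l
        change l = k + 1 at hkl
        subst hkl
        induction k with
        | zero => exact h
        | succ k ih =>
          first
          | exact (hstep ⟨k, by omega⟩ ⟨k + 1, hk⟩ ⟨k + 1 + 1, hl⟩ rfl rfl).1 (ih (by omega) hk)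
          | exact (hstep ⟨k, by omega⟩ ⟨k + 1, hk⟩ ⟨k + 1 + 1, hl⟩ rfl rfl).2 (ih (by omega) hk)
    · left
      intro k l hkl
      omega
  refine hglobal.imp (fun h x hx => ?_) fun h x hx => ?_
  · exact approx_of_superdiagonal hθ (hR x) (hr x) (hdd x) hx fun j k hjk => h j k hjk x
  · exact approx_of_superdiagonal hθ (hR x) (hr x).transpose (hdd x) hx
      fun j k hjk => h j k hjk x

end Rigidity

/-! ### Adapted bases -/

section Bases

variable {D : ℕ}

/-- The unitary matrix whose columns are the vectors of an orthonormal basis. -/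
noncomputable def basisMatrix (e : OrthonormalBasis (Fin D) ℂ (EuclideanSpace ℂ (Fin D))) :
    Matrix (Fin D) (Fin D) ℂ :=
  Matrix.of fun a k => e k a

theorem basisMatrix_mem (e : OrthonormalBasis (Fin D) ℂ (EuclideanSpace ℂ (Fin D))) :
    basisMatrix e ∈ Matrix.unitaryGroup (Fin D) ℂ := by
  rw [Matrix.mem_unitaryGroup_iff']
  ext j k
  have h := OrthonormalBasis.inner_eq_ite e j k
  rw [PiLp.inner_apply] at h
  rw [Matrix.one_apply, ← h, Matrix.mul_apply]
  refine Finset.sum_congr rfl fun a _ => ?_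
  simp [basisMatrix, Matrix.star_apply, mul_comm]

theorem basisMatrix_conj_ketbra (e : OrthonormalBasis (Fin D) ℂ (EuclideanSpace ℂ (Fin D)))
    (v : EuclideanSpace ℂ (Fin D)) (j k : Fin D) :
    ((basisMatrix e)ᴴ * ketbra v * basisMatrix e) j k =
      inner ℂ (e j) v * star (inner ℂ (e k) v) := by
  have h : ∀ i, inner ℂ (e i) v = ((basisMatrix e)ᴴ *ᵥ v.ofLp) i := by
    intro i
    rw [PiLp.inner_apply]
    simp only [Matrix.mulVec, dotProduct]
    refine Finset.sum_congr rfl fun a _ => ?_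
    simp [basisMatrix, mul_comm]
  unfold ketbra
  rw [Matrix.mul_vecMulVec, Matrix.vecMulVec_mul, Matrix.vecMulVec_apply, h, h]
  congr 1
  change ((star v.ofLp) ᵥ* basisMatrix e) k = (star ((basisMatrix e)ᴴ *ᵥ v.ofLp)) k
  rw [Matrix.star_mulVec, Matrix.conjTranspose_conjTranspose]

theorem trace_unitary_conj {F : Matrix (Fin D) (Fin D) ℂ} (hF : F ∈ Matrix.unitaryGroup (Fin D) ℂ)
    (A : Matrix (Fin D) (Fin D) ℂ) : (Fᴴ * A * F).trace = A.trace := by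
  have h : F * Fᴴ = 1 := Matrix.mem_unitaryGroup_iff.mp hF
  rw [Matrix.trace_mul_comm, ← Matrix.mul_assoc, h, Matrix.one_mul]

theorem unitary_conj_mul {F : Matrix (Fin D) (Fin D) ℂ} (hF : F ∈ Matrix.unitaryGroup (Fin D) ℂ)
    (A C : Matrix (Fin D) (Fin D) ℂ) : (Fᴴ * A * F) * (Fᴴ * C * F) = Fᴴ * (A * C) * F := by
  have h : F * Fᴴ = 1 := Matrix.mem_unitaryGroup_iff.mp hF
  calc (Fᴴ * A * F) * (Fᴴ * C * F) = Fᴴ * A * (F * Fᴴ) * C * F := by noncomm_ring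
    _ = _ := by rw [h]; noncomm_ring

theorem diagonal_mem_unitary {w : Fin D → ℂ} (hw : ∀ k, star (w k) * w k = 1) :
    Matrix.diagonal w ∈ Matrix.unitaryGroup (Fin D) ℂ := by
  rw [Matrix.mem_unitaryGroup_iff', Matrix.star_eq_conjTranspose, Matrix.diagonal_conjTranspose,
    Matrix.diagonal_mul_diagonal, ← Matrix.diagonal_one]
  congr 1
  ext k
  exact hw k

theorem mul_diagonal_conj_apply (F A : Matrix (Fin D) (Fin D) ℂ) (w : Fin D → ℂ) (j k : Fin D) :
    ((F * Matrix.diagonal w)ᴴ * A * (F * Matrix.diagonal w)) j k =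
      star (w j) * (Fᴴ * A * F) j k * w k := by
  have : (F * Matrix.diagonal w)ᴴ * A * (F * Matrix.diagonal w) =
      Matrix.diagonal (star w) * (Fᴴ * A * F) * Matrix.diagonal w := by
    rw [Matrix.conjTranspose_mul, Matrix.diagonal_conjTranspose]
    noncomm_ring
  rw [this, Matrix.mul_diagonal, Matrix.diagonal_mul]; rfl

/-- Phases that make prescribed superdiagonal entries non-negative. -/
theorem exists_phases (a : Fin D → Fin D → ℂ) : ∃ w : Fin D → ℂ, (∀ k, star (w k) * w k = 1) ∧
    ∀ k l : Fin D, (l : ℕ) = k + 1 → 0 ≤ star (w k) * a k l * w l := by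
  have phase : ∀ z : ℂ, ∃ c : ℂ, star c * c = 1 ∧ 0 ≤ z * c := by
    intro z
    by_cases hz : z = 0
    · exact ⟨1, by simp, by simp [hz]⟩
    have hn : (‖z‖ : ℂ) ≠ 0 := by exact_mod_cast norm_ne_zero_iff.mpr hz
    have hzz : z * star z = (‖z‖ : ℂ) * ‖z‖ := by
      rw [Complex.star_def, Complex.mul_conj, Complex.normSq_eq_norm_sq]; push_cast; ring
    refine ⟨star z / ‖z‖, ?_, ?_⟩
    · rw [star_div₀, star_star]
      have : star (‖z‖ : ℂ) = ‖z‖ := Complex.conj_ofReal _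
      rw [this, div_mul_div_comm, hzz, div_self (mul_ne_zero hn hn)]
    · rw [← mul_div_assoc, hzz, mul_div_assoc, div_self hn, mul_one]
      exact_mod_cast norm_nonneg z
  choose c hc1 hc2 using phase
  let b : ℕ → ℂ := fun k => if h : k + 1 < D then a ⟨k, by omega⟩ ⟨k + 1, h⟩ else 0
  let w : ℕ → ℂ := fun k => Nat.rec 1 (fun k wk => c (star wk * b k)) k
  refine ⟨fun k => w k, fun k => ?_, fun k l hkl => ?_⟩
  · obtain ⟨k, hk⟩ := k
    cases k with
    | zero => simp [w]
    | succ k => exact hc1 _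
  · obtain ⟨k, hk⟩ := k
    obtain ⟨l, hl⟩ := l
    change l = k + 1 at hkl
    subst hkl
    have hb : b k = a ⟨k, hk⟩ ⟨k + 1, hl⟩ := by simp [b, hl]
    have := hc2 (star (w k) * b k)
    rw [hb] at this
    change 0 ≤ star (w k) * a ⟨k, hk⟩ ⟨k + 1, hl⟩ * c (star (w k) * b k)
    rwa [hb]

/-- Nearly orthonormal vectors are close to an orthonormal basis. -/
theorem exists_orthonormalBasis_near {ι : Type*} {l : Filter ι} {η : ι → ℝ}
    (hη : Tendsto η l (𝓝 0)) (g : ι → Fin D → EuclideanSpace ℂ (Fin D))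
    (hg : ∀ n k, ‖g n k‖ = 1)
    (hgg : ∀ j k, j ≠ k → (fun n => inner ℂ (g n j) (g n k)) =O[l] η) :
    ∃ f : ι → OrthonormalBasis (Fin D) ℂ (EuclideanSpace ℂ (Fin D)),
      ∀ k, (fun n => f n k - g n k) =O[l] η := by
  let s : ι → Fin D → EuclideanSpace ℂ (Fin D) := fun n => InnerProductSpace.gramSchmidt ℂ (g n)
  have hnormdiff : ∀ k, (fun n => s n k - g n k) =O[l] η → (fun n => ‖s n k‖ - 1) =O[l] η := by
    intro k h
    refine IsBigO.trans (IsBigO.of_bound 1 (Eventually.of_forall fun n => ?_)) h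
    rw [one_mul, ← hg n k]
    exact abs_norm_sub_norm_le _ _
  have htend : ∀ k, (fun n => s n k - g n k) =O[l] η → Tendsto (fun n => ‖s n k‖) l (𝓝 1) :=
    fun k h => tendsto_sub_nhds_zero_iff.mp ((hnormdiff k h).trans_tendsto hη)
  have hs : ∀ k, (fun n => s n k - g n k) =O[l] η := by
    intro k
    induction k using WellFoundedLT.induction with
    | ind k ih =>
      have hdef : ∀ n, s n k - g n k = -∑ i ∈ Finset.Iio k,
          (inner ℂ (s n i) (g n k) / (‖s n i‖ : ℂ) ^ 2) • s n i := by
        intro n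
        have := InnerProductSpace.gramSchmidt_def'' ℂ (g n) k
        change g n k = s n k + _ at this
        nth_rewrite 1 [this]
        simp [s]
      have hterm : ∀ i ∈ Finset.Iio k, Approx l η
          (fun n => (inner ℂ (s n i) (g n k) / (‖s n i‖ : ℂ) ^ 2) • s n i) 0 := by
        intro i hi
        have hik := Finset.mem_Iio.mp hi
        have h1 : (fun n => inner ℂ (s n i) (g n k)) =O[l] η := by
          have h2 : (fun n => inner ℂ (s n i - g n i) (g n k)) =O[l] η := by
            refine IsBigO.trans (IsBigO.of_bound 1 (Eventually.of_forall fun n => ?_)) (ih i hik)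
            refine (norm_inner_le_norm _ _).trans ?_
            rw [hg, mul_one, one_mul]
          refine (h2.add (hgg i k hik.ne)).congr_left fun n => ?_
          rw [inner_sub_left, sub_add_cancel]
        have h3 := htend i (ih i hik)
        have h4 : (fun n => ((‖s n i‖ ^ 2)⁻¹ * ‖s n i‖ : ℝ)) =O[l] (fun _ => (1 : ℝ)) :=
          (((h3.pow 2).inv₀ (by norm_num)).mul h3).isBigO_one ℝ
        have h5 : (fun n => ‖inner ℂ (s n i) (g n k)‖ * ((‖s n i‖ ^ 2)⁻¹ * ‖s n i‖)) =O[l]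
            fun n => η n * 1 := h1.norm_left.mul h4
        simp only [mul_one] at h5
        have h6 : (fun n => (inner ℂ (s n i) (g n k) / (‖s n i‖ : ℂ) ^ 2) • s n i - 0) =O[l]
            fun n => ‖inner ℂ (s n i) (g n k)‖ * ((‖s n i‖ ^ 2)⁻¹ * ‖s n i‖) := by
          refine IsBigO.of_bound 1 (Eventually.of_forall fun n => le_of_eq ?_)
          rw [sub_zero, norm_smul, norm_div]
          simp [div_eq_mul_inv]
          ring
        exact h6.trans h5
      have hsum := (Approx.sum _ hterm).neg
      refine IsBigO.congr_left hsum fun n => ?_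
      rw [hdef n]; simp
  have hcard : Module.finrank ℂ (EuclideanSpace ℂ (Fin D)) = Fintype.card (Fin D) := by simp
  refine ⟨fun n => InnerProductSpace.gramSchmidtOrthonormalBasis hcard (g n), fun k => ?_⟩
  have h1 := htend k (hs k)
  have hpos : ∀ᶠ n in l, s n k ≠ 0 := by
    filter_upwards [h1.eventually_ne one_ne_zero] with n hn h0
    exact hn (by rw [h0, norm_zero])
  have hinv : (fun n => (‖s n k‖ : ℝ)⁻¹) =O[l] (fun _ => (1 : ℝ)) :=
    (h1.inv₀ one_ne_zero).isBigO_one ℝ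
  -- the normalised vector differs from the unnormalised one by `|1 - ‖s‖|`
  have h2 : (fun n => InnerProductSpace.gramSchmidtOrthonormalBasis hcard (g n) k - s n k)
      =O[l] fun n => ‖s n k‖ - 1 := by
    refine IsBigO.of_bound 1 ?_
    filter_upwards [hpos] with n hn
    have hn' : ‖s n k‖ ≠ 0 := norm_ne_zero_iff.mpr hn
    have hnormed : InnerProductSpace.gramSchmidtNormed ℂ (g n) k = (‖s n k‖ : ℂ)⁻¹ • s n k := rfl
    rw [InnerProductSpace.gramSchmidtOrthonormalBasis_apply hcard, hnormed]
    · have : (‖s n k‖ : ℂ)⁻¹ • s n k - s n k = ((((‖s n k‖)⁻¹ - 1 : ℝ)) : ℂ) • s n k := by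
        push_cast; rw [sub_smul, one_smul]
      rw [this, norm_smul, Complex.norm_real, one_mul]
      nth_rewrite 2 [← Real.norm_of_nonneg (norm_nonneg (s n k))]
      rw [← norm_mul, sub_mul, inv_mul_cancel₀ hn', one_mul, ← norm_neg, neg_sub]
    · rw [hnormed]
      exact smul_ne_zero (inv_ne_zero (by exact_mod_cast hn')) hn
  exact ((h2.trans (hnormdiff k (hs k))).add (hs k)).congr_left fun n => by abel

theorem exists_unitary_conj_eq {P : Matrix (Fin 2) (Fin 2) ℂ} (hP : IsPureState P) :
    ∃ F ∈ Matrix.unitaryGroup (Fin 2) ℂ, Fᴴ * P * F = !![1, 0; 0, 0] := by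
  obtain ⟨v, hv, rfl⟩ := hP
  have hn : star (v 0) * v 0 + star (v 1) * v 1 = 1 := by
    have h := EuclideanSpace.norm_sq_eq v
    rw [hv, Fin.sum_univ_two, ← Complex.normSq_eq_norm_sq, ← Complex.normSq_eq_norm_sq] at h
    rw [Complex.star_def, mul_comm, Complex.mul_conj, mul_comm, Complex.mul_conj]
    rw [← Complex.ofReal_add, ← h]; norm_num
  have h1 : (starRingEnd ℂ (v 0)) * v 0 + starRingEnd ℂ (v 1) * v 1 = 1 := hn
  refine ⟨!![v 0, -star (v 1); v 1, star (v 0)], ?_, ?_⟩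
  · rw [Matrix.mem_unitaryGroup_iff']
    ext i j
    fin_cases i <;> fin_cases j <;>
      simp [Matrix.mul_apply, Fin.sum_univ_two, Matrix.star_apply]
    · exact h1
    · ring
    · ring
    · linear_combination h1
  · ext i j
    fin_cases i <;> fin_cases j <;>
      simp [Matrix.mul_apply, Fin.sum_univ_two, ketbra_apply]
    · linear_combination (starRingEnd ℂ (v 0) * v 0 + starRingEnd ℂ (v 1) * v 1 + 1) * h1
    · ring
    · ring
    · ring

end Bases

/-! ### States determined up to a unitary or anti-unitary -/

section Adapted

variable {X ι : Type*} {u : Ultrafilter ι} {θ : ι → ℝ}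

theorem approx_trace_unitary_conj {D : ℕ} {P : X → ι → Matrix (Fin D) (Fin D) ℂ}
    {φ : X → Matrix (Fin D) (Fin D) ℂ} {l : Filter ι} {η : ι → ℝ}
    (hov : ∀ x y, Approx l η (fun n => (P x n * P y n).trace) (φ x * φ y).trace)
    {E : Matrix (Fin D) (Fin D) ℂ} {F : ι → Matrix (Fin D) (Fin D) ℂ}
    (hE : E ∈ Matrix.unitaryGroup (Fin D) ℂ) (hF : ∀ n, F n ∈ Matrix.unitaryGroup (Fin D) ℂ)
    (x y : X) : Approx l η (fun n => (((F n)ᴴ * P x n * F n) * ((F n)ᴴ * P y n * F n)).trace)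
      ((Eᴴ * φ x * E) * (Eᴴ * φ y * E)).trace :=
  (hov x y).congr (fun n => by rw [unitary_conj_mul (hF n), trace_unitary_conj (hF n)])
    (by rw [unitary_conj_mul hE, trace_unitary_conj hE])

theorem exists_adapted_bases_qubit {P : X → ι → Matrix (Fin 2) (Fin 2) ℂ}
    {φ : X → Matrix (Fin 2) (Fin 2) ℂ} (hθ : Tendsto θ u (𝓝 0))
    (hP : ∀ x n, IsPureState (P x n)) (hφ : ∀ x, IsPureState (φ x))
    (hov : ∀ x y, Approx (u : Filter ι) (fun n => θ n ^ 2) (fun n => (P x n * P y n).trace)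
      (φ x * φ y).trace) :
    ∃ E ∈ Matrix.unitaryGroup (Fin 2) ℂ, ∃ F : ι → Matrix (Fin 2) (Fin 2) ℂ,
      (∀ n, F n ∈ Matrix.unitaryGroup (Fin 2) ℂ) ∧
      ((∀ x j k, Approx (u : Filter ι) θ (fun n => ((F n)ᴴ * P x n * F n) j k)
        ((Eᴴ * φ x * E) j k)) ∨
      (∀ x j k, Approx (u : Filter ι) θ (fun n => ((F n)ᴴ * P x n * F n) j k)
        ((Eᴴ * φ x * E) k j))) := by
  rcases isEmpty_or_nonempty X with hX | ⟨⟨x₀⟩⟩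
  · exact ⟨1, one_mem _, fun _ => 1, fun _ => one_mem _, Or.inl fun x => hX.elim x⟩
  obtain ⟨E, hE, hE₀⟩ := exists_unitary_conj_eq (hφ x₀)
  choose F hF hF₀ using fun n => exists_unitary_conj_eq (hP x₀ n)
  have h00 : ∀ A : Matrix (Fin 2) (Fin 2) ℂ, (!![1, 0; 0, 0] * A).trace = A 0 0 := fun A => by
    rw [Matrix.trace_fin_two, Matrix.mul_apply, Matrix.mul_apply, Fin.sum_univ_two,
      Fin.sum_univ_two]
    simp
  -- the diagonal is given by the overlaps with the state `x₀`
  have hov' := approx_trace_unitary_conj hov hE hF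
  have hd0 : ∀ x, Approx (u : Filter ι) (fun n => θ n ^ 2) (fun n => ((F n)ᴴ * P x n * F n) 0 0)
      ((Eᴴ * φ x * E) 0 0) := by
    intro x
    refine (hov' x₀ x).congr (fun n => ?_) ?_
    · rw [hF₀, h00]
    · rw [hE₀, h00]
  have hone : ∀ {Q : Matrix (Fin 2) (Fin 2) ℂ}, IsPureState Q → 1 - Q 0 0 = Q 1 1 := by
    intro Q hQ
    have := hQ.isState.2
    rw [Matrix.trace_fin_two] at this
    rw [← this]; ring
  have hd : ∀ x k, Approx (u : Filter ι) (fun n => θ n ^ 2)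
      (fun n => ((F n)ᴴ * P x n * F n) k k) ((Eᴴ * φ x * E) k k) := by
    intro x k
    fin_cases k
    · exact hd0 x
    · exact ((Approx.const 1).sub (hd0 x)).congr
        (fun n => hone ((hP x n).conj_unitary (hF n))) (hone ((hφ x).conj_unitary hE))
  by_cases hoff : ∀ x, (Eᴴ * φ x * E) 0 1 = 0
  · refine ⟨E, hE, F, hF, ?_⟩
    exact qubit_rigidity hθ (fun x n => (hP x n).conj_unitary (hF n))
      (fun x => (hφ x).conj_unitary hE) hov' hd (Or.inl hoff)
  push Not at hoff
  obtain ⟨x₁, hx₁⟩ := hoff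
  obtain ⟨w, hw, hw'⟩ := exists_phases (D := 2) (Eᴴ * φ x₁ * E)
  choose c hc hc' using fun n => exists_phases (D := 2) ((F n)ᴴ * P x₁ n * F n)
  have hE' : E * diagonal w ∈ Matrix.unitaryGroup (Fin 2) ℂ := mul_mem hE (diagonal_mem_unitary hw)
  have hF' : ∀ n, F n * diagonal (c n) ∈ Matrix.unitaryGroup (Fin 2) ℂ :=
    fun n => mul_mem (hF n) (diagonal_mem_unitary (hc n))
  have hdiagw : ∀ (w : Fin 2 → ℂ) (hw : ∀ k, star (w k) * w k = 1) (z : ℂ) (k : Fin 2),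
      z = star (w k) * z * w k := fun w hw z k => by
    linear_combination (-z) * hw k
  refine ⟨E * diagonal w, hE', fun n => F n * diagonal (c n), hF', ?_⟩
  refine qubit_rigidity hθ (fun x n => (hP x n).conj_unitary (hF' n))
      (fun x => (hφ x).conj_unitary hE') (approx_trace_unitary_conj hov hE' hF')
      (fun x k => (hd x k).congr (fun n => ?_) ?_) (Or.inr ⟨x₁, ?_, fun n => ?_⟩)
  · rw [mul_diagonal_conj_apply]; exact hdiagw _ (hc n) _ k
  · rw [mul_diagonal_conj_apply]; exact hdiagw _ hw _ k
  · rw [mul_diagonal_conj_apply]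
    refine lt_of_le_of_ne (hw' 0 1 rfl) fun h => ?_
    have h0 : ∀ k, w k ≠ 0 := fun k hk => by have := hw k; simp [hk] at this
    exact mul_ne_zero (mul_ne_zero (star_ne_zero.mpr (h0 0)) hx₁) (h0 1) h.symm
  · rw [mul_diagonal_conj_apply]
    exact hc' n 0 1 rfl

theorem norm_sq_inner_isBigO {D : ℕ} {l : Filter ι} {η : ι → ℝ}
    {f g v : ι → EuclideanSpace ℂ (Fin D)} (hf : ∀ n, ‖f n‖ = 1) (hg : ∀ n, ‖g n‖ = 1)
    (hv : ∀ n, ‖v n‖ = 1) (h : (fun n => f n - g n) =O[l] η) :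
    (fun n => ‖inner ℂ (f n) (v n)‖ ^ 2 - ‖inner ℂ (g n) (v n)‖ ^ 2) =O[l] η := by
  refine IsBigO.trans (IsBigO.of_bound 2 (Eventually.of_forall fun n => ?_)) h
  have h1 : ‖inner ℂ (f n) (v n)‖ ≤ 1 :=
    (norm_inner_le_norm _ _).trans (by rw [hf, hv, mul_one])
  have h2 : ‖inner ℂ (g n) (v n)‖ ≤ 1 :=
    (norm_inner_le_norm _ _).trans (by rw [hg, hv, mul_one])
  have h3 : |‖inner ℂ (f n) (v n)‖ - ‖inner ℂ (g n) (v n)‖| ≤ ‖f n - g n‖ := by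
    refine (abs_norm_sub_norm_le _ _).trans ?_
    rw [← inner_sub_left]
    exact (norm_inner_le_norm _ _).trans (by rw [hv, mul_one])
  rw [sq_sub_sq, norm_mul, Real.norm_of_nonneg (by positivity)]
  exact mul_le_mul (by linarith) h3 (abs_nonneg _) zero_le_two

theorem exists_adapted_bases_fiducial {D : ℕ} {P : X → ι → Matrix (Fin D) (Fin D) ℂ}
    {φ : X → Matrix (Fin D) (Fin D) ℂ} (hθ : Tendsto θ u (𝓝 0))
    (hP : ∀ x n, IsPureState (P x n)) (hφ : ∀ x, IsPureState (φ x))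
    (hov : ∀ x y, Approx (u : Filter ι) (fun n => θ n ^ 4) (fun n => (P x n * P y n).trace)
      (φ x * φ y).trace)
    (e : OrthonormalBasis (Fin D) ℂ (EuclideanSpace ℂ (Fin D)))
    (he : fiducialStates e ⊆ Set.range φ) :
    ∃ F : ι → Matrix (Fin D) (Fin D) ℂ,
      (∀ n, F n ∈ Matrix.unitaryGroup (Fin D) ℂ) ∧
      ((∀ x, (∀ k, ((basisMatrix e)ᴴ * φ x * basisMatrix e) k k ≠ 0) →
        ∀ j k, Approx (u : Filter ι) θ (fun n => ((F n)ᴴ * P x n * F n) j k)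
          (((basisMatrix e)ᴴ * φ x * basisMatrix e) j k)) ∨
      (∀ x, (∀ k, ((basisMatrix e)ᴴ * φ x * basisMatrix e) k k ≠ 0) →
        ∀ j k, Approx (u : Filter ι) θ (fun n => ((F n)ᴴ * P x n * F n) j k)
          (((basisMatrix e)ᴴ * φ x * basisMatrix e) k j))) := by
  have hη : Tendsto (fun n => θ n ^ 2) u (𝓝 0) := by simpa using hθ.pow 2
  have h42 : (fun n => θ n ^ 4) =O[(u : Filter ι)] (fun n => θ n ^ 2) :=
    (isBigO_sq_of_tendsto hη).congr_left fun n => by ring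
  have hov2 := fun x y => (hov x y).mono h42
  have hE := basisMatrix_mem e
  choose v hv hPv using hP
  have hentry : ∀ (x : X) (p : EuclideanSpace ℂ (Fin D)), φ x = ketbra p → ∀ j k,
      ((basisMatrix e)ᴴ * φ x * basisMatrix e) j k = inner ℂ (e j) p * star (inner ℂ (e k) p) :=
    fun x p hx j k => by rw [hx, basisMatrix_conj_ketbra]
  have hite : ∀ i j, inner ℂ (e i) (e j) = if i = j then (1 : ℂ) else 0 :=
    fun i j => OrthonormalBasis.inner_eq_ite e i j
  -- the realized basis states are nearly orthogonal
  choose a ha using fun k => he (Or.inl ⟨k, rfl⟩ : ketbra (e k) ∈ fiducialStates e)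
  have hnear : ∀ j k, j ≠ k →
      (fun n => inner ℂ (v (a j) n) (v (a k) n)) =O[(u : Filter ι)] fun n => θ n ^ 2 := by
    intro j k hjk
    have h1 := (hov (a j) (a k)).re
    have h0 : (φ (a j) * φ (a k)).trace.re = 0 := by
      rw [ha, ha, trace_ketbra_mul_ketbra, hite, if_neg hjk]; simp
    have h2 : (fun n => ‖inner ℂ (v (a j) n) (v (a k) n)‖ ^ 2) =O[(u : Filter ι)]
        fun n => (θ n ^ 2) ^ 2 := by
      refine IsBigO.congr h1 (fun n => ?_) fun n => by ring
      change (P (a j) n * P (a k) n).trace.re - (φ (a j) * φ (a k)).trace.re = _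
      rw [h0, hPv, hPv, trace_ketbra_mul_ketbra, Complex.ofReal_re, sub_zero]
    exact (IsBigO.of_pow (f := fun n => ‖inner ℂ (v (a j) n) (v (a k) n)‖)
      (g := fun n => θ n ^ 2) two_ne_zero h2).of_norm_left
  obtain ⟨f, hf⟩ := exists_orthonormalBasis_near hη (fun n k => v (a k) n)
    (fun n k => hv _ _) hnear
  have hd : ∀ x k, Approx (u : Filter ι) (fun n => θ n ^ 2)
      (fun n => ((basisMatrix (f n))ᴴ * P x n * basisMatrix (f n)) k k)
      (((basisMatrix e)ᴴ * φ x * basisMatrix e) k k) := by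
    intro x k
    obtain ⟨p, hp, hxp⟩ := hφ x
    have h1 : Approx (u : Filter ι) (fun n => θ n ^ 2)
        (fun n => ‖inner ℂ (v (a k) n) (v x n)‖ ^ 2) (‖inner ℂ (e k) p‖ ^ 2) := by
      refine (hov2 (a k) x).re.congr (fun n => ?_) ?_
      · rw [hPv, hPv, trace_ketbra_mul_ketbra, Complex.ofReal_re]
      · rw [ha, hxp, trace_ketbra_mul_ketbra, Complex.ofReal_re]
    have h2 := norm_sq_inner_isBigO (fun n => (f n).orthonormal.1 k) (fun n => hv (a k) n)
      (fun n => hv x n) (hf k)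
    have h3 : Approx (u : Filter ι) (fun n => θ n ^ 2)
        (fun n => ‖inner ℂ (f n k) (v x n)‖ ^ 2) (‖inner ℂ (e k) p‖ ^ 2) :=
      (IsBigO.add h2 h1).congr_left fun n => by ring
    refine h3.ofReal.congr (fun n => ?_) ?_
    · rw [hPv, basisMatrix_conj_ketbra, Complex.star_def, Complex.mul_conj,
        Complex.normSq_eq_norm_sq]
    · rw [hentry x p hxp, Complex.star_def, Complex.mul_conj, Complex.normSq_eq_norm_sq]
  -- the phases of the basis are fixed by the states `(e_k + e_{k+1})/√2`
  have hpair : ∀ k l : Fin D, ∃ x, (l : ℕ) = k + 1 →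
      φ x = ketbra (((1 / √2 : ℝ) : ℂ) • (e k + e l)) := by
    intro k l
    by_cases h : (l : ℕ) = k + 1
    · obtain ⟨x, hx⟩ := he (Or.inr (Or.inl ⟨k, l, h, Or.inl rfl⟩) :
        ketbra (((1 / √2 : ℝ) : ℂ) • (e k + e l)) ∈ fiducialStates e)
      exact ⟨x, fun _ => hx⟩
    · exact ⟨a k, fun h' => absurd h' h⟩
  choose b hb using hpair
  choose c hc hc' using fun n => exists_phases (D := D)
    (fun k l => ((basisMatrix (f n))ᴴ * P (b k l) n * basisMatrix (f n)) k l)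
  have hF : ∀ n, basisMatrix (f n) * diagonal (c n) ∈ Matrix.unitaryGroup (Fin D) ℂ :=
    fun n => mul_mem (basisMatrix_mem _) (diagonal_mem_unitary (hc n))
  have hs2 : ((1 / √2 : ℝ) : ℂ) * ((1 / √2 : ℝ) : ℂ) = 1 / 2 := by
    rw [← Complex.ofReal_mul, div_mul_div_comm, Real.mul_self_sqrt (by norm_num)]; norm_num
  have hs3 : ((1 / √3 : ℝ) : ℂ) * ((1 / √3 : ℝ) : ℂ) = 1 / 3 := by
    rw [← Complex.ofReal_mul, div_mul_div_comm, Real.mul_self_sqrt (by norm_num)]; norm_num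
  have hc2 : star ((1 / √2 : ℝ) : ℂ) = ((1 / √2 : ℝ) : ℂ) := Complex.conj_ofReal _
  have hc3 : star ((1 / √3 : ℝ) : ℂ) = ((1 / √3 : ℝ) : ℂ) := Complex.conj_ofReal _
  have hcI : star Complex.I = -Complex.I := Complex.conj_I
  have hP' : ∀ x n, IsPureState (P x n) := fun x n => ⟨v x n, hv x n, hPv x n⟩
  refine ⟨fun n => basisMatrix (f n) * diagonal (c n), hF, ?_⟩
  refine fiducial_rigidity hθ (fun x n => (hP' x n).conj_unitary (hF n))
    (fun x => (hφ x).conj_unitary hE) (approx_trace_unitary_conj hov2 hE hF)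
    (fun x k => (hd x k).congr (fun n => ?_) rfl) ?_ ?_ ?_ ?_
  · rw [mul_diagonal_conj_apply]
    linear_combination (-((basisMatrix (f n))ᴴ * P x n * basisMatrix (f n)) k k) * hc n k
  · intro k l hkl
    have hne : k ≠ l := fun h => by rw [h] at hkl; omega
    have h := hentry _ _ (hb k l hkl)
    refine ⟨b k l, ?_, ?_, ?_, fun j hjk hjl => ?_, fun n => ?_⟩
    · rw [h]; simp only [inner_smul_right, inner_add_right, hite, if_neg hne, if_true,
        star_mul', hc2]
      simp only [star_add, star_one, star_zero]; linear_combination hs2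
    · rw [h]; simp only [inner_smul_right, inner_add_right, hite, if_neg hne.symm, if_true,
        star_mul', hc2]
      simp only [star_add, star_one, star_zero]; linear_combination hs2
    · rw [h]; simp only [inner_smul_right, inner_add_right, hite, if_neg hne, if_neg hne.symm, if_true,
        star_mul', hc2]
      simp only [star_add, star_one, star_zero]; linear_combination hs2
    · rw [h]; simp only [inner_smul_right, inner_add_right, hite, if_neg hjk, if_neg hjl]; simp
    · rw [mul_diagonal_conj_apply]
      exact hc' n k l hkl
  · intro k l hkl
    have hne : k ≠ l := fun h => by rw [h] at hkl; omega
    obtain ⟨x, hx⟩ := he (Or.inr (Or.inl ⟨k, l, hkl, Or.inr rfl⟩) :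
      ketbra (((1 / √2 : ℝ) : ℂ) • (e k + Complex.I • e l)) ∈ fiducialStates e)
    have h := hentry _ _ hx
    refine ⟨x, ?_, ?_, ?_, fun j hjk hjl => ?_⟩
    · rw [h]; simp only [inner_smul_right, inner_add_right, hite, if_neg hne, if_true,
        star_mul', hc2]
      simp only [star_add, star_mul', star_one, star_zero, hcI]; linear_combination hs2
    · rw [h]; simp only [inner_smul_right, inner_add_right, hite, if_neg hne.symm, if_true,
        star_mul', hc2]
      simp only [star_add, star_mul', star_one, star_zero, hcI]
      linear_combination (-Complex.I * Complex.I) * hs2 - (1 / 2) * Complex.I_mul_I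
    · rw [h]; simp only [inner_smul_right, inner_add_right, hite, if_neg hne, if_neg hne.symm, if_true,
        star_mul', hc2]
      simp only [star_add, star_mul', star_one, star_zero, hcI]; linear_combination (-Complex.I) * hs2
    · rw [h]; simp only [inner_smul_right, inner_add_right, hite, if_neg hjk, if_neg hjl]; simp
  · intro k l m hkl hkm
    have hne₁ : k ≠ l := fun h => by rw [h] at hkl; omega
    have hne₂ : k ≠ m := fun h => by rw [h] at hkm; omega
    have hne₃ : l ≠ m := fun h => by rw [h] at hkl; omega
    obtain ⟨x, hx⟩ := he (Or.inr (Or.inr ⟨k, l, m, hkl, hkm, Or.inl rfl⟩) :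
      ketbra (((1 / √3 : ℝ) : ℂ) • (e k + e l + e m)) ∈ fiducialStates e)
    have h := hentry _ _ hx
    have hk : inner ℂ (e k) (((1 / √3 : ℝ) : ℂ) • (e k + e l + e m)) = ((1 / √3 : ℝ) : ℂ) := by
      simp only [inner_smul_right, inner_add_right, hite, if_neg hne₁, if_neg hne₂, if_true]; ring
    have hl : inner ℂ (e l) (((1 / √3 : ℝ) : ℂ) • (e k + e l + e m)) = ((1 / √3 : ℝ) : ℂ) := by
      simp only [inner_smul_right, inner_add_right, hite, if_neg hne₁.symm, if_neg hne₃, if_true]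
      ring
    have hm : inner ℂ (e m) (((1 / √3 : ℝ) : ℂ) • (e k + e l + e m)) = ((1 / √3 : ℝ) : ℂ) := by
      simp only [inner_smul_right, inner_add_right, hite, if_neg hne₂.symm, if_neg hne₃.symm, if_true]
      ring
    refine ⟨x, ?_⟩
    simp only [h, hk, hl, hm, hc3, hs3, true_and]
    intro j h1 h2 h3
    simp only [inner_smul_right, inner_add_right, hite, if_neg h1, if_neg h2, if_neg h3]; simp
  · intro k l m hkl hkm
    have hne₁ : k ≠ l := fun h => by rw [h] at hkl; omega
    have hne₂ : k ≠ m := fun h => by rw [h] at hkm; omega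
    have hne₃ : l ≠ m := fun h => by rw [h] at hkl; omega
    obtain ⟨x, hx⟩ := he (Or.inr (Or.inr ⟨k, l, m, hkl, hkm, Or.inr rfl⟩) :
      ketbra (((1 / √3 : ℝ) : ℂ) • (Complex.I • e k + e l + Complex.I • e m)) ∈ fiducialStates e)
    have h := hentry _ _ hx
    have hk : inner ℂ (e k) (((1 / √3 : ℝ) : ℂ) • (Complex.I • e k + e l + Complex.I • e m)) =
        ((1 / √3 : ℝ) : ℂ) * Complex.I := by
      simp only [inner_smul_right, inner_add_right, hite, if_neg hne₁, if_neg hne₂, if_true]; ring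
    have hl : inner ℂ (e l) (((1 / √3 : ℝ) : ℂ) • (Complex.I • e k + e l + Complex.I • e m)) =
        ((1 / √3 : ℝ) : ℂ) := by
      simp only [inner_smul_right, inner_add_right, hite, if_neg hne₁.symm, if_neg hne₃, if_true]
      ring
    have hm : inner ℂ (e m) (((1 / √3 : ℝ) : ℂ) • (Complex.I • e k + e l + Complex.I • e m)) =
        ((1 / √3 : ℝ) : ℂ) * Complex.I := by
      simp only [inner_smul_right, inner_add_right, hite, if_neg hne₂.symm, if_neg hne₃.symm, if_true]
      ring
    have hII : ∀ z : ℂ, (z * Complex.I) * (z * -Complex.I) = z * z := fun z => by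
      linear_combination (-z * z) * Complex.I_mul_I
    refine ⟨x, ?_, ?_, ?_, ?_, ?_, ?_⟩ <;> rw [h] <;>
      simp only [hk, hl, hm, star_mul', hc3, hcI, hII, hs3]
    · linear_combination Complex.I * hs3
    · linear_combination (-Complex.I) * hs3

/-- A quantitative Wigner theorem for families of pure states. If the overlaps of the states `P x n`
agree with those of reference states up to `O(θ⁴)`, then in suitable orthonormal bases (the columns
of `E` and `F n`) the matrices of the states in `S` agree up to `O(θ)`, after a transposition in the
anti-unitary case. Above dimension two the reference family is required to contain the fiducial
states of a basis in which the states in `S` have no vanishing coordinate. -/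
theorem exists_adapted_bases {D : ℕ} {P : X → ι → Matrix (Fin D) (Fin D) ℂ}
    {φ : X → Matrix (Fin D) (Fin D) ℂ} (hθ : Tendsto θ u (𝓝 0))
    (hP : ∀ x n, IsPureState (P x n)) (hφ : ∀ x, IsPureState (φ x))
    (hov : ∀ x y, Approx (u : Filter ι) (fun n => θ n ^ 4) (fun n => (P x n * P y n).trace)
      (φ x * φ y).trace) (S : Set X)
    (hT : 2 < D → ∃ e : OrthonormalBasis (Fin D) ℂ (EuclideanSpace ℂ (Fin D)),
      fiducialStates e ⊆ Set.range φ ∧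
        ∀ x ∈ S, ∀ k, ((basisMatrix e)ᴴ * φ x * basisMatrix e) k k ≠ 0) :
    ∃ E ∈ Matrix.unitaryGroup (Fin D) ℂ, ∃ F : ι → Matrix (Fin D) (Fin D) ℂ,
      (∀ n, F n ∈ Matrix.unitaryGroup (Fin D) ℂ) ∧
      ((∀ x ∈ S, ∀ j k, Approx (u : Filter ι) θ (fun n => ((F n)ᴴ * P x n * F n) j k)
        ((Eᴴ * φ x * E) j k)) ∨
      (∀ x ∈ S, ∀ j k, Approx (u : Filter ι) θ (fun n => ((F n)ᴴ * P x n * F n) j k)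
        ((Eᴴ * φ x * E) k j))) := by
  rcases lt_trichotomy D 2 with hD | rfl | hD
  · -- in dimension at most one there is a single state
    have hsub : Subsingleton (Fin D) := ⟨fun a b => Fin.ext (by omega)⟩
    have hone : ∀ Q : Matrix (Fin D) (Fin D) ℂ, IsPureState Q → ∀ j k, Q j k = 1 := by
      intro Q hQ j k
      have h := hQ.isState.2
      rw [Matrix.trace, Fintype.sum_subsingleton _ j, Matrix.diag] at h
      rw [Subsingleton.elim k j, h]
    refine ⟨1, one_mem _, fun _ => 1, fun _ => one_mem _, Or.inl fun x _ j k => ?_⟩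
    refine (Approx.const 1).congr (fun n => ?_) ?_
    · exact (hone _ ((hP x n).conj_unitary (one_mem _)) j k).symm
    · exact (hone _ ((hφ x).conj_unitary (one_mem _)) j k).symm
  · have hη : Tendsto (fun n => θ n ^ 2) u (𝓝 0) := by simpa using hθ.pow 2
    have h42 : (fun n => θ n ^ 4) =O[(u : Filter ι)] (fun n => θ n ^ 2) :=
      (isBigO_sq_of_tendsto hη).congr_left fun n => by ring
    obtain ⟨E, hE, F, hF, h⟩ := exists_adapted_bases_qubit hθ hP hφ fun x y => (hov x y).mono h42
    exact ⟨E, hE, F, hF, h.imp (fun h x _ => h x) fun h x _ => h x⟩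
  · obtain ⟨e, he, heS⟩ := hT hD
    obtain ⟨F, hF, h⟩ := exists_adapted_bases_fiducial hθ hP hφ hov e he
    exact ⟨basisMatrix e, basisMatrix_mem e, F, hF,
      h.imp (fun h x hx => h x (heS x hx)) fun h x hx => h x (heS x hx)⟩

end Adapted

/-! ### Stability of extremal POVMs -/

section Extremal

variable {D B : ℕ}

theorem eventually_posSemidef_one_add_smul {Y : Matrix (Fin D) (Fin D) ℂ} (hY : Y.IsHermitian) :
    ∀ᶠ t : ℝ in 𝓝 0, (1 + (t : ℂ) • Y).PosSemidef := by
  open scoped MatrixOrder Matrix.Norms.L2Operator in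
  have hcont : Tendsto (fun t : ℝ => ‖(t : ℂ) • Y‖) (𝓝 0) (𝓝 0) := by
    have : Continuous fun t : ℝ => ‖(t : ℂ) • Y‖ := by fun_prop
    simpa using this.tendsto 0
  filter_upwards [hcont.eventually_le_const zero_lt_one] with t ht
  have hsa : IsSelfAdjoint ((t : ℂ) • Y) := by
    rw [isSelfAdjoint_iff, Matrix.star_eq_conjTranspose, Matrix.conjTranspose_smul, hY.eq]
    simp
  have h1 := hsa.neg_algebraMap_norm_le_self
  have h2 : algebraMap ℝ (Matrix (Fin D) (Fin D) ℂ) ‖(t : ℂ) • Y‖ ≤ 1 := by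
    rw [← map_one (algebraMap ℝ (Matrix (Fin D) (Fin D) ℂ))]
    exact algebraMap_mono _ ht
  have h3 : (0 : Matrix (Fin D) (Fin D) ℂ) ≤ 1 + (t : ℂ) • Y := by
    rw [← neg_le_iff_add_nonneg']
    exact (neg_le_neg h2).trans h1
  exact Matrix.nonneg_iff_posSemidef.mp h3

theorem mul_ketbra_eq_zero {M : Matrix (Fin D) (Fin D) ℂ} {d : ℕ}
    {ψ : Fin d → EuclideanSpace ℂ (Fin D)}
    (hker : Submodule.span ℂ (Set.range ψ) = LinearMap.ker (Matrix.toEuclideanLin M)) (i : Fin d) :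
    M * ketbra (ψ i) = 0 := by
  have h : ψ i ∈ LinearMap.ker (Matrix.toEuclideanLin M) :=
    hker ▸ Submodule.subset_span ⟨i, rfl⟩
  have h' : M *ᵥ (fun j => (ψ i) j) = 0 := congrArg WithLp.ofLp (LinearMap.mem_ker.mp h)
  unfold ketbra
  rw [Matrix.mul_vecMulVec, h']; ext; simp [Matrix.vecMulVec_apply]

/-- A positive semidefinite matrix stays so under small Hermitian perturbations that vanish on
its kernel: with `Z` the projector onto the kernel, the perturbation factors as `M X M`, hence as
`Rᴴ Y R` when `M = Rᴴ R`. -/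
theorem eventually_posSemidef_add_smul {M Δ : Matrix (Fin D) (Fin D) ℂ} (hM : M.PosSemidef)
    {d : ℕ} {ψ : Fin d → EuclideanSpace ℂ (Fin D)} (hψ : Orthonormal ℂ ψ)
    (hker : Submodule.span ℂ (Set.range ψ) = LinearMap.ker (Matrix.toEuclideanLin M))
    (hΔ : Δ.IsHermitian) (hΔψ : ∀ i, Δ * ketbra (ψ i) = 0) :
    ∀ᶠ t : ℝ in 𝓝 0, (M + (t : ℂ) • Δ).PosSemidef := by
  set Z : Matrix (Fin D) (Fin D) ℂ := ∑ i, ketbra (ψ i) with hZ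
  have hZH : Zᴴ = Z := by
    rw [hZ, Matrix.conjTranspose_sum]
    exact Finset.sum_congr rfl fun i _ => (ketbra_posSemidef _).1.eq
  have hZΔ : Δ * Z = 0 := by
    rw [hZ, Matrix.mul_sum]; exact Finset.sum_eq_zero fun i _ => hΔψ i
  have hΔZ : Z * Δ = 0 := by
    have := congrArg Matrix.conjTranspose hZΔ
    rwa [Matrix.conjTranspose_mul, hZH, hΔ.eq, Matrix.conjTranspose_zero] at this
  have hketbra : ∀ (v : EuclideanSpace ℂ (Fin D)) (x : EuclideanSpace ℂ (Fin D)),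
      ketbra v *ᵥ x.ofLp = (inner ℂ v x) • v.ofLp := by
    intro v x
    ext i
    simp only [ketbra, Matrix.mulVec, dotProduct, Matrix.vecMulVec_apply, Pi.smul_apply,
      smul_eq_mul, PiLp.inner_apply, Finset.sum_mul]
    refine Finset.sum_congr rfl fun j _ => ?_
    simp; ring
  have hmemker : ∀ x : EuclideanSpace ℂ (Fin D),
      x ∈ LinearMap.ker (Matrix.toEuclideanLin M) ↔ M *ᵥ x.ofLp = 0 := by
    intro x
    rw [LinearMap.mem_ker]
    constructor
    · intro h; exact congrArg WithLp.ofLp h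
    · intro h; ext i; exact congrFun h i
  have hMZ : M * Z = 0 := by
    rw [hZ, Matrix.mul_sum]
    exact Finset.sum_eq_zero fun i _ => mul_ketbra_eq_zero hker i
  have hZM : Z * M = 0 := by
    have := congrArg Matrix.conjTranspose hMZ
    rwa [Matrix.conjTranspose_mul, hZH, hM.1.eq, Matrix.conjTranspose_zero] at this
  have hZψ : ∀ i, Z *ᵥ (ψ i).ofLp = (ψ i).ofLp := by
    intro i
    rw [hZ, Matrix.sum_mulVec, Finset.sum_eq_single i]
    · rw [hketbra, inner_self_eq_norm_sq_to_K, hψ.1 i]; simp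
    · intro j _ hj
      rw [hketbra, hψ.2 hj, zero_smul]
    · simp
  have hZx : ∀ x : EuclideanSpace ℂ (Fin D), x ∈ Submodule.span ℂ (Set.range ψ) →
      Z *ᵥ x.ofLp = x.ofLp := by
    intro x hx
    induction hx using Submodule.span_induction with
    | mem x h => obtain ⟨i, rfl⟩ := h; exact hZψ i
    | zero => simp
    | add x y _ _ hx hy => rw [WithLp.ofLp_add, Matrix.mulVec_add, hx, hy]
    | smul c x _ hx => rw [WithLp.ofLp_smul, Matrix.mulVec_smul, hx]
  have hZZ : Z * Z = Z := by
    nth_rewrite 2 3 [hZ]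
    rw [Matrix.mul_sum]
    refine Finset.sum_congr rfl fun i _ => ?_
    unfold ketbra
    rw [Matrix.mul_vecMulVec]
    congr 1
    exact hZψ i
  have hunit : IsUnit (M + Z) := by
    rw [← Matrix.mulVec_injective_iff_isUnit]
    refine (injective_iff_map_eq_zero (Matrix.mulVecLin (M + Z))).mpr fun x hx => ?_
    change (M + Z) *ᵥ x = 0 at hx
    have h1 : Z *ᵥ x = 0 := by
      have := congrArg (fun y => Z *ᵥ y) hx
      simpa [Matrix.mulVec_mulVec, Matrix.mul_add, hZM, hZZ] using this
    have h2 : M *ᵥ x = 0 := by rwa [Matrix.add_mulVec, h1, add_zero] at hx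
    have h3 := hZx (WithLp.toLp 2 x) (hker ▸ (hmemker _).mpr h2)
    exact h3.symm.trans h1
  -- the perturbation factors through `M` on both sides
  set S := (M + Z)⁻¹ with hS
  have hdet := (Matrix.isUnit_iff_isUnit_det _).mp hunit
  have hSM : S * M = 1 - Z := by
    have h1 : (M + Z) * (1 - Z) = M := by
      rw [Matrix.mul_sub, Matrix.mul_one, Matrix.add_mul, hMZ, hZZ]; simp
    calc S * M = S * ((M + Z) * (1 - Z)) := by rw [h1]
      _ = 1 - Z := by rw [hS, ← Matrix.mul_assoc, Matrix.nonsing_inv_mul _ hdet, Matrix.one_mul]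
  have hSH : Sᴴ = S := by
    rw [hS, Matrix.conjTranspose_nonsing_inv, Matrix.conjTranspose_add, hM.1.eq, hZH]
  have hMS : M * S = 1 - Z := by
    have := congrArg Matrix.conjTranspose hSM
    rwa [Matrix.conjTranspose_mul, hM.1.eq, hSH, Matrix.conjTranspose_sub,
      Matrix.conjTranspose_one, hZH] at this
  have hfac : Δ = M * S * Δ * (S * M) := by
    rw [hMS, hSM]
    simp [Matrix.sub_mul, Matrix.mul_sub, hΔZ, hZΔ]
  obtain ⟨R, hR⟩ := exists_eq_conjTranspose_mul_self hM
  have hY : (R * (S * Δ * S) * Rᴴ).IsHermitian := by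
    rw [Matrix.IsHermitian]
    simp only [Matrix.conjTranspose_mul, Matrix.conjTranspose_conjTranspose, hSH, hΔ.eq,
      Matrix.mul_assoc]
  filter_upwards [eventually_posSemidef_one_add_smul hY] with t ht
  have h := ht.conjTranspose_mul_mul_same R
  have e : Rᴴ * (1 + (t : ℂ) • (R * (S * Δ * S) * Rᴴ)) * R = M + (t : ℂ) • Δ := by
    rw [Matrix.mul_add, Matrix.add_mul, Matrix.mul_one, ← hR, Matrix.mul_smul, Matrix.smul_mul]
    have e' : Rᴴ * (R * (S * Δ * S) * Rᴴ) * R = (Rᴴ * R) * S * Δ * (S * (Rᴴ * R)) := by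
      simp only [Matrix.mul_assoc]
    rw [e', ← hR, ← hfac]
  rwa [e] at h

/-- An extremal POVM admits no non-trivial Hermitian perturbation of total zero that vanishes on
the kernels of its elements. -/
theorem extremal_povm_rigid {M : Fin B → Matrix (Fin D) (Fin D) ℂ}
    (hM : M ∈ Set.extremePoints ℝ (povms D B))
    {d : Fin B → ℕ} {ψ : (b : Fin B) → Fin (d b) → EuclideanSpace ℂ (Fin D)}
    (hψ : ∀ b, Orthonormal ℂ (ψ b))
    (hker : ∀ b, Submodule.span ℂ (Set.range (ψ b)) =
      LinearMap.ker (Matrix.toEuclideanLin (M b)))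
    {Δ : Fin B → Matrix (Fin D) (Fin D) ℂ} (hΔ : ∀ b, (Δ b).IsHermitian) (hsum : ∑ b, Δ b = 0)
    (hΔψ : ∀ b i, Δ b * ketbra (ψ b i) = 0) : Δ = 0 := by
  have hev : ∀ᶠ t : ℝ in 𝓝 0, ∀ b, (M b + (t : ℂ) • Δ b).PosSemidef :=
    eventually_all.mpr fun b =>
      eventually_posSemidef_add_smul (hM.1.1 b) (hψ b) (hker b) (hΔ b) (hΔψ b)
  have hneg : Tendsto (fun t : ℝ => -t) (𝓝 0) (𝓝 0) := by
    simpa using (continuous_neg (G := ℝ)).tendsto 0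
  have hev' := hev.and (hneg.eventually hev)
  obtain ⟨t, ht, ht0⟩ := ((hev'.filter_mono nhdsWithin_le_nhds).and
    (self_mem_nhdsWithin : ∀ᶠ t : ℝ in 𝓝[>] 0, t ∈ Set.Ioi 0)).exists
  have hpovm : ∀ s : ℝ, (∀ b, (M b + (s : ℂ) • Δ b).PosSemidef) →
      (fun b => M b + (s : ℂ) • Δ b) ∈ povms D B := fun s hs =>
    ⟨hs, by rw [Finset.sum_add_distrib, ← Finset.smul_sum, hsum, smul_zero, add_zero, hM.1.2]⟩
  have hseg : M ∈ openSegment ℝ (fun b => M b + (t : ℂ) • Δ b)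
      (fun b => M b + ((-t : ℝ) : ℂ) • Δ b) := by
    refine ⟨1 / 2, 1 / 2, by norm_num, by norm_num, by norm_num, ?_⟩
    ext b i j
    simp
    ring
  have h := (mem_extremePoints.mp hM).2 _ (hpovm t ht.1) _ (hpovm (-t) ht.2) hseg
  ext b i j
  have h1 := congrFun (congrFun (congrFun h.1 b) i) j
  have h2 : (t : ℂ) ≠ 0 := by exact_mod_cast (ne_of_gt ht0)
  simpa [h2] using h1

open scoped Matrix.Norms.Frobenius in
theorem frobenius_norm_mul_ketbra_le {Q : Matrix (Fin D) (Fin D) ℂ} (hQ : Q.PosSemidef)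
    (hQ' : (1 - Q).PosSemidef) {v : EuclideanSpace ℂ (Fin D)} (hv : ‖v‖ = 1) :
    ‖Q * ketbra v‖ ≤ √D * √(ketbra v * Q).trace.re := by
  have hP : IsPureState (ketbra v) := ⟨v, hv, rfl⟩
  obtain ⟨R, hR⟩ := exists_eq_conjTranspose_mul_self hQ
  have h1 : ‖R‖ ≤ √D := by
    refine Real.le_sqrt_of_sq_le ?_
    rw [frobenius_norm_sq, ← hR]
    have := (Complex.le_def.mp hQ'.trace_nonneg).1
    simp only [Matrix.trace_sub, Matrix.trace_one, Fintype.card_fin, Complex.sub_re,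
      Complex.natCast_re, Complex.zero_re] at this
    linarith
  have h2 : ‖R * ketbra v‖ ≤ √(ketbra v * Q).trace.re := by
    refine Real.le_sqrt_of_sq_le (le_of_eq ?_)
    rw [frobenius_norm_sq, Matrix.conjTranspose_mul, (ketbra_posSemidef v).1.eq,
      Matrix.mul_assoc, ← Matrix.mul_assoc Rᴴ, ← hR, ← Matrix.mul_assoc, Matrix.trace_mul_comm,
      ← Matrix.mul_assoc, hP.mul_self]
  have h3 : Q * ketbra v = Rᴴ * (R * ketbra v) := by rw [← Matrix.mul_assoc, ← hR]
  rw [h3]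
  refine (Matrix.frobenius_norm_mul _ _).trans ?_
  rw [Matrix.frobenius_norm_conjTranspose]
  exact mul_le_mul h1 h2 (norm_nonneg _) (Real.sqrt_nonneg _)

theorem one_sub_posSemidef_of_povm {Q : Fin B → Matrix (Fin D) (Fin D) ℂ} (hQ : Q ∈ povms D B)
    (b : Fin B) : (1 - Q b).PosSemidef := by
  rw [← hQ.2, ← Finset.add_sum_erase _ _ (Finset.mem_univ b), add_sub_cancel_left]
  exact Matrix.posSemidef_sum _ fun i _ => hQ.1 i

open scoped Matrix.Norms.Frobenius in
theorem exists_opNorm_le_frobenius :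
    ∃ c : ℝ, 0 ≤ c ∧ ∀ A : Matrix (Fin D) (Fin D) ℂ, opNorm A ≤ c * ‖A‖ := by
  let T : Matrix (Fin D) (Fin D) ℂ →ₗ[ℂ]
      (EuclideanSpace ℂ (Fin D) →L[ℂ] EuclideanSpace ℂ (Fin D)) :=
    { toFun := fun A => Matrix.toEuclideanCLM (n := Fin D) (𝕜 := ℂ) A
      map_add' := fun A C => map_add _ A C
      map_smul' := fun c A => map_smul _ c A }
  obtain ⟨c, hc, h⟩ := SemilinearMapClass.bound_of_continuous T T.continuous_of_finiteDimensional
  exact ⟨c, hc.le, h⟩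

/-- A POVM whose elements have small expectation on the kernels of an extremal POVM is close to
that POVM: the linear map collecting the total, the action on the kernels and the anti-Hermitian
parts of a tuple is injective by extremality, hence bounded below. -/
theorem extremal_povm_stable {M : Fin B → Matrix (Fin D) (Fin D) ℂ}
    (hM : M ∈ Set.extremePoints ℝ (povms D B))
    {d : Fin B → ℕ} {ψ : (b : Fin B) → Fin (d b) → EuclideanSpace ℂ (Fin D)}
    (hψ : ∀ b, Orthonormal ℂ (ψ b))
    (hker : ∀ b, Submodule.span ℂ (Set.range (ψ b)) =
      LinearMap.ker (Matrix.toEuclideanLin (M b))) :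
    ∃ K : ℝ, ∀ Q ∈ povms D B, ∀ b, opNorm (M b - Q b) ≤
      K * ∑ b, ∑ i, √(ketbra (ψ b i) * Q b).trace.re := by
  open scoped Matrix.Norms.Frobenius in
  let T : (Fin B → Matrix (Fin D) (Fin D) ℂ) →ₗ[ℝ]
      Matrix (Fin D) (Fin D) ℂ × ((b : Fin B) → Fin (d b) → Matrix (Fin D) (Fin D) ℂ) ×
        (Fin B → Matrix (Fin D) (Fin D) ℂ) :=
    { toFun := fun Δ => (∑ b, Δ b, fun b i => Δ b * ketbra (ψ b i), fun b => Δ b - (Δ b)ᴴ)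
      map_add' := fun Δ Δ' => by
        refine Prod.ext ?_ (Prod.ext ?_ ?_)
        · simp [Finset.sum_add_distrib]
        · ext b i : 2; simp [Matrix.add_mul]
        · ext b : 1; simp [Matrix.conjTranspose_add]; abel
      map_smul' := fun c Δ => by
        refine Prod.ext ?_ (Prod.ext ?_ ?_)
        · simp [Finset.smul_sum]
        · ext b i : 2; simp
        · ext b : 1; simp [Matrix.conjTranspose_smul, smul_sub] }
  have hT : LinearMap.ker T = ⊥ := by
    refine LinearMap.ker_eq_bot'.mpr fun Δ hΔ => ?_
    have h1 : ∑ b, Δ b = 0 := congrArg Prod.fst hΔ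
    have h2 : (fun b i => Δ b * ketbra (ψ b i)) = (0 : (b : Fin B) → Fin (d b) → _) :=
      congrArg (fun z => z.2.1) hΔ
    have h3 : (fun b => Δ b - (Δ b)ᴴ) = 0 := congrArg (fun z => z.2.2) hΔ
    exact extremal_povm_rigid hM hψ hker (fun b => (sub_eq_zero.mp (congrFun h3 b)).symm) h1
      fun b i => congrFun (congrFun h2 b) i
  obtain ⟨K, -, hK⟩ := T.exists_antilipschitzWith hT
  obtain ⟨c, hc0, hc⟩ := exists_opNorm_le_frobenius (D := D)
  refine ⟨c * (K * √D), fun Q hQ b => ?_⟩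
  have hMψ := fun b i => mul_ketbra_eq_zero (hker b) i
  have hle : ∀ b i, ‖(M b - Q b) * ketbra (ψ b i)‖ ≤
      √D * ∑ b, ∑ i, √(ketbra (ψ b i) * Q b).trace.re := by
    intro b i
    rw [Matrix.sub_mul, hMψ, zero_sub, norm_neg]
    refine (frobenius_norm_mul_ketbra_le (hQ.1 b) (one_sub_posSemidef_of_povm hQ b)
      ((hψ b).1 i)).trans (mul_le_mul_of_nonneg_left ?_ (Real.sqrt_nonneg _))
    refine (Finset.single_le_sum (f := fun i => √(ketbra (ψ b i) * Q b).trace.re)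
      (fun i _ => Real.sqrt_nonneg _) (Finset.mem_univ i)).trans ?_
    exact Finset.single_le_sum (f := fun b => ∑ i, √(ketbra (ψ b i) * Q b).trace.re)
      (fun b _ => Finset.sum_nonneg fun i _ => Real.sqrt_nonneg _) (Finset.mem_univ b)
  have hnn : 0 ≤ √D * ∑ b, ∑ i, √(ketbra (ψ b i) * Q b).trace.re :=
    mul_nonneg (Real.sqrt_nonneg _)
      (Finset.sum_nonneg fun b _ => Finset.sum_nonneg fun i _ => Real.sqrt_nonneg _)
  have hTle : ‖T (M - Q)‖ ≤ √D * ∑ b, ∑ i, √(ketbra (ψ b i) * Q b).trace.re := by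
    have e : T (M - Q) = (0, fun b i => (M b - Q b) * ketbra (ψ b i), 0) := by
      refine Prod.ext ?_ (Prod.ext rfl ?_)
      · change ∑ b, (M b - Q b) = 0
        rw [Finset.sum_sub_distrib, hM.1.2, hQ.2, sub_self]
      · ext b : 1
        change (M b - Q b) - (M b - Q b)ᴴ = 0
        rw [Matrix.conjTranspose_sub, (hM.1.1 b).1.eq, (hQ.1 b).1.eq, sub_self]
    rw [e, Prod.norm_mk, Prod.norm_mk, norm_zero, norm_zero]
    refine max_le hnn (max_le ?_ hnn)
    exact (pi_norm_le_iff_of_nonneg hnn).mpr fun b =>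
      (pi_norm_le_iff_of_nonneg hnn).mpr fun i => hle b i
  have h1 : ‖M - Q‖ ≤ K * ‖T (M - Q)‖ := by
    have := hK.le_mul_dist (M - Q) 0
    simpa using this
  calc opNorm (M b - Q b) ≤ c * ‖(M - Q) b‖ := hc _
    _ ≤ c * ‖M - Q‖ := mul_le_mul_of_nonneg_left (norm_le_pi_norm _ b) hc0
    _ ≤ c * (K * (√D * ∑ b, ∑ i, √(ketbra (ψ b i) * Q b).trace.re)) :=
        mul_le_mul_of_nonneg_left (h1.trans (mul_le_mul_of_nonneg_left hTle K.2)) hc0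
    _ = _ := by ring

end Extremal

/-! ### From near-optimal realizations to the reference POVM -/

section Conclusion

variable {D : ℕ}

open scoped Matrix.Norms.Frobenius in
theorem norm_apply_le_frobenius (A : Matrix (Fin D) (Fin D) ℂ) (j k : Fin D) : ‖A j k‖ ≤ ‖A‖ := by
  rw [Matrix.frobenius_norm_def, ← Real.sqrt_eq_rpow]
  refine Real.le_sqrt_of_sq_le ?_
  have h1 := Finset.single_le_sum (f := fun k => ‖A j k‖ ^ (2 : ℝ)) (fun i _ => by positivity)
    (Finset.mem_univ k)
  have h2 := Finset.single_le_sum (f := fun j => ∑ k, ‖A j k‖ ^ (2 : ℝ))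
    (fun i _ => Finset.sum_nonneg fun k _ => by positivity) (Finset.mem_univ j)
  refine (le_of_eq ?_).trans (h1.trans h2)
  exact (Real.rpow_two _).symm

theorem IsState.norm_apply_le {ρ : Matrix (Fin D) (Fin D) ℂ} (hρ : IsState ρ) (j k : Fin D) :
    ‖ρ j k‖ ≤ 1 := by
  open scoped Matrix.Norms.Frobenius in
  refine (norm_apply_le_frobenius ρ j k).trans ?_
  have h : ‖ρ‖ ^ 2 ≤ 1 := by
    rw [frobenius_norm_sq, hρ.1.1.eq]; exact trace_mul_le_one hρ hρ
  exact (sq_le_one_iff₀ (norm_nonneg _)).mp h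

open scoped Matrix.Norms.Frobenius in
theorem effect_frobenius_le {Q : Matrix (Fin D) (Fin D) ℂ} (hQ : Q.PosSemidef)
    (hQ' : (1 - Q).PosSemidef) : ‖Q‖ ≤ D := by
  obtain ⟨R, hR⟩ := exists_eq_conjTranspose_mul_self hQ
  have h1 : ‖R‖ ^ 2 ≤ D := by
    rw [frobenius_norm_sq, ← hR]
    have := (Complex.le_def.mp hQ'.trace_nonneg).1
    simp only [Matrix.trace_sub, Matrix.trace_one, Fintype.card_fin, Complex.sub_re,
      Complex.natCast_re, Complex.zero_re] at this
    linarith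
  rw [hR]
  refine (Matrix.frobenius_norm_mul _ _).trans ?_
  rwa [Matrix.frobenius_norm_conjTranspose, ← sq]

theorem effect_unitary_conj {Q F : Matrix (Fin D) (Fin D) ℂ} (hQ : Q.PosSemidef)
    (hQ' : (1 - Q).PosSemidef) (hF : F ∈ Matrix.unitaryGroup (Fin D) ℂ) :
    (Fᴴ * Q * F).PosSemidef ∧ (1 - Fᴴ * Q * F).PosSemidef := by
  refine ⟨hQ.conjTranspose_mul_mul_same F, ?_⟩
  have h : Fᴴ * F = 1 := Matrix.mem_unitaryGroup_iff'.mp hF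
  have e : 1 - Fᴴ * Q * F = Fᴴ * (1 - Q) * F := by
    rw [Matrix.mul_sub, Matrix.sub_mul, Matrix.mul_one, h]
  rw [e]
  exact hQ'.conjTranspose_mul_mul_same F

/-- A state of purity close to one is close to a pure state. In a decomposition of `ρ` into pure
states the average overlap with `ρ` is `tr ρ²`, so that some pure state has at least this overlap. -/
theorem exists_pure_near {ρ : Matrix (Fin D) (Fin D) ℂ} (hρ : IsState ρ) :
    ∃ P, IsPureState P ∧ ∀ j k, ‖ρ j k - P j k‖ ≤ √(1 - (ρ * ρ).trace.re) := by
  open scoped Matrix.Norms.Frobenius in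
  obtain ⟨m, w, hw⟩ := Matrix.posSemidef_iff_eq_sum_vecMulVec.mp hρ.1
  let v : Fin m → EuclideanSpace ℂ (Fin D) := fun i => WithLp.toLp 2 (w i)
  have hw' : ρ = ∑ i, ketbra (v i) := hw
  have hnorm : ∑ i, ‖v i‖ ^ 2 = 1 := by
    have h := hρ.2
    rw [hw', Matrix.trace_sum] at h
    simp only [trace_ketbra] at h
    exact_mod_cast h
  have havg : ∑ i, (ρ * ketbra (v i)).trace.re = (ρ * ρ).trace.re := by
    conv_rhs => rw [hw']
    rw [← Complex.re_sum, ← Matrix.trace_sum, ← Matrix.mul_sum, ← hw']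
  obtain ⟨i, hi, hle⟩ : ∃ i, v i ≠ 0 ∧
      (ρ * ρ).trace.re * ‖v i‖ ^ 2 ≤ (ρ * ketbra (v i)).trace.re := by
    by_contra! hcon
    have hle : ∀ i, (ρ * ketbra (v i)).trace.re ≤ (ρ * ρ).trace.re * ‖v i‖ ^ 2 := by
      intro i
      by_cases h0 : v i = 0
      · have : ketbra (0 : EuclideanSpace ℂ (Fin D)) = 0 := by ext; simp [ketbra_apply]
        rw [h0, this]; simp
      · exact (hcon i h0).le
    obtain ⟨i, hi⟩ : ∃ i, v i ≠ 0 := by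
      by_contra! h0
      simp [h0] at hnorm
    have hlt := Finset.sum_lt_sum (fun i _ => hle i) ⟨i, Finset.mem_univ i, hcon i hi⟩
    rw [← Finset.mul_sum, hnorm, havg, mul_one] at hlt
    exact lt_irrefl _ hlt
  have hn : ‖v i‖ ≠ 0 := norm_ne_zero_iff.mpr hi
  have hk : ketbra (v i) = ((‖v i‖ ^ 2 : ℝ) : ℂ) • ketbra (((‖v i‖⁻¹ : ℝ) : ℂ) • v i) := by
    ext j k
    simp only [ketbra_apply, Matrix.smul_apply, PiLp.smul_apply, smul_eq_mul, star_mul']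
    have hs : star ((‖v i‖⁻¹ : ℝ) : ℂ) = ((‖v i‖⁻¹ : ℝ) : ℂ) := Complex.conj_ofReal _
    have hn' : (‖v i‖ : ℂ) ≠ 0 := by exact_mod_cast hn
    rw [hs]
    push_cast
    field_simp
  set p := ((‖v i‖⁻¹ : ℝ) : ℂ) • v i with hp
  have hpn : ‖p‖ = 1 := by
    rw [hp, norm_smul, Complex.norm_real, norm_inv, norm_norm, inv_mul_cancel₀ hn]
  have hP : IsPureState (ketbra p) := ⟨p, hpn, rfl⟩
  refine ⟨ketbra p, hP, fun j k => ?_⟩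
  refine (norm_apply_le_frobenius (ρ - ketbra p) j k).trans (Real.le_sqrt_of_sq_le ?_)
  have hov : (ρ * ρ).trace.re ≤ (ρ * ketbra p).trace.re := by
    rw [hk, Matrix.mul_smul, Matrix.trace_smul, smul_eq_mul, Complex.re_ofReal_mul, mul_comm] at hle
    exact le_of_mul_le_mul_left hle (by positivity)
  rw [frobenius_norm_sq, Matrix.conjTranspose_sub, hρ.1.1.eq, hP.isState.1.1.eq, Matrix.sub_mul,
    Matrix.mul_sub, Matrix.mul_sub, hP.mul_self]
  simp only [Matrix.trace_sub, Complex.sub_re, hP.isState.2, Complex.one_re,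
    Matrix.trace_mul_comm (ketbra p) ρ]
  linarith

theorem IsUnitaryOrAntiunitaryConj.povm {B : ℕ}
    {τ : Matrix (Fin D) (Fin D) ℂ → Matrix (Fin D) (Fin D) ℂ} (hτ : IsUnitaryOrAntiunitaryConj τ)
    {Q : Fin B → Matrix (Fin D) (Fin D) ℂ} (hQ : Q ∈ povms D B) : (fun b => τ (Q b)) ∈ povms D B := by
  obtain ⟨V, hV, hτ⟩ := hτ
  have hVV : V * Vᴴ = 1 := Matrix.mem_unitaryGroup_iff.mp hV
  rcases hτ with hτ | hτ
  · refine ⟨fun b => ?_, ?_⟩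
    · simp only [hτ]; exact (hQ.1 b).mul_mul_conjTranspose_same V
    · simp only [hτ]
      rw [← Finset.sum_mul, ← Finset.mul_sum, hQ.2, Matrix.mul_one, hVV]
  · have hmap : ∀ b, (Q b).map star = (Q b)ᵀ := fun b => by
      nth_rewrite 2 [← (hQ.1 b).1.eq]; rfl
    refine ⟨fun b => ?_, ?_⟩
    · simp only [hτ, hmap]; exact (hQ.1 b).transpose.mul_mul_conjTranspose_same V
    · simp only [hτ, hmap]
      rw [← Finset.sum_mul, ← Finset.mul_sum, ← Matrix.transpose_sum, hQ.2, Matrix.transpose_one,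
        Matrix.mul_one, hVV]

theorem IsUnitaryOrAntiunitaryConj.exists_inverse
    {τ : Matrix (Fin D) (Fin D) ℂ → Matrix (Fin D) (Fin D) ℂ}
    (hτ : IsUnitaryOrAntiunitaryConj τ) :
    ∃ σ, IsUnitaryOrAntiunitaryConj σ ∧ ∀ A : Matrix (Fin D) (Fin D) ℂ, σ (τ A) = A := by
  obtain ⟨V, hV, hτ⟩ := hτ
  have hVV : Vᴴ * V = 1 := Matrix.mem_unitaryGroup_iff'.mp hV
  rcases hτ with hτ | hτ
  · refine ⟨fun A => Vᴴ * A * Vᴴᴴ, ⟨Vᴴ, Unitary.star_mem hV, Or.inl fun _ => rfl⟩, fun A => ?_⟩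
    rw [hτ, Matrix.conjTranspose_conjTranspose]
    calc Vᴴ * (V * A * Vᴴ) * V = (Vᴴ * V) * A * (Vᴴ * V) := by simp only [Matrix.mul_assoc]
      _ = A := by rw [hVV, Matrix.one_mul, Matrix.mul_one]
  · have hmm : ∀ A C : Matrix (Fin D) (Fin D) ℂ, (A * C).map star = A.map star * C.map star := by
      intro A C
      exact Matrix.map_mul (f := starRingEnd ℂ)
    have hT : (Vᵀ)ᴴ = V.map star := by
      rw [Matrix.conjTranspose, Matrix.transpose_transpose]
    have hVs : Vᵀ * V.map star = 1 := by
      have h := congrArg (fun A : Matrix (Fin D) (Fin D) ℂ => A.map star) hVV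
      simp only [hmm] at h
      have h1 : (Vᴴ).map star = Vᵀ := by ext; simp
      have h2 : (1 : Matrix (Fin D) (Fin D) ℂ).map star = 1 :=
        Matrix.map_one (starRingEnd ℂ) (map_zero _) (map_one _)
      rwa [h1, h2] at h
    have hmem : Vᵀ ∈ Matrix.unitaryGroup (Fin D) ℂ := by
      rw [Matrix.mem_unitaryGroup_iff, Matrix.star_eq_conjTranspose, hT, hVs]
    refine ⟨fun A => Vᵀ * A.map star * Vᵀᴴ, ⟨Vᵀ, hmem, Or.inr fun _ => rfl⟩, fun A => ?_⟩
    have h1 : (Vᴴ).map star = Vᵀ := by ext; simp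
    have h2 : (A.map star).map star = A := by ext; simp
    beta_reduce
    rw [hτ, hT, hmm, hmm, h1, h2]
    calc Vᵀ * (V.map star * A * Vᵀ) * V.map star =
        (Vᵀ * V.map star) * A * (Vᵀ * V.map star) := by simp only [Matrix.mul_assoc]
      _ = A := by rw [hVs, Matrix.one_mul, Matrix.mul_one]

/-- The (anti-)unitary change of basis from the columns of `F` to those of `E`. -/
theorem exists_conj_between {E F : Matrix (Fin D) (Fin D) ℂ}
    (hE : E ∈ Matrix.unitaryGroup (Fin D) ℂ) (hF : F ∈ Matrix.unitaryGroup (Fin D) ℂ) :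
    (∃ τ, IsUnitaryOrAntiunitaryConj τ ∧ ∀ A φ : Matrix (Fin D) (Fin D) ℂ,
      (φ * τ A).trace = ((Eᴴ * φ * E) * (Fᴴ * A * F)).trace) ∧
    ∃ τ, IsUnitaryOrAntiunitaryConj τ ∧ ∀ A φ : Matrix (Fin D) (Fin D) ℂ, A.IsHermitian →
      (φ * τ A).trace = ((Eᴴ * φ * E) * (Fᴴ * A * F)ᵀ).trace := by
  have hFs : Fᴴ ∈ Matrix.unitaryGroup (Fin D) ℂ := Unitary.star_mem hF
  have hFF : F * Fᴴ = 1 := Matrix.mem_unitaryGroup_iff.mp hF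
  have hT : (Fᵀ)ᴴ = F.map star := by
    rw [Matrix.conjTranspose, Matrix.transpose_transpose]
  have hHT : (Fᴴ)ᵀ = F.map star := by
    rw [Matrix.conjTranspose, Matrix.transpose_map, Matrix.transpose_transpose]
  have hFt : Fᵀ ∈ Matrix.unitaryGroup (Fin D) ℂ := by
    rw [Matrix.mem_unitaryGroup_iff', Matrix.star_eq_conjTranspose, hT, ← hHT,
      ← Matrix.transpose_mul, hFF, Matrix.transpose_one]
  have hcyc : ∀ φ X : Matrix (Fin D) (Fin D) ℂ,
      (φ * (E * X * Eᴴ)).trace = ((Eᴴ * φ * E) * X).trace := by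
    intro φ X
    rw [← Matrix.mul_assoc, Matrix.trace_mul_comm]
    simp only [Matrix.mul_assoc]
  refine ⟨⟨fun A => (E * Fᴴ) * A * (E * Fᴴ)ᴴ, ⟨E * Fᴴ, mul_mem hE hFs, Or.inl fun _ => rfl⟩,
    fun A φ => ?_⟩, ⟨fun A => (E * Fᵀ) * A.map star * (E * Fᵀ)ᴴ,
    ⟨E * Fᵀ, mul_mem hE hFt, Or.inr fun _ => rfl⟩, fun A φ hA => ?_⟩⟩
  · rw [← hcyc, Matrix.conjTranspose_mul, Matrix.conjTranspose_conjTranspose]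
    simp only [Matrix.mul_assoc]
  · have hmap : A.map star = Aᵀ := by
      nth_rewrite 2 [← hA.eq]; rfl
    beta_reduce
    rw [← hcyc, Matrix.conjTranspose_mul, hT, hmap, Matrix.transpose_mul, Matrix.transpose_mul, hHT]
    simp only [Matrix.mul_assoc]

end Conclusion

/-! ### Robust self-testing -/

section SelfTest

variable {D N B : ℕ} {ι : Type*} {u : Ultrafilter ι} {ε : ι → ℝ}

theorem rpow_eighth_pow {x : ℝ} (hx : 0 ≤ x) : (x ^ (1 / 8 : ℝ)) ^ 8 = x := by
  rw [← Real.rpow_natCast, ← Real.rpow_mul hx]; norm_num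

theorem rpow_sixteenth_sq {x : ℝ} (hx : 0 ≤ x) : (x ^ (1 / 16 : ℝ)) ^ 2 = x ^ (1 / 8 : ℝ) := by
  rw [← Real.rpow_natCast, ← Real.rpow_mul hx]; norm_num

/-- Overlaps of nearly optimal states, and their distance to pure states. Here `ε^{1/2}` is
written as the fourth power of `ε^{1/8}`, the accuracy available for the states in the end. -/
theorem overlaps_of_near_optimal {l : Filter ι} {φ : Fin N → Matrix (Fin D) (Fin D) ℂ}
    (hφ : ∀ x, IsPureState (φ x)) {α : Fin N → ℝ} (hα : ∀ x, 0 < α x)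
    {ρ : ι → Fin N → Matrix (Fin D) (Fin D) ℂ} (hρ : ∀ n x, IsState (ρ n x))
    (hε : ∀ n, 0 ≤ ε n) (hε0 : Tendsto ε l (𝓝 0))
    (h1 : ∀ n, ∀ i j, j < i → α i * α j *
      (√(1 - (φ i * φ j).trace.re) - √(1 - (ρ n i * ρ n j).trace.re)) ^ 2 ≤ ε n)
    (h2 : ∀ n i, α i ^ 2 * (1 - (ρ n i * ρ n i).trace.re) ≤ 2 * ε n) :
    ∃ P : Fin N → ι → Matrix (Fin D) (Fin D) ℂ, (∀ x n, IsPureState (P x n)) ∧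
      (∀ x j k, (fun n => ρ n x j k - P x n j k) =O[l] fun n => (ε n ^ (1 / 8 : ℝ)) ^ 4) ∧
      ∀ x y, Approx l (fun n => (ε n ^ (1 / 8 : ℝ)) ^ 4) (fun n => (P x n * P y n).trace)
        (φ x * φ y).trace := by
  set θ : ι → ℝ := fun n => ε n ^ (1 / 8 : ℝ) with hθdef
  have hθnn : ∀ n, 0 ≤ θ n := fun n => Real.rpow_nonneg (hε n) _
  have hθ8 : ∀ n, (θ n ^ 4) ^ 2 = ε n := fun n => by
    rw [← pow_mul]; exact rpow_eighth_pow (hε n)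
  have hθ : Tendsto θ l (𝓝 0) := by
    have := hε0.rpow_const (p := (1 / 8 : ℝ)) (Or.inr (by norm_num))
    rwa [Real.zero_rpow (by norm_num)] at this
  have hη : Tendsto (fun n => θ n ^ 4) l (𝓝 0) := by simpa using hθ.pow 4
  choose P hP hPρ using fun (x : Fin N) (n : ι) => exists_pure_near (hρ n x)
  have hclose : ∀ x j k, (fun n => ρ n x j k - P x n j k) =O[l] fun n => θ n ^ 4 := by
    intro x j k
    refine IsBigO.of_bound (√(2 / α x ^ 2)) (Eventually.of_forall fun n => ?_)
    refine (hPρ x n j k).trans ?_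
    rw [Real.norm_of_nonneg (pow_nonneg (hθnn n) 4),
      ← Real.sqrt_sq (pow_nonneg (hθnn n) 4), hθ8, ← Real.sqrt_mul (by positivity)]
    refine Real.sqrt_le_sqrt ?_
    rw [div_mul_eq_mul_div, le_div_iff₀ (pow_pos (hα x) 2), mul_comm]
    exact h2 n x
  -- overlaps of the realized states
  have hoff : ∀ x y, y < x → Approx l (fun n => θ n ^ 4) (fun n => (ρ n x * ρ n y).trace.re)
      (φ x * φ y).trace.re := by
    intro x y hxy
    refine IsBigO.of_bound (2 * √(1 / (α x * α y))) (Eventually.of_forall fun n => ?_)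
    have ha : 0 < α x * α y := mul_pos (hα x) (hα y)
    have hs : (0 : ℝ) ≤ 1 - (φ x * φ y).trace.re := by
      linarith [trace_mul_le_one (hφ x).isState (hφ y).isState]
    have ht : (0 : ℝ) ≤ 1 - (ρ n x * ρ n y).trace.re := by
      linarith [trace_mul_le_one (hρ n x) (hρ n y)]
    have hs1 : √(1 - (φ x * φ y).trace.re) ≤ 1 := by
      rw [Real.sqrt_le_one]
      linarith [trace_mul_nonneg (hφ x).isState.1 (hφ y).isState.1]
    have ht1 : √(1 - (ρ n x * ρ n y).trace.re) ≤ 1 := by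
      rw [Real.sqrt_le_one]
      linarith [trace_mul_nonneg (hρ n x).1 (hρ n y).1]
    have hst := h1 n x y hxy
    have e : (ρ n x * ρ n y).trace.re - (φ x * φ y).trace.re =
        (√(1 - (φ x * φ y).trace.re) + √(1 - (ρ n x * ρ n y).trace.re)) *
        (√(1 - (φ x * φ y).trace.re) - √(1 - (ρ n x * ρ n y).trace.re)) := by
      rw [← sq_sub_sq, Real.sq_sqrt hs, Real.sq_sqrt ht]; ring
    have hd : ‖√(1 - (φ x * φ y).trace.re) - √(1 - (ρ n x * ρ n y).trace.re)‖ ≤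
        √(1 / (α x * α y)) * θ n ^ 4 := by
      refine Real.abs_le_sqrt (y := 1 / (α x * α y) * (θ n ^ 4) ^ 2) ?_ |>.trans (le_of_eq ?_)
      · rw [hθ8, one_div, inv_mul_eq_div, le_div_iff₀ ha, mul_comm]; exact hst
      · rw [Real.sqrt_mul (by positivity), Real.sqrt_sq (pow_nonneg (hθnn n) 4)]
    rw [e, norm_mul, Real.norm_of_nonneg (pow_nonneg (hθnn n) 4), mul_assoc]
    refine mul_le_mul ?_ hd (norm_nonneg _) zero_le_two
    rw [Real.norm_of_nonneg (add_nonneg (Real.sqrt_nonneg _) (Real.sqrt_nonneg _))]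
    linarith
  have hdiag : ∀ x, Approx l (fun n => θ n ^ 4) (fun n => (ρ n x * ρ n x).trace.re)
      (φ x * φ x).trace.re := by
    intro x
    rw [(hφ x).mul_self, (hφ x).isState.2, Complex.one_re]
    refine Approx.mono (η := ε) ?_ ?_
    · refine IsBigO.of_bound (2 / α x ^ 2) (Eventually.of_forall fun n => ?_)
      rw [← norm_neg, neg_sub, Real.norm_of_nonneg
        (by linarith [trace_mul_le_one (hρ n x) (hρ n x)]), Real.norm_of_nonneg (hε n),
        div_mul_eq_mul_div, le_div_iff₀ (pow_pos (hα x) 2), mul_comm]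
      exact h2 n x
    · exact (isBigO_sq_of_tendsto hη).congr_left hθ8
  have hall : ∀ x y, Approx l (fun n => θ n ^ 4) (fun n => (ρ n x * ρ n y).trace)
      (φ x * φ y).trace := by
    intro x y
    have hre : Approx l (fun n => θ n ^ 4) (fun n => (ρ n x * ρ n y).trace.re)
        (φ x * φ y).trace.re := by
      rcases lt_trichotomy x y with h | rfl | h
      · refine (hoff y x h).congr (fun n => ?_) ?_
        · rw [Matrix.trace_mul_comm]
        · rw [Matrix.trace_mul_comm]
      · exact hdiag x
      · exact hoff x y h
    exact hre.ofReal.congr (fun n => (trace_mul_eq_ofReal (hρ n x).1.1 (hρ n y).1.1).symm)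
      (trace_mul_eq_ofReal (hφ x).isState.1.1 (hφ y).isState.1.1).symm
  refine ⟨P, hP, hclose, fun x y => ?_⟩
  have hdiff : ∀ j k, Approx l (fun n => θ n ^ 4)
      (fun n => P x n j k * P y n k j - ρ n x j k * ρ n y k j) 0 := by
    intro j k
    have e1 : (fun n => (ρ n x j k - P x n j k) * ρ n y k j) =O[l] fun n => θ n ^ 4 * (1 : ℝ) :=
      (hclose x j k).mul (IsBigO.of_bound 1 (Eventually.of_forall fun n => by
        simpa using (hρ n y).norm_apply_le k j))
    have e2 : (fun n => P x n j k * (ρ n y k j - P y n k j)) =O[l] fun n => (1 : ℝ) * θ n ^ 4 :=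
      (isBigO_one_apply hP x j k).mul (hclose y k j)
    simp only [mul_one, one_mul] at e1 e2
    exact (e1.add e2).neg_left.congr_left fun n => by ring
  have hsum := Approx.sum Finset.univ fun j _ => Approx.sum Finset.univ fun k _ => hdiff j k
  refine ((hall x y).add hsum).congr (fun n => ?_) (by simp)
  simp only [Matrix.trace, Matrix.diag, Matrix.mul_apply, Finset.sum_sub_distrib]
  ring

/-- If the entries of the states `R n` converge to those of `r`, then their expectation of effects
`G n` differs from that of `r` by the same error. -/
theorem isBigO_trace_sub {l : Filter ι} {θ : ι → ℝ} {R G : ι → Matrix (Fin D) (Fin D) ℂ}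
    {r : Matrix (Fin D) (Fin D) ℂ} (hR : ∀ j k, Approx l θ (fun n => R n j k) (r j k))
    (hG : ∀ n j k, ‖G n j k‖ ≤ D) :
    (fun n => (r * G n).trace.re - (R n * G n).trace.re) =O[l] θ := by
  have h : ∀ j k, Approx l θ (fun n => (R n j k - r j k) * G n k j) 0 := by
    intro j k
    have e : (fun n => (R n j k - r j k) * G n k j) =O[l] fun n => θ n * (1 : ℝ) :=
      IsBigO.mul (hR j k) (IsBigO.of_bound D (Eventually.of_forall fun n => by
        simpa using hG n k j))
    exact e.congr (fun n => by rw [sub_zero]) fun n => mul_one _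
  have hsum := (Approx.sum Finset.univ fun j _ => Approx.sum Finset.univ fun k _ => h j k).re.neg
  refine IsBigO.congr_left hsum fun n => ?_
  simp only [Matrix.trace, Matrix.diag, Matrix.mul_apply, sub_mul, Finset.sum_sub_distrib,
    Finset.sum_const_zero, Complex.zero_re, neg_zero, sub_zero, Complex.sub_re]
  ring

/-- Robust self-testing along an ultrafilter: realizations whose deficit `ε` tends to zero recover
the extremal POVM up to `O(ε^{1/16})`. -/
theorem exists_conj_isBigO (hD : 0 < D) {M : Fin B → Matrix (Fin D) (Fin D) ℂ}
    (hM : M ∈ Set.extremePoints ℝ (povms D B))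
    {d : Fin B → ℕ} {ψ : (b : Fin B) → Fin (d b) → EuclideanSpace ℂ (Fin D)}
    (hψ : ∀ b, Orthonormal ℂ (ψ b))
    (hker : ∀ b, Submodule.span ℂ (Set.range (ψ b)) =
      LinearMap.ker (Matrix.toEuclideanLin (M b)))
    {φ : Fin N → Matrix (Fin D) (Fin D) ℂ} (hφ : ∀ x, IsPureState (φ x))
    {α : Fin N → ℝ} (hα : ∀ x, 0 < α x)
    (hmix : ∑ x, (α x : ℂ) • φ x = (1 / (D : ℂ)) • (1 : Matrix (Fin D) (Fin D) ℂ))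
    {κ : (b : Fin B) → Fin (d b) → Fin N} (hκ : ∀ b i, φ (κ b i) = ketbra (ψ b i))
    (hT : 2 < D → ∃ e : OrthonormalBasis (Fin D) ℂ (EuclideanSpace ℂ (Fin D)),
      fiducialStates e ⊆ Set.range φ ∧ ∀ b i k, inner ℂ (e k) (ψ b i) ≠ 0)
    (hε : ∀ n, 0 ≤ ε n) (hε0 : Tendsto ε u (𝓝 0))
    {ρ : ι → Fin N → Matrix (Fin D) (Fin D) ℂ} {Q : ι → Measurements D N B}
    (hR : ∀ n, IsRealization (ρ n) (Q n))
    (hW : ∀ n, 1 - 1 / (D : ℝ) - ε n ≤ povmWitness φ α κ (born (ρ n) (Q n))) :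
    ∃ τ : ι → Matrix (Fin D) (Fin D) ℂ → Matrix (Fin D) (Fin D) ℂ,
      (∀ n, IsUnitaryOrAntiunitaryConj (τ n)) ∧
      ∀ b, (fun n => opNorm (M b - τ n (Q n (.inr ()) b))) =O[(u : Filter ι)]
        fun n => ε n ^ (1 / 16 : ℝ) := by
  have hbounds := fun n => near_optimal_bounds hD hφ hα hmix κ (hR n) (hW n)
  obtain ⟨P, hP, hPρ, hov⟩ := overlaps_of_near_optimal (l := u) hφ hα (fun n => (hR n).1) hε hε0
    (fun n => (hbounds n).1) fun n => (hbounds n).2.1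
  set θ : ι → ℝ := fun n => ε n ^ (1 / 8 : ℝ) with hθdef
  have hθ : Tendsto θ u (𝓝 0) := by
    have := hε0.rpow_const (p := (1 / 8 : ℝ)) (Or.inr (by norm_num))
    rwa [Real.zero_rpow (by norm_num)] at this
  have hη : Tendsto (fun n => θ n ^ 2) u (𝓝 0) := by simpa using hθ.pow 2
  have hη4 : Tendsto (fun n => θ n ^ 4) u (𝓝 0) := by simpa using hθ.pow 4
  have h41 : (fun n => θ n ^ 4) =O[(u : Filter ι)] θ :=
    ((isBigO_sq_of_tendsto hη).congr_left fun n => by ring).trans (isBigO_sq_of_tendsto hθ)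
  have h81 : ε =O[(u : Filter ι)] θ :=
    ((isBigO_sq_of_tendsto hη4).congr_left fun n => by
      rw [← pow_mul]; exact rpow_eighth_pow (hε n)).trans h41
  obtain ⟨E, hE, F, hF, hEF⟩ := exists_adapted_bases hθ hP hφ hov {x | ∃ b i, κ b i = x} (by
    intro hD2
    obtain ⟨e, he, hne⟩ := hT hD2
    refine ⟨e, he, ?_⟩
    rintro x ⟨b, i, rfl⟩ k
    rw [hκ, basisMatrix_conj_ketbra]
    exact mul_ne_zero (hne b i k) (star_ne_zero.mpr (hne b i k)))
  have hQ := fun n b => (hR n).2 (.inr ()) |>.1 b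
  have hQ1 := fun n b => one_sub_posSemidef_of_povm ((hR n).2 (.inr ())) b
  have hG := fun n b => effect_unitary_conj (hQ n b) (hQ1 n b) (hF n)
  have hGb : ∀ n b j k, ‖((F n)ᴴ * Q n (.inr ()) b * F n) j k‖ ≤ D := fun n b j k =>
    (norm_apply_le_frobenius _ j k).trans (effect_frobenius_le (hG n b).1 (hG n b).2)
  -- expectations of the realized effects in the pure approximations of the kernel states
  have hsmall : ∀ b i, (fun n => (P (κ b i) n * Q n (.inr ()) b).trace.re) =O[(u : Filter ι)] θ := by
    intro b i
    have h1 : (fun n => (ρ n (κ b i) * Q n (.inr ()) b).trace.re) =O[(u : Filter ι)] θ := by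
      refine IsBigO.trans (IsBigO.of_bound 1 (Eventually.of_forall fun n => ?_)) h81
      rw [one_mul, Real.norm_of_nonneg (hε n),
        Real.norm_of_nonneg (trace_mul_nonneg ((hR n).1 _).1 (hQ n b))]
      exact (hbounds n).2.2 b i
    have h2 : ∀ j k, Approx (u : Filter ι) θ (fun n => P (κ b i) n j k - ρ n (κ b i) j k)
        ((0 : Matrix (Fin D) (Fin D) ℂ) j k) := fun j k =>
      (((hPρ (κ b i) j k).trans h41).neg_left).congr_left fun n => by simp
    have h3 := isBigO_trace_sub (R := fun n => P (κ b i) n - ρ n (κ b i))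
      (G := fun n => Q n (.inr ()) b) h2 fun n j k =>
        (norm_apply_le_frobenius _ j k).trans (effect_frobenius_le (hQ n b) (hQ1 n b))
    refine (h1.sub h3).congr_left fun n => ?_
    rw [Matrix.zero_mul, Matrix.trace_zero, Matrix.sub_mul, Matrix.trace_sub, Complex.sub_re,
      Complex.zero_re]
    ring
  have hexp : ∃ τ : ι → Matrix (Fin D) (Fin D) ℂ → Matrix (Fin D) (Fin D) ℂ,
      (∀ n, IsUnitaryOrAntiunitaryConj (τ n)) ∧
      ∀ b i, (fun n => (ketbra (ψ b i) * τ n (Q n (.inr ()) b)).trace.re) =O[(u : Filter ι)] θ := by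
    have htr : ∀ n b i, (((F n)ᴴ * P (κ b i) n * F n) * ((F n)ᴴ * Q n (.inr ()) b * F n)).trace =
        (P (κ b i) n * Q n (.inr ()) b).trace := fun n b i => by
      rw [unitary_conj_mul (hF n), trace_unitary_conj (hF n)]
    rcases hEF with h | h
    · choose τ hτ hτ' using fun n => (exists_conj_between hE (hF n)).1
      refine ⟨τ, hτ, fun b i => ?_⟩
      have h1 := isBigO_trace_sub (G := fun n => (F n)ᴴ * Q n (.inr ()) b * F n)
        (h (κ b i) ⟨b, i, rfl⟩) fun n j k => hGb n b j k
      refine (h1.add (hsmall b i)).congr_left fun n => ?_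
      rw [htr, ← hκ, hτ', sub_add_cancel]
    · choose τ hτ hτ' using fun n => (exists_conj_between hE (hF n)).2
      refine ⟨τ, hτ, fun b i => ?_⟩
      have h1 := isBigO_trace_sub (G := fun n => ((F n)ᴴ * Q n (.inr ()) b * F n)ᵀ)
        (R := fun n => ((F n)ᴴ * P (κ b i) n * F n)ᵀ)
        (fun j k => h (κ b i) ⟨b, i, rfl⟩ k j) fun n j k => hGb n b k j
      refine (h1.add (hsmall b i)).congr_left fun n => ?_
      rw [← Matrix.transpose_mul, Matrix.trace_transpose,
        Matrix.trace_mul_comm _ (_ * P (κ b i) n * _), htr, ← hκ, hτ' _ _ _ (hQ n b).1, sub_add_cancel]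
  obtain ⟨τ, hτ, hτs⟩ := hexp
  refine ⟨τ, hτ, fun b => ?_⟩
  obtain ⟨K, hK⟩ := extremal_povm_stable hM hψ hker
  have hpov := fun n => (hτ n).povm ((hR n).2 (.inr ()))
  have hsqrt : ∀ b i, (fun n => √(ketbra (ψ b i) * τ n (Q n (.inr ()) b)).trace.re)
      =O[(u : Filter ι)] fun n => ε n ^ (1 / 16 : ℝ) := by
    intro b i
    refine IsBigO.of_pow (n := 2) (f := fun n => √(ketbra (ψ b i) * τ n (Q n (.inr ()) b)).trace.re)
      (g := fun n => ε n ^ (1 / 16 : ℝ)) two_ne_zero ?_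
    refine (hτs b i).congr (fun n => ?_) fun n => ?_
    · exact (Real.sq_sqrt (trace_mul_nonneg (ketbra_posSemidef _) ((hpov n).1 b))).symm
    · exact (rpow_sixteenth_sq (hε n)).symm
  have hsum : (fun n => K * ∑ b, ∑ i, √(ketbra (ψ b i) * τ n (Q n (.inr ()) b)).trace.re)
      =O[(u : Filter ι)] fun n => ε n ^ (1 / 16 : ℝ) := by
    refine IsBigO.const_mul_left ?_ K
    have := Approx.sum (l := (u : Filter ι)) (θ := fun n => ε n ^ (1 / 16 : ℝ)) Finset.univ
      fun (b : Fin B) _ => Approx.sum Finset.univ fun (i : Fin (d b)) _ =>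
        (show Approx (u : Filter ι) (fun n => ε n ^ (1 / 16 : ℝ))
          (fun n => √(ketbra (ψ b i) * τ n (Q n (.inr ()) b)).trace.re) 0 from
          (hsqrt b i).congr_left fun n => by rw [sub_zero])
    exact IsBigO.congr_left this fun n => by simp
  refine IsBigO.trans (IsBigO.of_bound 1 (Eventually.of_forall fun n => ?_)) hsum
  rw [one_mul, Real.norm_of_nonneg (show 0 ≤ opNorm _ from norm_nonneg _)]
  exact (hK _ (hpov n) b).trans (le_abs_self _)

theorem exists_opNorm_sub_le (D B : ℕ) : ∃ c : ℝ, ∀ M ∈ povms D B, ∀ Q ∈ povms D B, ∀ b,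
    opNorm (M b - Q b) ≤ c := by
  open scoped Matrix.Norms.Frobenius in
  obtain ⟨c, hc0, hc⟩ := exists_opNorm_le_frobenius (D := D)
  refine ⟨c * (D + D), fun M hM Q hQ b => (hc _).trans (mul_le_mul_of_nonneg_left ?_ hc0)⟩
  exact (norm_sub_le _ _).trans (add_le_add
    (effect_frobenius_le (hM.1 b) (one_sub_posSemidef_of_povm hM b))
    (effect_frobenius_le (hQ.1 b) (one_sub_posSemidef_of_povm hQ b)))

theorem isUnitaryOrAntiunitaryConj_id : IsUnitaryOrAntiunitaryConj
    (id : Matrix (Fin D) (Fin D) ℂ → Matrix (Fin D) (Fin D) ℂ) :=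
  ⟨1, one_mem _, Or.inl fun A => by simp⟩

/-- The constant in the robustness bound exists: a sequence of realizations violating the bound
with constants `n + 1` has a deficit tending to zero, since POVMs are uniformly bounded, and this
contradicts the asymptotic estimate along an ultrafilter. -/
theorem exists_robustness_constant (hD : 0 < D) {M : Fin B → Matrix (Fin D) (Fin D) ℂ}
    (hM : M ∈ Set.extremePoints ℝ (povms D B))
    {d : Fin B → ℕ} {ψ : (b : Fin B) → Fin (d b) → EuclideanSpace ℂ (Fin D)}
    (hψ : ∀ b, Orthonormal ℂ (ψ b))
    (hker : ∀ b, Submodule.span ℂ (Set.range (ψ b)) =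
      LinearMap.ker (Matrix.toEuclideanLin (M b)))
    {φ : Fin N → Matrix (Fin D) (Fin D) ℂ} (hφ : ∀ x, IsPureState (φ x))
    {α : Fin N → ℝ} (hα : ∀ x, 0 < α x)
    (hmix : ∑ x, (α x : ℂ) • φ x = (1 / (D : ℂ)) • (1 : Matrix (Fin D) (Fin D) ℂ))
    {κ : (b : Fin B) → Fin (d b) → Fin N} (hκ : ∀ b i, φ (κ b i) = ketbra (ψ b i))
    (hT : 2 < D → ∃ e : OrthonormalBasis (Fin D) ℂ (EuclideanSpace ℂ (Fin D)),
      fiducialStates e ⊆ Set.range φ ∧ ∀ b i k, inner ℂ (e k) (ψ b i) ≠ 0)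
    {q : ℝ} (hq0 : 0 < q) (hq : q ≤ 1 / 16) :
    ∃ C : ℝ, 0 < C ∧ ∀ ε : ℝ, 0 ≤ ε →
      ∀ (ρ : Fin N → Matrix (Fin D) (Fin D) ℂ) (Q : Measurements D N B), IsRealization ρ Q →
        1 - 1 / (D : ℝ) - ε ≤ povmWitness φ α κ (born ρ Q) →
        ∃ τ : Matrix (Fin D) (Fin D) ℂ → Matrix (Fin D) (Fin D) ℂ,
          IsUnitaryOrAntiunitaryConj τ ∧
          ∀ b : Fin B, opNorm (M b - τ (Q (.inr ()) b)) ≤ C * ε ^ q := by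
  by_contra! hcon
  choose ε hε ρ Q hR hW hbad using fun n : ℕ => hcon (n + 1) (by positivity)
  obtain ⟨c, hc⟩ := exists_opNorm_sub_le D B
  have hpow0 : Tendsto (fun n => ε n ^ q) atTop (𝓝 0) := by
    refine squeeze_zero (g := fun n : ℕ => c * (1 / ((n : ℝ) + 1)))
      (fun n => Real.rpow_nonneg (hε n) q) (fun n => ?_) ?_
    · obtain ⟨b, hb⟩ := hbad n id isUnitaryOrAntiunitaryConj_id
      have h := hb.trans_le (hc M hM.1 _ ((hR n).2 (.inr ())) b)
      rw [mul_one_div, le_div_iff₀ (by positivity), mul_comm]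
      exact h.le
    · simpa using tendsto_one_div_add_atTop_nhds_zero_nat.const_mul c
  have hε0 : Tendsto ε atTop (𝓝 0) := by
    have h := hpow0.rpow_const (p := q⁻¹) (Or.inr (inv_nonneg.mpr hq0.le))
    rw [Real.zero_rpow (inv_ne_zero hq0.ne')] at h
    refine h.congr fun n => ?_
    rw [← Real.rpow_mul (hε n), mul_inv_cancel₀ hq0.ne', Real.rpow_one]
  have hu : ((hyperfilter ℕ : Ultrafilter ℕ) : Filter ℕ) ≤ atTop := Nat.hyperfilter_le_atTop
  obtain ⟨τ, hτ, hO⟩ := exists_conj_isBigO (u := hyperfilter ℕ) hD hM hψ hker hφ hα hmix hκ hT hε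
    (hε0.mono_left hu) hR hW
  have hpow : (fun n => ε n ^ (1 / 16 : ℝ)) =O[((hyperfilter ℕ : Ultrafilter ℕ) : Filter ℕ)]
      fun n => ε n ^ q := by
    refine IsBigO.of_bound 1 ?_
    filter_upwards [(hε0.mono_left hu).eventually_le_const zero_lt_one] with n hn
    rw [one_mul, Real.norm_of_nonneg (Real.rpow_nonneg (hε n) _),
      Real.norm_of_nonneg (Real.rpow_nonneg (hε n) _)]
    exact Real.rpow_le_rpow_of_exponent_ge' (hε n) hn hq0.le hq
  choose C hC using fun b => ((hO b).trans hpow).bound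
  have hev : ∀ᶠ n in ((hyperfilter ℕ : Ultrafilter ℕ) : Filter ℕ), ∀ b,
      opNorm (M b - τ n (Q n (.inr ()) b)) ≤ ((n : ℝ) + 1) * ε n ^ q := by
    refine eventually_all.mpr fun b => ?_
    have hlarge : ∀ᶠ n : ℕ in atTop, C b ≤ n :=
      tendsto_natCast_atTop_atTop.eventually_ge_atTop (C b)
    filter_upwards [hC b, hlarge.filter_mono hu] with n h1 h2
    rw [Real.norm_of_nonneg (Real.rpow_nonneg (hε n) _)] at h1
    exact (le_abs_self _).trans (h1.trans (mul_le_mul_of_nonneg_right (by linarith)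
      (Real.rpow_nonneg (hε n) _)))
  obtain ⟨n, hn⟩ := hev.exists
  obtain ⟨b, hb⟩ := hbad n (τ n) (hτ n)
  exact absurd (hn b) (not_le.mpr hb)

end SelfTest

end PrepareMeasure

theorem mainTheorem4
    (D B N : ℕ) (hD : 0 < D)
    -- an extremal POVM
    (M : Fin B → Matrix (Fin D) (Fin D) ℂ)
    (hM : M ∈ Set.extremePoints ℝ (PrepareMeasure.povms D B))
    -- an orthonormal basis of the kernel of each element
    (d : Fin B → ℕ) (ψ : (b : Fin B) → Fin (d b) → EuclideanSpace ℂ (Fin D))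
    (hψ : ∀ b, Orthonormal ℂ (ψ b))
    (hker : ∀ b, Submodule.span ℂ (Set.range (ψ b)) =
      LinearMap.ker (Matrix.toEuclideanLin (M b)))
    -- a weighted ensemble of pure states that averages to the maximally mixed state
    (φ : Fin N → Matrix (Fin D) (Fin D) ℂ) (hφ : ∀ x, PrepareMeasure.IsPureState (φ x))
    (α : Fin N → ℝ) (hα : ∀ x, 0 < α x)
    (hmix : ∑ x, (α x : ℂ) • φ x = (1 / (D : ℂ)) • (1 : Matrix (Fin D) (Fin D) ℂ))
    -- it contains the kernel states and, in dimension above two, the fiducial states of a basis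
    -- in which the kernel vectors have no zero coordinate
    (κ : (b : Fin B) → Fin (d b) → Fin N)
    (hκ : ∀ b i, φ (κ b i) = PrepareMeasure.ketbra (ψ b i))
    (hT : 2 < D → ∃ e : OrthonormalBasis (Fin D) ℂ (EuclideanSpace ℂ (Fin D)),
      PrepareMeasure.fiducialStates e ⊆ Set.range φ ∧
        ∀ b i k, inner ℂ (e k) (ψ b i) ≠ 0) :
    -- the maximal quantum value of the witness
    IsGreatest
      (PrepareMeasure.povmWitness φ α κ '' PrepareMeasure.quantumSet D N B)
      (1 - 1 / (D : ℝ)) ∧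
    -- robustness
    (∃ C : ℝ, 0 < C ∧ ∀ ε : ℝ, 0 ≤ ε →
      ∀ (ρ : Fin N → Matrix (Fin D) (Fin D) ℂ) (Q : PrepareMeasure.Measurements D N B),
        PrepareMeasure.IsRealization ρ Q →
        1 - 1 / (D : ℝ) - ε ≤
          PrepareMeasure.povmWitness φ α κ (PrepareMeasure.born ρ Q) →
        ∃ τ : Matrix (Fin D) (Fin D) ℂ → Matrix (Fin D) (Fin D) ℂ,
          PrepareMeasure.IsUnitaryOrAntiunitaryConj τ ∧
          ∀ b : Fin B, PrepareMeasure.opNorm (M b - τ (Q (.inr ()) b)) ≤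
            C * ε ^ (if D = 2 then (1 / 16 : ℝ) else (1 / 32 : ℝ))) ∧
    -- exact self-testing
    (∀ (ρ : Fin N → Matrix (Fin D) (Fin D) ℂ) (Q : PrepareMeasure.Measurements D N B),
      PrepareMeasure.IsRealization ρ Q →
      PrepareMeasure.povmWitness φ α κ (PrepareMeasure.born ρ Q) = 1 - 1 / (D : ℝ) →
      ∃ τ : Matrix (Fin D) (Fin D) ℂ → Matrix (Fin D) (Fin D) ℂ,
        PrepareMeasure.IsUnitaryOrAntiunitaryConj τ ∧
        ∀ b : Fin B, Q (.inr ()) b = τ (M b)) := by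
  have hq0 : (0 : ℝ) < if D = 2 then (1 / 16 : ℝ) else (1 / 32 : ℝ) := by split_ifs <;> norm_num
  have hrob := PrepareMeasure.exists_robustness_constant hD hM hψ hker hφ hα hmix hκ hT hq0
    (by split_ifs <;> norm_num)
  refine ⟨⟨?_, ?_⟩, hrob, ?_⟩
  · have hzero : ∀ b i, (φ (κ b i) * M b).trace.re = 0 := by
      intro b i
      rw [hκ, Matrix.trace_mul_comm, PrepareMeasure.mul_ketbra_eq_zero (hker b) i,
        Matrix.trace_zero, Complex.zero_re]
    obtain ⟨Q, hQ, hW⟩ := PrepareMeasure.exists_realization_eq hD hφ hmix κ hM.1 hzero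
    exact ⟨_, ⟨φ, Q, hQ, rfl⟩, hW⟩
  · rintro _ ⟨_, ⟨ρ, Q, hR, rfl⟩, rfl⟩
    exact PrepareMeasure.povmWitness_le hD hφ hα hmix κ hR
  · intro ρ Q hR hW
    obtain ⟨C, -, hC⟩ := hrob
    obtain ⟨τ, hτ, hle⟩ := hC 0 le_rfl ρ Q hR (by rw [hW, sub_zero])
    obtain ⟨σ, hσ, hστ⟩ := hτ.exists_inverse
    refine ⟨σ, hσ, fun b => ?_⟩
    have h0 := hle b
    rw [Real.zero_rpow hq0.ne', mul_zero] at h0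
    have h1 : Matrix.toEuclideanCLM (n := Fin D) (𝕜 := ℂ) (M b - τ (Q (.inr ()) b)) = 0 :=
      norm_le_zero_iff.mp h0
    have h2 : M b - τ (Q (.inr ()) b) = 0 := (map_eq_zero_iff _ (EquivLike.injective _)).mp h1
    rw [sub_eq_zero.mp h2, hστ]
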